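/- Let $(\mathcal V,\otimes,\underline{\mathrm{Hom}},e)$ be a closed symmetric monoidal Grothendieck category whose derived category $D(\mathcal V)$ is compactly generated with a set of compact generators $\{P_j\}_{j\in J}$ (complexes $P_j\in \mathrm{Ch}(\mathcal V)$ that are compact in $D(\mathcal V)$ and such that $Y=0$ whenever $\mathrm{Hom}_{D(\mathcal V)}(P_j,Y[n])=0$ for all $j\in J$, $n\in\mathbb Z$). Let $\mathcal C$ be a small $\mathcal V$-category, let $[\mathcal C,\mathcal V]$ be the Grothendieck category of $\mathcal V$-functors $\mathcal C\to\mathcal V$ and $\mathcal V$-natural transformations, and $D[\mathcal C,\mathcal V]$ its derived category. Assume that at least one of the following holds, with complexes $Q_j\in\mathrm{Ch}(\mathcal V)$ as indicated: 1. each $P_j$ is K-projective; $Q_j=P_j$; 2. for every K-injective $Y\in \mathrm{Ch}[\mathcal C,\mathcal V]$ and every $c\in\mathcal C$ the complex $Y(c)$ is K-injective; $Q_j=P_j$; 3. $\mathrm{Ch}(\mathcal V)$ has a model structure whose weak equivalences are the quasi-isomorphisms, such that $Y(c)$ is fibrant for every $c\in\mathcal C$ and every injective fibrant complex $Y\in\mathrm{Ch}[\mathcal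 C,\mathcal V]$ (that is, every $Y$ such that all morphisms to $Y$ extend along monomorphisms that are quasi-isomorphisms); $Q_j$ is a cofibrant replacement of $P_j$ (a cofibrant complex with a quasi-isomorphism $Q_j\to P_j$) for which the inclusion $Q_j\to\mathrm{cone}(\mathrm{id}_{Q_j})$ is a cofibration, i.e. the chain-level cylinder of $Q_j$ is a cylinder object of the model structure. Let $\mathcal A\subset\mathcal C$ be a full $\mathcal V$-subcategory. Let $$\mathcal E_{\mathcal A}=\{Y\in D[\mathcal C,\mathcal V]\mid H_n(Y(a))=0\text{ for all }a\in\mathcal A,\ n\in\mathbb Z\},$$ let $\iota:\mathcal E_{\mathcal A}\to D[\mathcal C,\mathcal V]$ be the inclusion, and let $\rho:D[\mathcal C,\mathcal V]\to D[\mathcal A,\mathcal V]$ be induced by the exact restriction functor $[\mathcal C,\mathcal V]\to[\mathcal A,\mathcal V]$. Let $r_R:[\mathcal A,\mathcal V]\to[\mathcal C,\mathcal V]$, $(r_RH)(c)=\int_{b\in\mathcal A}\underline{\mathrm{Hom}}(\mathcal V_{\mathcal C}(c,b),H(b))$, be the enriched right Kan extension. Let $\mathcal V_{\mathcal C}(a,-)\oslash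 Q_j$ be the complex $c\mapsto \mathcal V_{\mathcal C}(a,c)\otimes Q_j$, let $\mathcal T_{\mathcal A}\subset D[\mathcal C,\mathcal V]$ be the smallest localizing subcategory containing $\mathcal V_{\mathcal C}(a,-)\oslash Q_j$ for all $a\in\mathcal A$, $j\in J$, and let $\tau_L:\mathcal T_{\mathcal A}\to D[\mathcal C,\mathcal V]$ be the inclusion. Then $F=\rho\circ\tau_L:\mathcal T_{\mathcal A}\to D[\mathcal A,\mathcal V]$ is an equivalence of categories, and there is a recollement of triangulated categories $$\mathcal E_{\mathcal A}\xrightarrow{\ \iota\ }D[\mathcal C,\mathcal V]\xrightarrow{\ \rho\ }D[\mathcal A,\mathcal V],$$ that is, there are triangulated functors $\iota_L,\iota_R:D[\mathcal C,\mathcal V]\to\mathcal E_{\mathcal A}$ and $\rho_L,\rho_R:D[\mathcal A,\mathcal V]\to D[\mathcal C,\mathcal V]$ with $\iota_L\dashv\iota\dashv\iota_R$ and $\rho_L\dashv\rho\dashv\rho_R$, the functors $\iota,\rho_L,\rho_R$ are fully faithful, and $\mathrm{Im}\,\iota=\mathrm{Ker}\,\rho$. Moreover $\rho_L\cong\tau_L\circ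 F^{-1}$, and $\rho_R$ takes $Y$ to $r_R(kY)$, where $Y\to kY$ is a K-injective resolution of $Y$ in $\mathrm{Ch}[\mathcal A,\mathcal V]$ (such resolutions exist) and $r_R$ is applied degreewise; more precisely there is a natural transformation $r_R(K)\to\rho_R(K)$ in $D[\mathcal C,\mathcal V]$, for $K\in\mathrm{Ch}[\mathcal A,\mathcal V]$, which is an isomorphism when $K$ is K-injective. -/

import Mathlib

open CategoryTheory CategoryTheory.Limits

universe w₁ w₂ w₃ v u

namespace EnrichedDerived

noncomputable section

open MonoidalCategory MonoidalClosed

section Functors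

variable (V : Type u) [Category.{v} V] [MonoidalCategory V] [MonoidalClosed V]
variable (C : Type v) [EnrichedCategory V C]

/-- A `V`-functor from the small `V`-category `C` to `V`, where `V` is enriched over itself by its
internal Hom-objects. (This wrapper of Mathlib's `EnrichedFunctor` carries the category structure
given by `V`-natural transformations, see `VFun.Hom`.) -/
structure VFun extends EnrichedFunctor V C V

variable {V C}

namespace VFun

/-- The action `X a ⊗ C(a, b) ⟶ X b` that corresponds under the closed structure to the structure
morphism `C(a, b) ⟶ [X a, X b]` of a `V`-functor `X`. -/
def act (X : VFun V C) (a b : C) : X.obj a ⊗ (a ⟶[V] b) ⟶ X.obj b :=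
  uncurry (X.map a b)

lemma act_id (X : VFun V C) (a : C) : X.obj a ◁ eId V a ≫ X.act a a = (ρ_ (X.obj a)).hom := by
  have h := X.map_id a
  have := congrArg (uncurry (A := X.obj a) (X := X.obj a)) h
  erw [uncurry_natural_left] at this
  exact this.trans (uncurry_curry (ρ_ (X.obj a)).hom)

lemma uncurry_tensor_comp {x y z p q : V} (f : p ⟶ (ihom x).obj y) (g : q ⟶ (ihom y).obj z) :
    uncurry ((f ⊗ₘ g) ≫ MonoidalClosed.comp x y z) =
      (α_ x p q).inv ≫ uncurry f ▷ q ≫ uncurry g := by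
  rw [uncurry_natural_left, MonoidalClosed.comp_eq, uncurry_curry, compTranspose_eq,
    uncurry_eq f, uncurry_eq g,
    MonoidalCategory.tensorHom_def]
  simp only [MonoidalCategory.whiskerLeft_comp, comp_whiskerRight, Category.assoc]
  rw [associator_inv_naturality_right_assoc, associator_inv_naturality_middle_assoc,
    whisker_exchange_assoc]
  rfl

lemma act_comp (X : VFun V C) (a b c : C) :
    X.obj a ◁ eComp V a b c ≫ X.act a c =
      (α_ _ _ _).inv ≫ X.act a b ▷ _ ≫ X.act b c := by
  have h := X.map_comp a b c
  have := congrArg (uncurry (A := X.obj a) (X := X.obj c)) h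
  erw [uncurry_natural_left] at this
  exact this.trans (uncurry_tensor_comp _ _)

/-- A `V`-functor is the same as a family of objects with a unital and associative action. -/
def ofAct (obj : C → V) (act : ∀ a b, obj a ⊗ (a ⟶[V] b) ⟶ obj b)
    (act_id : ∀ a, obj a ◁ eId V a ≫ act a a = (ρ_ (obj a)).hom)
    (act_comp : ∀ a b c, obj a ◁ eComp V a b c ≫ act a c =
      (α_ _ _ _).inv ≫ act a b ▷ _ ≫ act b c) : VFun V C where
  obj := obj
  map a b := curry (act a b)
  map_id a := by
    apply uncurry_injective (A := obj a) (X := obj a)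
    erw [uncurry_natural_left, uncurry_curry, act_id]
    exact (uncurry_curry (ρ_ (obj a)).hom).symm
  map_comp a b c := by
    apply uncurry_injective (A := obj a) (X := obj c)
    refine Eq.trans ?_ (uncurry_tensor_comp _ _).symm
    erw [uncurry_natural_left, uncurry_curry, uncurry_curry, uncurry_curry]
    exact act_comp a b c

@[simp]
lemma ofAct_obj (obj : C → V) (act h₁ h₂) (a : C) :
    (ofAct (V := V) (C := C) obj act h₁ h₂).obj a = obj a := rfl

@[simp]
lemma ofAct_act (obj : C → V) (act h₁ h₂) (a b : C) :
    (ofAct (V := V) (C := C) obj act h₁ h₂).act a b = act a b :=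
  uncurry_curry _

/-- A `V`-natural transformation of `V`-functors `X, Y : C → V`: a family of morphisms
`X a ⟶ Y a` of `V` (equivalently, of morphisms `e ⟶ [X a, Y a]`) such that the two morphisms
`X a ⊗ C(a, b) ⟶ Y b` (equivalently, `C(a, b) ⟶ [X a, Y b]`) agree for all `a` and `b`. -/
@[ext]
structure Hom (X Y : VFun V C) where
  app (a : C) : X.obj a ⟶ Y.obj a
  naturality (a b : C) : X.act a b ≫ app b = app a ▷ (a ⟶[V] b) ≫ Y.act a b

instance : Category.{v} (VFun V C) where
  Hom := Hom
  id X := { app := fun a => 𝟙 (X.obj a), naturality := fun a b => by simp }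
  comp f g :=
    { app := fun a => f.app a ≫ g.app a
      naturality := fun a b => by
        rw [← Category.assoc, f.naturality, Category.assoc, g.naturality]
        simp }
  id_comp f := by apply Hom.ext; funext a; exact Category.id_comp _
  comp_id f := by apply Hom.ext; funext a; exact Category.comp_id _
  assoc f g h := by apply Hom.ext; funext a; exact Category.assoc _ _ _

@[ext]
lemma hom_ext {X Y : VFun V C} {f g : X ⟶ Y} (h : ∀ a, Hom.app f a = Hom.app g a) : f = g :=
  Hom.ext (funext h)

@[simp] lemma id_app (X : VFun V C) (a : C) : Hom.app (𝟙 X) a = 𝟙 (X.obj a) := rfl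

@[simp] lemma comp_app {X Y Z : VFun V C} (f : X ⟶ Y) (g : Y ⟶ Z) (a : C) :
    Hom.app (f ≫ g) a = Hom.app f a ≫ Hom.app g a := rfl

variable (V) in
/-- Evaluation at an object `c`. -/
def ev (c : C) : VFun V C ⥤ V where
  obj X := X.obj c
  map f := Hom.app f c

@[simp] lemma ev_obj (c : C) (X : VFun V C) : (ev V c).obj X = X.obj c := rfl
@[simp] lemma ev_map (c : C) {X Y : VFun V C} (f : X ⟶ Y) : (ev V c).map f = Hom.app f c := rfl

/-- Isomorphisms are detected pointwise. -/
lemma isIso_of_app {X Y : VFun V C} (f : X ⟶ Y) (h : ∀ a, IsIso (Hom.app f a)) : IsIso f := by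
  refine ⟨⟨{ app := fun a => inv (Hom.app f a), naturality := fun a b => ?_ }, ?_, ?_⟩⟩
  · rw [IsIso.comp_inv_eq, Category.assoc, Hom.naturality, ← comp_whiskerRight_assoc]
    simp
  · ext a; exact IsIso.hom_inv_id _
  · ext a; exact IsIso.inv_hom_id _

end VFun

end Functors

section Abelian

variable {V : Type u} [Category.{v} V] [MonoidalCategory V] [MonoidalClosed V]
  [SymmetricCategory V] [Abelian V]

variable (V) in
/-- In a closed symmetric monoidal abelian category the tensor product is biadditive. -/
lemma monoidalPreadditive : MonoidalPreadditive V := by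
  have hl : ∀ X : V, (tensorLeft X).Additive := fun X =>
    have : PreservesBinaryBiproducts (tensorLeft X) :=
      preservesBinaryBiproducts_of_preservesBinaryCoproducts _
    Functor.additive_of_preservesBinaryBiproducts _
  have hr : ∀ X : V, (tensorRight X).Additive := fun X =>
    have : PreservesBinaryBiproducts (tensorRight X) :=
      preservesBinaryBiproducts_of_preservesBinaryCoproducts _
    Functor.additive_of_preservesBinaryBiproducts _
  constructor
  · intro X Y Z; exact (tensorLeft X).map_zero Y Z
  · intro X Y Z; exact (tensorRight X).map_zero Y Z
  · intro X Y Z f g; exact (tensorLeft X).map_add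
  · intro X Y Z f g; exact (tensorRight X).map_add

attribute [local instance] monoidalPreadditive

variable {C : Type v} [EnrichedCategory V C]

namespace VFun

instance (X Y : VFun V C) : Zero (X ⟶ Y) :=
  ⟨{ app := fun _ => 0, naturality := fun a b => by simp }⟩
instance (X Y : VFun V C) : Add (X ⟶ Y) :=
  ⟨fun f g =>
    { app := fun a => Hom.app f a + Hom.app g a
      naturality := fun a b => by
        simp [Hom.naturality, MonoidalPreadditive.add_whiskerRight] }⟩
instance (X Y : VFun V C) : Neg (X ⟶ Y) :=
  ⟨fun f =>
    { app := fun a => -Hom.app f a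
      naturality := fun a b => by
        have : (-Hom.app f a) ▷ (a ⟶[V] b) = -(Hom.app f a ▷ (a ⟶[V] b)) :=
          (tensorRight (a ⟶[V] b)).map_neg
        simp [Hom.naturality, this] }⟩

@[simp] lemma zero_app (X Y : VFun V C) (a : C) : Hom.app (0 : X ⟶ Y) a = 0 := rfl
@[simp] lemma add_app {X Y : VFun V C} (f g : X ⟶ Y) (a : C) :
    Hom.app (f + g) a = Hom.app f a + Hom.app g a := rfl
@[simp] lemma neg_app {X Y : VFun V C} (f : X ⟶ Y) (a : C) :
    Hom.app (-f) a = -Hom.app f a := rfl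

instance (X Y : VFun V C) : AddCommGroup (X ⟶ Y) where
  add_assoc f g h := by ext a; exact add_assoc _ _ _
  zero_add f := by ext a; exact zero_add _
  add_zero f := by ext a; exact add_zero _
  nsmul := nsmulRec
  zsmul := zsmulRec
  neg_add_cancel f := by ext a; exact neg_add_cancel _
  add_comm f g := by ext a; exact add_comm _ _

instance : Preadditive (VFun V C) where

instance (c : C) : (ev V c).Additive where

/-! Finite products and kernels are computed pointwise. -/

lemma jm_id {V : Type u} [Category.{v} V] [MonoidalCategory V] [MonoidalClosed V]
    {C : Type v} [EnrichedCategory V C] {K : Type} (T : K → VFun V C) (L : C → V)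
    (p : ∀ a j, L a ⟶ (T j).obj a)
    (hp : ∀ (a : C) {Z : V} (f g : Z ⟶ L a), (∀ j, f ≫ p a j = g ≫ p a j) → f = g)
    (act : ∀ a b, L a ⊗ (a ⟶[V] b) ⟶ L b)
    (h : ∀ a b j, act a b ≫ p b j = p a j ▷ (a ⟶[V] b) ≫ (T j).act a b) (a : C) :
    L a ◁ eId V a ≫ act a a = (ρ_ (L a)).hom := by
  apply hp; intro j
  rw [Category.assoc, h, whisker_exchange_assoc, act_id]
  exact rightUnitor_naturality _

lemma jm_comp {V : Type u} [Category.{v} V] [MonoidalCategory V] [MonoidalClosed V]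
    {C : Type v} [EnrichedCategory V C] {K : Type} (T : K → VFun V C) (L : C → V)
    (p : ∀ a j, L a ⟶ (T j).obj a)
    (hp : ∀ (a : C) {Z : V} (f g : Z ⟶ L a), (∀ j, f ≫ p a j = g ≫ p a j) → f = g)
    (act : ∀ a b, L a ⊗ (a ⟶[V] b) ⟶ L b)
    (h : ∀ a b j, act a b ≫ p b j = p a j ▷ (a ⟶[V] b) ≫ (T j).act a b) (a b c : C) :
    L a ◁ eComp V a b c ≫ act a c = (α_ _ _ _).inv ≫ act a b ▷ _ ≫ act b c := by
  apply hp; intro j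
  simp only [Category.assoc, h]
  rw [whisker_exchange_assoc, act_comp, ← comp_whiskerRight_assoc, h, comp_whiskerRight,
    Category.assoc, associator_inv_naturality_left_assoc]

section Products

variable {K : Type} [Finite K] (T : K → VFun V C)

def prodAct (a b : C) : (∏ᶜ fun j => (T j).obj a) ⊗ (a ⟶[V] b) ⟶ ∏ᶜ fun j => (T j).obj b :=
  Pi.lift fun j => Pi.π (fun j => (T j).obj a) j ▷ _ ≫ (T j).act a b

lemma prodAct_π (a b : C) (j : K) : prodAct T a b ≫ Pi.π (fun j => (T j).obj b) j =
    Pi.π (fun j => (T j).obj a) j ▷ _ ≫ (T j).act a b := by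
  simp [prodAct]

def prodObj : VFun V C :=
  ofAct (fun a => ∏ᶜ fun j => (T j).obj a) (prodAct T)
    (jm_id T _ (fun a j => Pi.π (fun j => (T j).obj a) j) (fun _ _ _ _ h => Pi.hom_ext _ _ h) _
      (prodAct_π T))
    (jm_comp T _ (fun a j => Pi.π (fun j => (T j).obj a) j) (fun _ _ _ _ h => Pi.hom_ext _ _ h) _
      (prodAct_π T))

lemma prodObj_act (a b : C) : (prodObj T).act a b = prodAct T a b := ofAct_act _ _ _ _ a b

def prodFan : Fan T :=
  Fan.mk (prodObj T) fun j =>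
    { app := fun a => Pi.π (fun j => (T j).obj a) j
      naturality := fun a b => by rw [prodObj_act]; exact prodAct_π T a b j }

lemma prodLift_nat {Z : VFun V C} (g : ∀ j, Z ⟶ T j) (a b : C) :
    Z.act a b ≫ Pi.lift (fun j => Hom.app (g j) b) =
      Pi.lift (fun j => Hom.app (g j) a) ▷ _ ≫ prodAct T a b := by
  refine Pi.hom_ext _ _ fun j => ?_
  rw [Category.assoc, Category.assoc, prodAct_π, Pi.lift_π, ← comp_whiskerRight_assoc,
    Pi.lift_π, Hom.naturality]

def prodLift {Z : VFun V C} (g : ∀ j, Z ⟶ T j) : Z ⟶ prodObj T where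
  app a := Pi.lift fun j => Hom.app (g j) a
  naturality a b :=
    (prodLift_nat T g a b).trans (congrArg (fun t => _ ≫ t) (prodObj_act T a b).symm)

def prodFanIsLimit : IsLimit (prodFan T) :=
  Fan.IsLimit.mk _ (fun s => prodLift T s.proj)
    (fun s j => by ext a; exact Pi.lift_π _ _)
    (fun s m h => by
      ext a
      refine Pi.hom_ext _ _ fun j => ?_
      exact (congrArg (fun t => Hom.app t a) (h j)).trans
        (Pi.lift_π (fun j => Hom.app (s.proj j) a) j).symm)

end Products

instance : HasFiniteProducts (VFun V C) where
  out _ :=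
    { has_limit := fun F =>
        have : HasLimit (Discrete.functor (F.obj ∘ Discrete.mk)) :=
          ⟨⟨⟨_, prodFanIsLimit (F.obj ∘ Discrete.mk)⟩⟩⟩
        hasLimit_of_iso (Discrete.natIsoFunctor (F := F)).symm }

section Kernels

variable {X Y : VFun V C} (f : X ⟶ Y)

def kerAct (a b : C) : kernel (Hom.app f a) ⊗ (a ⟶[V] b) ⟶ kernel (Hom.app f b) :=
  kernel.lift _ (kernel.ι (Hom.app f a) ▷ _ ≫ X.act a b) (by
    rw [Category.assoc, Hom.naturality, ← comp_whiskerRight_assoc, kernel.condition]; simp)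

lemma kerAct_ι (a b : C) : kerAct f a b ≫ kernel.ι (Hom.app f b) =
    kernel.ι (Hom.app f a) ▷ _ ≫ X.act a b := kernel.lift_ι _ _ _

def kerObj : VFun V C :=
  ofAct (fun a => kernel (Hom.app f a)) (kerAct f)
    (jm_id (fun _ : Unit => X) _ (fun a _ => kernel.ι (Hom.app f a))
      (fun _ _ _ _ h => (cancel_mono _).1 (h ())) _ (fun a b _ => kerAct_ι f a b))
    (jm_comp (fun _ : Unit => X) _ (fun a _ => kernel.ι (Hom.app f a))
      (fun _ _ _ _ h => (cancel_mono _).1 (h ())) _ (fun a b _ => kerAct_ι f a b))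

lemma kerObj_act (a b : C) : (kerObj f).act a b = kerAct f a b := ofAct_act _ _ _ _ a b

def kerι : kerObj f ⟶ X where
  app a := kernel.ι (Hom.app f a)
  naturality a b := by rw [kerObj_act]; exact kerAct_ι f a b

lemma kerι_comp : kerι f ≫ f = 0 := by ext a; exact kernel.condition _

lemma kerLift_nat {Z : VFun V C} (g : Z ⟶ X) (w : ∀ a, Hom.app g a ≫ Hom.app f a = 0) (a b : C) :
    Z.act a b ≫ kernel.lift _ (Hom.app g b) (w b) =
      kernel.lift _ (Hom.app g a) (w a) ▷ _ ≫ kerAct f a b := by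
  refine (cancel_mono (kernel.ι (Hom.app f b))).1 ?_
  rw [Category.assoc, Category.assoc, kerAct_ι, kernel.lift_ι, ← comp_whiskerRight_assoc,
    kernel.lift_ι, Hom.naturality]

def kerLift {Z : VFun V C} (g : Z ⟶ X) (w : g ≫ f = 0) : Z ⟶ kerObj f where
  app a := kernel.lift _ (Hom.app g a) (congrArg (fun t => Hom.app t a) w)
  naturality a b :=
    (kerLift_nat f g (fun a => congrArg (fun t => Hom.app t a) w) a b).trans
      (congrArg (fun t => _ ≫ t) (kerObj_act f a b).symm)

def kerIsLimit : IsLimit (KernelFork.ofι (kerι f) (kerι_comp f)) :=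
  KernelFork.IsLimit.ofι _ _ (fun g w => kerLift f g w)
    (fun g w => by ext a; exact kernel.lift_ι _ _ _)
    (fun g w m h => by
      ext a
      refine (cancel_mono (kernel.ι (Hom.app f a))).1 ?_
      exact (congrArg (fun t => Hom.app t a) h).trans (kernel.lift_ι _ _ _).symm)

instance : HasKernels (VFun V C) where
  has_limit f := ⟨⟨⟨_, kerIsLimit f⟩⟩⟩

instance (c : C) : PreservesLimit (parallelPair f 0) (ev V c) :=
  preservesLimit_of_preserves_limit_cone (kerIsLimit f)
    ((KernelFork.isLimitMapConeEquiv _ (ev V c)).symm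
      (kernelIsKernel (Hom.app f c)))

end Kernels

/-! Cokernels are computed pointwise. -/

section Cokernels

variable {X Y : VFun V C} (f : X ⟶ Y)

instance (a b : C) : Epi (cokernel.π (Hom.app f a) ▷ (a ⟶[V] b)) :=
  inferInstanceAs (Epi ((tensorRight (a ⟶[V] b)).map (cokernel.π (Hom.app f a))))

instance (a : C) (Z : V) : Epi (cokernel.π (Hom.app f a) ▷ Z) :=
  inferInstanceAs (Epi ((tensorRight Z).map (cokernel.π (Hom.app f a))))

instance (a : C) (Z : V) : Epi (Z ◁ cokernel.π (Hom.app f a)) :=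
  inferInstanceAs (Epi ((tensorLeft Z).map (cokernel.π (Hom.app f a))))

def cokAct (a b : C) : cokernel (Hom.app f a) ⊗ (a ⟶[V] b) ⟶ cokernel (Hom.app f b) :=
  (CokernelCofork.mapIsColimit _ (cokernelIsCokernel (Hom.app f a))
    (tensorRight (a ⟶[V] b))).desc
      (CokernelCofork.ofπ (Y.act a b ≫ cokernel.π (Hom.app f b)) (by
        have := Hom.naturality f a b
        dsimp
        rw [← Category.assoc, ← this, Category.assoc, cokernel.condition, comp_zero]))

lemma π_cokAct (a b : C) : cokernel.π (Hom.app f a) ▷ _ ≫ cokAct f a b =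
    Y.act a b ≫ cokernel.π (Hom.app f b) :=
  (CokernelCofork.mapIsColimit _ (cokernelIsCokernel (Hom.app f a))
    (tensorRight (a ⟶[V] b))).fac _ WalkingParallelPair.one

def cokObj : VFun V C :=
  ofAct (fun a => cokernel (Hom.app f a)) (cokAct f)
    (fun a => by
      refine (cancel_epi (cokernel.π (Hom.app f a) ▷ _)).1 ?_
      rw [← whisker_exchange_assoc, π_cokAct, ← Category.assoc, act_id]
      exact (rightUnitor_naturality _).symm)
    (fun a b c => by
      refine (cancel_epi (cokernel.π (Hom.app f a) ▷ _)).1 ?_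
      rw [← whisker_exchange_assoc, π_cokAct, ← Category.assoc, act_comp,
        associator_inv_naturality_left_assoc, ← comp_whiskerRight_assoc, π_cokAct]
      simp only [Category.assoc, comp_whiskerRight, π_cokAct])

lemma cokObj_act (a b : C) : (cokObj f).act a b = cokAct f a b := ofAct_act _ _ _ _ a b

def cokπ : Y ⟶ cokObj f where
  app a := cokernel.π (Hom.app f a)
  naturality a b := by rw [cokObj_act]; exact (π_cokAct f a b).symm

lemma comp_cokπ : f ≫ cokπ f = 0 := by ext a; exact cokernel.condition _

lemma cokDesc_nat {Z : VFun V C} (g : Y ⟶ Z) (w : ∀ a, Hom.app f a ≫ Hom.app g a = 0) (a b : C) :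
    cokAct f a b ≫ cokernel.desc _ (Hom.app g b) (w b) =
      cokernel.desc _ (Hom.app g a) (w a) ▷ _ ≫ Z.act a b := by
  refine (cancel_epi (cokernel.π (Hom.app f a) ▷ (a ⟶[V] b))).1 ?_
  rw [← Category.assoc, π_cokAct, Category.assoc, cokernel.π_desc, ← comp_whiskerRight_assoc,
    cokernel.π_desc, Hom.naturality]

def cokDesc {Z : VFun V C} (g : Y ⟶ Z) (w : f ≫ g = 0) : cokObj f ⟶ Z where
  app a := cokernel.desc _ (Hom.app g a) (congrArg (fun t => Hom.app t a) w)
  naturality a b :=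
    (congrArg (fun t => t ≫ _) (cokObj_act f a b)).trans
      (cokDesc_nat f g (fun a => congrArg (fun t => Hom.app t a) w) a b)

def cokIsColimit : IsColimit (CokernelCofork.ofπ (cokπ f) (comp_cokπ f)) :=
  CokernelCofork.IsColimit.ofπ _ _ (fun g w => cokDesc f g w)
    (fun g w => by ext a; exact cokernel.π_desc _ _ _)
    (fun g w m h => by
      ext a
      refine (cancel_epi (cokernel.π (Hom.app f a))).1 ?_
      exact (congrArg (fun t => Hom.app t a) h).trans (cokernel.π_desc _ _ _).symm)

instance : HasCokernels (VFun V C) where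
  has_colimit f := ⟨⟨⟨_, cokIsColimit f⟩⟩⟩

instance (c : C) : PreservesColimit (parallelPair f 0) (ev V c) :=
  preservesColimit_of_preserves_colimit_cocone (cokIsColimit f)
    ((CokernelCofork.isColimitMapCoconeEquiv _ (ev V c)).symm
      (cokernelIsCokernel (Hom.app f c)))

end Cokernels

/-- `[C, V]` is an abelian category, with pointwise kernels and cokernels. -/
instance : Abelian (VFun V C) :=
  have : ∀ {X Y : VFun V C} (f : X ⟶ Y), IsIso (Abelian.coimageImageComparison f) := fun f => by
    apply isIso_of_app
    intro a
    have e := Abelian.PreservesCoimageImageComparison.iso (ev V a) f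
    exact (MorphismProperty.isomorphisms V).arrow_mk_iso_iff e |>.2
      (MorphismProperty.isomorphisms.infer_property _)
  Abelian.ofCoimageImageComparisonIsIso

instance (c : C) : (ev V c).PreservesHomology where
  preservesKernels _ _ _ := inferInstance
  preservesCokernels _ _ _ := inferInstance

instance (c : C) : PreservesFiniteLimits (ev V c) :=
  (ev V c).preservesFiniteLimits_of_preservesHomology
instance (c : C) : PreservesFiniteColimits (ev V c) :=
  (ev V c).preservesFiniteColimits_of_preservesHomology

variable (V) in
/-- The functor `g ↦ C(c, -) ⊘ g` from `V` to `[C, V]`, where `(C(c, -) ⊘ g) b` is the tensor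
product of `g` and `C(c, b)`. -/
def reprTensor (c : C) : V ⥤ VFun V C where
  obj g := ofAct (fun b => g ⊗ (c ⟶[V] b))
    (fun a b => (α_ g (c ⟶[V] a) (a ⟶[V] b)).hom ≫ g ◁ eComp V c a b)
    (fun a => by
      have := e_comp_id V c a
      rw [Iso.inv_comp_eq, Category.comp_id] at this
      rw [associator_naturality_right_assoc, ← MonoidalCategory.whiskerLeft_comp, this]
      simp)
    (fun a b d => by
      have := e_assoc V c a b d
      rw [Iso.inv_comp_eq] at this
      simp only [comp_whiskerRight, Category.assoc, associator_naturality_right_assoc,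
        associator_naturality_middle_assoc]
      rw [← MonoidalCategory.whiskerLeft_comp, ← MonoidalCategory.whiskerLeft_comp, this]
      simp)
  map f :=
    { app := fun b => f ▷ (c ⟶[V] b)
      naturality := fun a b => by
        rw [ofAct_act, ofAct_act]
        simp [whisker_exchange] }
  map_id g := by ext b; exact id_whiskerRight _ _
  map_comp f g := by ext b; exact comp_whiskerRight _ _ _

instance (c : C) : (reprTensor V c).Additive where
  map_add {g h f f'} := by
    ext b; exact (tensorRight (c ⟶[V] b)).map_add

section Restriction

variable (A : Set C)

/-- The full `V`-subcategory of `C` on a set `A` of objects. -/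
instance fullSubcategory : EnrichedCategory V A where
  Hom a b := (a : C) ⟶[V] (b : C)
  id a := eId V (a : C)
  comp a b c := eComp V (a : C) b c
  id_comp a b := e_id_comp V (a : C) b
  comp_id a b := e_comp_id V (a : C) b
  assoc a b c d := e_assoc V (a : C) b c d

variable (V) in
/-- The restriction functor `r : [C, V] ⥤ [A, V]`, `X ↦ X ∘ I` for the inclusion `I : A ⊂ C`. -/
def restr : VFun V C ⥤ VFun V A where
  obj X :=
    { obj := fun a => X.obj a
      map := fun a b => X.map (a : C) b
      map_id := fun a => X.map_id (a : C)
      map_comp := fun a b c => X.map_comp (a : C) b c }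
  map f :=
    { app := fun a => Hom.app f (a : C)
      naturality := fun a b => Hom.naturality f (a : C) b }
  map_id _ := rfl
  map_comp _ _ := rfl

instance : (restr V A).Additive where

lemma isZero_of_ev {D : Type v} [EnrichedCategory V D] (X : VFun V D)
    (h : ∀ a, IsZero ((ev V a).obj X)) : IsZero X := by
  rw [IsZero.iff_id_eq_zero]
  ext a
  exact (h a).eq_of_src _ _

/-- Exactness is detected pointwise. -/
lemma exact_of_ev {D : Type v} [EnrichedCategory V D] (S : ShortComplex (VFun V D))
    (h : ∀ a, (S.map (ev V a)).Exact) : S.Exact := by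
  rw [ShortComplex.exact_iff_isZero_homology]
  exact isZero_of_ev _ fun a =>
    ((ShortComplex.exact_iff_isZero_homology _).1 (h a)).of_iso (S.mapHomologyIso (ev V a)).symm

instance : (restr V A).PreservesHomology :=
  (restr V A).preservesHomology_of_map_exact fun S hS => by
    refine exact_of_ev _ fun a => ?_
    exact hS.map (ev V (a : C))

instance : PreservesFiniteLimits (restr V A) :=
  (restr V A).preservesFiniteLimits_of_preservesHomology
instance : PreservesFiniteColimits (restr V A) :=
  (restr V A).preservesFiniteColimits_of_preservesHomology

end Restriction

section Kan

variable {A : Set C} [HasLimitsOfSize.{v, v} V]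

/-- Currying on the right: `Hom(T ⊗ K, Z) ≅ Hom(T, [K, Z])`. -/
def curryR {T K Z : V} (f : T ⊗ K ⟶ Z) : T ⟶ (ihom K).obj Z := curry ((β_ K T).hom ≫ f)

/-- Uncurrying on the right: `Hom(T, [K, Z]) ≅ Hom(T ⊗ K, Z)`. -/
def uncurryR {T K Z : V} (f : T ⟶ (ihom K).obj Z) : T ⊗ K ⟶ Z := (β_ T K).hom ≫ uncurry f

lemma uncurryR_curryR {T K Z : V} (f : T ⊗ K ⟶ Z) : uncurryR (curryR f) = f := by
  simp [uncurryR, curryR]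

lemma curryR_uncurryR {T K Z : V} (f : T ⟶ (ihom K).obj Z) : curryR (uncurryR f) = f := by
  simp [uncurryR, curryR]

lemma uncurryR_comp {T T' K Z : V} (h : T' ⟶ T) (f : T ⟶ (ihom K).obj Z) :
    uncurryR (h ≫ f) = h ▷ K ≫ uncurryR f := by
  simp [uncurryR, uncurry_natural_left]

lemma uncurryR_injective {T K Z : V} {f g : T ⟶ (ihom K).obj Z} (h : uncurryR f = uncurryR g) :
    f = g := by
  rw [← curryR_uncurryR f, h, curryR_uncurryR]

lemma comp_curryR {T T' K Z : V} (h : T' ⟶ T) (f : T ⊗ K ⟶ Z) :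
    h ≫ curryR f = curryR (h ▷ K ≫ f) :=
  uncurryR_injective (by rw [uncurryR_comp, uncurryR_curryR, uncurryR_curryR])

/-- The action of a `V`-functor on `A`, where the Hom-objects of `A` are those of `C`. -/
def subAct (H : VFun V A) (b b' : A) : H.obj b ⊗ ((b : C) ⟶[V] (b' : C)) ⟶ H.obj b' := H.act b b'

lemma subAct_nat {H H' : VFun V A} (f : H ⟶ H') (b b' : A) :
    subAct H b b' ≫ Hom.app f b' = Hom.app f b ▷ ((b : C) ⟶[V] (b' : C)) ≫ subAct H' b b' :=
  Hom.naturality f b b'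

variable (H : VFun V A) (c : C)

/-- The product of the objects `[C(c, b), H b]` over `b ∈ A`. -/
abbrev ranProd : V := ∏ᶜ fun b : A => (ihom (c ⟶[V] (b : C))).obj (H.obj b)

/-- The evaluation of the factor at `b`. -/
def ranProdEv (b : A) : ranProd H c ⊗ (c ⟶[V] (b : C)) ⟶ H.obj b :=
  uncurryR (Pi.π (fun b : A => (ihom (c ⟶[V] (b : C))).obj (H.obj b)) b)

/-- The product of the objects `[C(c, b) ⊗ C(b, b'), H b']` over `b, b' ∈ A`. -/
abbrev ranProd₂ : V :=
  ∏ᶜ fun p : A × A => (ihom ((c ⟶[V] (p.1 : C)) ⊗ ((p.1 : C) ⟶[V] (p.2 : C)))).obj (H.obj p.2)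

/-- The morphism which acts on the value at `b`. -/
def ranD₀ : ranProd H c ⟶ ranProd₂ H c :=
  Pi.lift fun p => curryR ((α_ _ _ _).inv ≫ ranProdEv H c p.1 ▷ _ ≫ subAct H p.1 p.2)

/-- The morphism which composes the arguments. -/
def ranD₁ : ranProd H c ⟶ ranProd₂ H c :=
  Pi.lift fun p => curryR (_ ◁ eComp V c (p.1 : C) (p.2 : C) ≫ ranProdEv H c p.2)

/-- The end `∫_{b ∈ A} [C(c, b), H b]`. -/
def ranVal : V := equalizer (ranD₀ H c) (ranD₁ H c)

/-- The inclusion of the end in the product. -/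
def ranι : ranVal H c ⟶ ranProd H c := equalizer.ι (ranD₀ H c) (ranD₁ H c)

/-- The evaluations `(∫_{b ∈ A} [C(c, b), H b]) ⊗ C(c, b) ⟶ H b`. -/
def ranEv (b : A) : ranVal H c ⊗ (c ⟶[V] (b : C)) ⟶ H.obj b :=
  ranι H c ▷ _ ≫ ranProdEv H c b

/-- A family of morphisms `T ⊗ C(c, b) ⟶ H b` that is `V`-natural in `b ∈ A`. -/
def IsNat {T : V} (φ : ∀ b : A, T ⊗ (c ⟶[V] (b : C)) ⟶ H.obj b) : Prop :=
  ∀ b b' : A, (α_ _ _ _).inv ≫ φ b ▷ ((b : C) ⟶[V] (b' : C)) ≫ subAct H b b' =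
    T ◁ eComp V c (b : C) (b' : C) ≫ φ b'

lemma isNat_iff {T : V} (f : T ⟶ ranProd H c) :
    IsNat H c (fun b => f ▷ _ ≫ ranProdEv H c b) ↔ f ≫ ranD₀ H c = f ≫ ranD₁ H c := by
  have h₀ : ∀ p : A × A, f ≫ ranD₀ H c ≫ Pi.π _ p =
      curryR ((α_ _ _ _).inv ≫ (f ▷ _ ≫ ranProdEv H c p.1) ▷ _ ≫ subAct H p.1 p.2) := fun p => by
    rw [ranD₀, Pi.lift_π, comp_curryR]
    simp
  have h₁ : ∀ p : A × A, f ≫ ranD₁ H c ≫ Pi.π _ p =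
      curryR (T ◁ eComp V c (p.1 : C) (p.2 : C) ≫ f ▷ _ ≫ ranProdEv H c p.2) := fun p => by
    rw [ranD₁, Pi.lift_π, comp_curryR, whisker_exchange_assoc]
  constructor
  · intro h
    refine Pi.hom_ext _ _ fun p => ?_
    rw [Category.assoc, Category.assoc, h₀, h₁]
    exact congrArg curryR (h p.1 p.2)
  · intro h b b'
    have := congrArg uncurryR ((h₀ (b, b')).symm.trans
      ((by rw [← Category.assoc, h, Category.assoc] : _ = _).trans (h₁ (b, b'))))
    rwa [uncurryR_curryR, uncurryR_curryR] at this

lemma ranEv_nat : IsNat H c (ranEv H c) :=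
  (isNat_iff H c _).2 (equalizer.condition _ _)

/-- The universal property of the end. -/
def ranLift {T : V} (φ : ∀ b : A, T ⊗ (c ⟶[V] (b : C)) ⟶ H.obj b) (hφ : IsNat H c φ) :
    T ⟶ ranVal H c :=
  equalizer.lift (Pi.lift fun b => curryR (φ b)) ((isNat_iff H c _).1 (by
    convert hφ using 2 with b
    rw [ranProdEv, ← uncurryR_comp, Pi.lift_π, uncurryR_curryR]))

lemma ranLift_ι {T : V} (φ : ∀ b : A, T ⊗ (c ⟶[V] (b : C)) ⟶ H.obj b) (hφ : IsNat H c φ) :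
    ranLift H c φ hφ ≫ ranι H c = Pi.lift fun b => curryR (φ b) :=
  equalizer.lift_ι _ _

lemma ranLift_ev {T : V} (φ : ∀ b : A, T ⊗ (c ⟶[V] (b : C)) ⟶ H.obj b) (hφ : IsNat H c φ)
    (b : A) : ranLift H c φ hφ ▷ _ ≫ ranEv H c b = φ b := by
  rw [ranEv, ← comp_whiskerRight_assoc, ranLift_ι, ranProdEv, ← uncurryR_comp,
    Pi.lift_π, uncurryR_curryR]

lemma ran_hom_ext {T : V} {f g : T ⟶ ranVal H c}
    (h : ∀ b : A, f ▷ _ ≫ ranEv H c b = g ▷ _ ≫ ranEv H c b) : f = g := by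
  refine equalizer.hom_ext (Pi.hom_ext _ _ fun b => uncurryR_injective ?_)
  have := h b
  rw [ranEv, ← comp_whiskerRight_assoc, ← comp_whiskerRight_assoc, ranProdEv, ← uncurryR_comp,
    ← uncurryR_comp] at this
  exact this

/-- The action of `C(c, c')` on the end, by composition of the arguments. -/
def ranAct (c c' : C) : ranVal H c ⊗ (c ⟶[V] c') ⟶ ranVal H c' :=
  ranLift H c' (fun b => (α_ _ _ _).hom ≫ _ ◁ eComp V c c' (b : C) ≫ ranEv H c b) (by
    intro b b'
    have h := ranEv_nat H c b b'
    have e := e_assoc V c c' (b : C) (b' : C)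
    rw [Iso.inv_comp_eq] at e h
    simp only [comp_whiskerRight, Category.assoc, h, associator_naturality_middle_assoc]
    rw [associator_naturality_right_assoc, ← MonoidalCategory.whiskerLeft_comp_assoc,
      ← MonoidalCategory.whiskerLeft_comp_assoc, e]
    simp)

lemma ranAct_ev (c c' : C) (b : A) : ranAct H c c' ▷ _ ≫ ranEv H c' b =
    (α_ _ _ _).hom ≫ _ ◁ eComp V c c' (b : C) ≫ ranEv H c b :=
  ranLift_ev _ _ _ _ _

/-- The right Kan extension of a `V`-functor `H : A → V` to `C`. -/
def ranObj : VFun V C :=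
  ofAct (ranVal H) (ranAct H)
    (fun c => by
      apply ran_hom_ext; intro b
      have e := e_id_comp V c (b : C)
      rw [Iso.inv_comp_eq, Category.comp_id] at e
      rw [comp_whiskerRight, Category.assoc, ranAct_ev, associator_naturality_middle_assoc,
        ← MonoidalCategory.whiskerLeft_comp_assoc, e]
      simp)
    (fun c c' c'' => by
      apply ran_hom_ext; intro b
      have e := e_assoc V c c' c'' (b : C)
      rw [Iso.inv_comp_eq] at e
      simp only [comp_whiskerRight, Category.assoc, ranAct_ev, associator_naturality_left_assoc,
        associator_naturality_middle_assoc]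
      rw [← whisker_exchange_assoc, ranAct_ev, ← MonoidalCategory.whiskerLeft_comp_assoc, e]
      simp)

lemma ranObj_act (c c' : C) : (ranObj H).act c c' = ranAct H c c' := ofAct_act _ _ _ _ c c'

section Map

variable {H} {H' : VFun V A} (f : H ⟶ H')

/-- The induced morphism of ends. -/
def ranMapVal (c : C) : ranVal H c ⟶ ranVal H' c :=
  ranLift H' c (fun b => ranEv H c b ≫ Hom.app f b) (by
    intro b b'
    rw [comp_whiskerRight, Category.assoc, ← subAct_nat]
    have h := ranEv_nat H c b b'
    simp only [← Category.assoc] at h ⊢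
    rw [h])

lemma ranMapVal_ev (c : C) (b : A) :
    ranMapVal f c ▷ _ ≫ ranEv H' c b = ranEv H c b ≫ Hom.app f b :=
  ranLift_ev _ _ _ _ _

lemma ranMapVal_nat (c c' : C) :
    ranAct H c c' ≫ ranMapVal f c' = ranMapVal f c ▷ (c ⟶[V] c') ≫ ranAct H' c c' := by
  apply ran_hom_ext; intro b
  rw [comp_whiskerRight, Category.assoc, ranMapVal_ev, ← Category.assoc, ranAct_ev,
    comp_whiskerRight, Category.assoc (ranMapVal f c ▷ _ ▷ _), ranAct_ev,
    associator_naturality_left_assoc, ← whisker_exchange_assoc, ranMapVal_ev]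
  simp

def ranMap : ranObj H ⟶ ranObj H' where
  app c := ranMapVal f c
  naturality c c' :=
    (congrArg (fun t => t ≫ ranMapVal f c') (ranObj_act H c c')).trans
      ((ranMapVal_nat f c c').trans
        (congrArg (fun t => ranMapVal f c ▷ (c ⟶[V] c') ≫ t) (ranObj_act H' c c').symm))

lemma ranMapVal_id (c : C) : ranMapVal (𝟙 H) c = 𝟙 _ := by
  apply ran_hom_ext; intro b
  rw [ranMapVal_ev, id_whiskerRight, Category.id_comp, id_app, Category.comp_id]

lemma ranMapVal_comp {H'' : VFun V A} (g : H' ⟶ H'') (c : C) :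
    ranMapVal (f ≫ g) c = ranMapVal f c ≫ ranMapVal g c := by
  apply ran_hom_ext; intro b
  rw [ranMapVal_ev, comp_whiskerRight, Category.assoc, ranMapVal_ev, ← Category.assoc,
    ranMapVal_ev, Category.assoc, comp_app]

lemma ranMapVal_add (g : H ⟶ H') (c : C) :
    ranMapVal (f + g) c = ranMapVal f c + ranMapVal g c := by
  apply ran_hom_ext; intro b
  rw [ranMapVal_ev, MonoidalPreadditive.add_whiskerRight, Preadditive.add_comp, ranMapVal_ev,
    ranMapVal_ev, add_app, Preadditive.comp_add]

end Map

variable (V A) in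
/-- The enriched right Kan extension `r_R : [A, V] ⥤ [C, V]` along the inclusion `A ⊂ C`, given by
`(r_R H) c = ∫_{b ∈ A} [C(c, b), H b]`. -/
def ran : VFun V A ⥤ VFun V C where
  obj H := ranObj H
  map f := ranMap f
  map_id _ := by ext c; exact ranMapVal_id c
  map_comp f g := by ext c; exact ranMapVal_comp f g c

instance : (ran V A).Additive where
  map_add {_ _ f g} := by ext c; exact ranMapVal_add f g c

end Kan

end VFun

end Abelian

/-! ### Compact generation and localizing subcategories of triangulated categories -/

section Triangulated

variable {D : Type u} [Category.{w₁} D] [Preadditive D] [HasZeroObject D] [HasShift D ℤ]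
  [∀ n : ℤ, (shiftFunctor D n).Additive] [Pretriangulated D]

/-- A family of objects of a triangulated category (with coproducts indexed by the sets in
`Type v`) is a family of compact generators if all its members are compact, that is,
`Hom(G j, -)` preserves coproducts, and every object `Y` with `Hom(G j, Y⟦n⟧) = 0` for all `j`
and `n` vanishes. -/
def IsCompactGenerators {J : Type v} (G : J → D) : Prop :=
  (∀ (j : J) (K : Type v),
    PreservesColimitsOfShape (Discrete K) (preadditiveCoyoneda.obj (Opposite.op (G j)))) ∧
  ∀ Y : D, (∀ (j : J) (n : ℤ) (f : G j ⟶ Y⟦n⟧), f = 0) → IsZero Y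

/-- A localizing subcategory: a strictly full triangulated subcategory which is closed under the
coproducts indexed by the sets in `Type v`. -/
def IsLocalizing (S : ObjectProperty D) : Prop :=
  S.IsTriangulated ∧ S.IsClosedUnderIsomorphisms ∧
    ∀ K : Type v, S.IsClosedUnderColimitsOfShape (Discrete K)

/-- The smallest localizing subcategory that contains a family of objects. -/
def localizingClosure {K : Type v} (G : K → D) : ObjectProperty D := fun X =>
  ∀ S : ObjectProperty D, IsLocalizing.{w₁, v} S → (∀ k, S (G k)) → S X

end Triangulated

/-- A recollement of the triangulated category `D` by the triangulated categories `B` and `E`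
whose middle row consists of the triangulated functors `i : B ⥤ D` and `r : D ⥤ E`. -/
structure Recollement {B D E : Type*} [Category* B] [Category* D] [Category* E]
    [Preadditive B] [Preadditive D] [Preadditive E]
    [HasZeroObject B] [HasZeroObject D] [HasZeroObject E]
    [HasShift B ℤ] [HasShift D ℤ] [HasShift E ℤ]
    [∀ n : ℤ, (shiftFunctor B n).Additive] [∀ n : ℤ, (shiftFunctor D n).Additive]
    [∀ n : ℤ, (shiftFunctor E n).Additive]
    [Pretriangulated B] [Pretriangulated D] [Pretriangulated E]
    (i : B ⥤ D) (r : D ⥤ E) [i.CommShift ℤ] [i.IsTriangulated] [r.CommShift ℤ]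
    [r.IsTriangulated] where
  iL : D ⥤ B
  iR : D ⥤ B
  rL : E ⥤ D
  rR : E ⥤ D
  [commShift_iL : iL.CommShift ℤ]
  [commShift_iR : iR.CommShift ℤ]
  [commShift_rL : rL.CommShift ℤ]
  [commShift_rR : rR.CommShift ℤ]
  [isTriangulated_iL : iL.IsTriangulated]
  [isTriangulated_iR : iR.IsTriangulated]
  [isTriangulated_rL : rL.IsTriangulated]
  [isTriangulated_rR : rR.IsTriangulated]
  iL_adj : iL ⊣ i
  adj_iR : i ⊣ iR
  rL_adj : rL ⊣ r
  adj_rR : r ⊣ rR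
  full_i : i.Full
  faithful_i : i.Faithful
  full_rL : rL.Full
  faithful_rL : rL.Faithful
  full_rR : rR.Full
  faithful_rR : rR.Faithful
  image_eq_kernel (X : D) : i.essImage X ↔ IsZero (r.obj X)

/-! ### The derived categories -/

section Derived

open HomotopicalAlgebra
open scoped ZeroObject

variable {V : Type u} [Category.{v} V] [MonoidalCategory V] [MonoidalClosed V]
  [SymmetricCategory V] [Abelian V]
variable {C : Type v} [EnrichedCategory V C]

/-- The functor on cochain complexes that applies an additive functor degreewise. -/
abbrev onComplexes {X Y : Type*} [Category* X] [Category* Y] [Preadditive X] [Preadditive Y]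
    (F : X ⥤ Y) [F.Additive] : CochainComplex X ℤ ⥤ CochainComplex Y ℤ :=
  F.mapHomologicalComplex (ComplexShape.up ℤ)

/-- The complex `Y(c)`. -/
abbrev evalAt (Y : CochainComplex (VFun V C) ℤ) (c : C) : CochainComplex V ℤ :=
  (onComplexes (VFun.ev V c)).obj Y

/-- The complex `C(c, -) ⊘ Q` of `V`-functors. -/
abbrev reprTensorComplex (c : C) (Q : CochainComplex V ℤ) : CochainComplex (VFun V C) ℤ :=
  (onComplexes (VFun.reprTensor V c)).obj Q

/-- A complex `Y` is injective fibrant (fibrant for the injective model structure, where the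
cofibrations are the monomorphisms and the weak equivalences are the quasi-isomorphisms) if
every morphism to `Y` extends along every monomorphism that is a quasi-isomorphism. -/
def IsInjectiveFibrant {X : Type*} [Category* X] [Abelian X] (Y : CochainComplex X ℤ) : Prop :=
  ∀ ⦃K L : CochainComplex X ℤ⦄ (i : K ⟶ L) [Mono i] [QuasiIso i] (f : K ⟶ Y),
    ∃ g : L ⟶ Y, i ≫ g = f

/-- The condition that there is a model structure on `Ch(V)` such that
* the weak equivalences are the quasi-isomorphisms,
* `Y(c)` is fibrant for every injective fibrant complex `Y` of `V`-functors and every `c`,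
* each `Q j` is a cofibrant replacement of `P j`, and the inclusion of `Q j` in the cone of its
  identity is a cofibration. (The last point says that the chain-level cylinder of `Q j` is a
  cylinder object, so that homotopies of morphisms out of `Q j` are chain homotopies.) -/
def ModelCondition (C : Type v) [EnrichedCategory V C] {J : Type v}
    (P Q : J → CochainComplex V ℤ) : Prop :=
  ∃ _ : ModelCategory (CochainComplex V ℤ),
    weakEquivalences (CochainComplex V ℤ) = HomologicalComplex.quasiIso V (ComplexShape.up ℤ) ∧
    (∀ Y : CochainComplex (VFun V C) ℤ, IsInjectiveFibrant Y → ∀ c : C, IsFibrant (evalAt Y c)) ∧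
    ∀ j, IsCofibrant (Q j) ∧ (∃ q : Q j ⟶ P j, WeakEquivalence q) ∧
      Cofibration (CochainComplex.mappingCone.inr (𝟙 (Q j)))

/-- The three alternative conditions on compact generators `P j` of `D(V)`, together with the
associated choice of complexes `Q j`. -/
def GeneratorCondition (C : Type v) [EnrichedCategory V C] {J : Type v}
    (P Q : J → CochainComplex V ℤ) : Prop :=
  ((∀ j, (P j).IsKProjective) ∧ Q = P) ∨
  ((∀ Y : CochainComplex (VFun V C) ℤ, Y.IsKInjective → ∀ c : C, (evalAt Y c).IsKInjective) ∧
    Q = P) ∨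
  ModelCondition C P Q

variable [HasDerivedCategory.{w₁} V] [HasDerivedCategory.{w₂} (VFun V C)]

/-- The subcategory `E_A` of `D[C, V]`: the objects `Y` such that `H^n(Y(a)) = 0` for all
`a ∈ A` and all `n`. -/
def acyclicOn (A : Set C) : ObjectProperty (DerivedCategory (VFun V C)) := fun Y =>
  ∀ (a : A) (n : ℤ), IsZero
    ((DerivedCategory.homologyFunctor V n).obj ((VFun.ev V (a : C)).mapDerivedCategory.obj Y))

lemma acyclicOn_iff (A : Set C) (Y : DerivedCategory (VFun V C)) :
    acyclicOn A Y ↔ ∀ a : A, (((DerivedCategory.homologyFunctor V 0).homologicalKernel).inverseImage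
      (VFun.ev V (a : C)).mapDerivedCategory) Y := by
  refine forall_congr' fun a => ?_
  exact ((DerivedCategory.homologyFunctor V 0).mem_homologicalKernel_iff _).symm

instance (A : Set C) :
    (acyclicOn A : ObjectProperty (DerivedCategory (VFun V C))).IsClosedUnderIsomorphisms where
  of_iso e h := (acyclicOn_iff A _).2 fun a =>
    ObjectProperty.prop_of_iso _ e ((acyclicOn_iff A _).1 h a)

instance (A : Set C) :
    (acyclicOn A : ObjectProperty (DerivedCategory (VFun V C))).IsTriangulated where
  exists_zero := ⟨0, isZero_zero _, (acyclicOn_iff A _).2 fun _ => ObjectProperty.prop_zero _⟩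
  isStableUnderShiftBy n :=
    { le_shift := fun _ h => (acyclicOn_iff A _).2 fun a =>
        ObjectProperty.le_shift _ n _ ((acyclicOn_iff A _).1 h a) }
  toIsTriangulatedClosed₂ := .mk' fun T hT h₁ h₃ => (acyclicOn_iff A _).2 fun a =>
    ObjectProperty.ext_of_isTriangulatedClosed₂ _ T hT ((acyclicOn_iff A _).1 h₁ a)
      ((acyclicOn_iff A _).1 h₃ a)

/-- The subcategory `T_A` of `D[C, V]`: the smallest localizing subcategory that contains the
objects `C(a, -) ⊘ Q j` for `a ∈ A` and all `j`. -/
def generatedBy (A : Set C) {J : Type v} (Q : J → CochainComplex V ℤ) :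
    ObjectProperty (DerivedCategory (VFun V C)) :=
  localizingClosure fun p : A × J =>
    DerivedCategory.Q.obj (reprTensorComplex (p.1 : C) (Q p.2))

variable (V) in
/-- The restriction functor `ρ : D[C, V] ⥤ D[A, V]`, induced by the exact functor
`[C, V] ⥤ [A, V]`. -/
abbrev restrDerived (A : Set C) [HasDerivedCategory.{w₃} (VFun V A)] :
    DerivedCategory (VFun V C) ⥤ DerivedCategory (VFun V A) :=
  (VFun.restr V A).mapDerivedCategory

/-- The functor `F : T_A ⥤ D[A, V]`, the inclusion of `T_A` in `D[C, V]` followed by `ρ`. -/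
abbrev restrGenerated (A : Set C) [HasDerivedCategory.{w₃} (VFun V A)] {J : Type v}
    (Q : J → CochainComplex V ℤ) :
    (generatedBy (C := C) A Q).FullSubcategory ⥤ DerivedCategory (VFun V A) :=
  (generatedBy A Q).ι ⋙ restrDerived V A

end Derived

end

end EnrichedDerived

open EnrichedDerived

universe w

set_option linter.unusedSectionVars false

/-! Restriction to `A` is exact, and its right adjoint `r_R` has an invertible counit because `A` is
full. A right adjoint of an exact functor preserves K-injectivity, so `r_R` applied to K-injective
resolutions is right adjoint to `ρ`, again with invertible counit (`exists_restrDerived_adj`).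
Homology of complexes of `V`-functors is pointwise, so `E_A` is the kernel of `ρ`, and the right
half of the recollement is formal.

The left half comes from compactness. The functor `C(c, -) ⊘ -` is left adjoint to evaluation at
`c`. It need not be exact, but each of the three conditions ensures that morphisms `Q j ⟶ Y(c)` in
`D(V)` are homotopy classes of chain maps when `Y` is injective fibrant
(`GeneratorCondition.homIsHomotopyClass`). Hence `Hom(C(c, -) ⊘ Q j, X) ≅ Hom(Q j, X(c))`. These
objects are therefore compact, and the objects orthogonal to all their shifts, for `c ∈ A`, form
`E_A`. A telescope construction (`exists_distinguished_triangle_of_compact`) puts every `X` in a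
triangle `T ⟶ X ⟶ Z` with `T` in `T_A` and `Z` in `E_A`, and `exists_recollement` concludes.

All this needs injective fibrant resolutions in a Grothendieck category
(`exists_acyclicMono_isInjectiveFibrant`), and `[C, V]` is one. The small object argument requires a
set of acyclic monomorphisms that tests injective fibrancy. If `S ⟶ L` is an acyclic monomorphism
but not an epimorphism, then `L/S` is acyclic and nonzero, and it has a nonzero acyclic subcomplex
that is a quotient of one of a set of contractible complexes depending only on a separator
(`exists_coverComplex_hom`). Adding it to `S` is a pushout along the inclusion of a subobject of
that contractible complex, and Zorn's lemma exhausts `L`. -/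

/-! ### Acyclic cofibrations of complexes in a Grothendieck abelian category -/

namespace CochainComplex

open HomComplex MorphismProperty

section Abelian

variable {𝒜 : Type u} [Category.{v} 𝒜] [Abelian 𝒜]

variable (𝒜) in
/-- The monomorphisms of cochain complexes that are quasi-isomorphisms. -/
def acyclicMono : MorphismProperty (CochainComplex 𝒜 ℤ) :=
  monomorphisms _ ⊓ HomologicalComplex.quasiIso 𝒜 (ComplexShape.up ℤ)

lemma acyclicMono_iff {K L : CochainComplex 𝒜 ℤ} (i : K ⟶ L) :
    acyclicMono 𝒜 i ↔ Mono i ∧ QuasiIso i := Iff.rfl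

/-- Lifts exist in each degree. Their failure to commute with the differentials is a 1-cocycle from
the acyclic `cokernel i` to the K-injective `kernel p`, hence a coboundary, which corrects them. -/
lemma hasLiftingProperty_of_isKInjective_kernel {A B X Y : CochainComplex 𝒜 ℤ} (i : A ⟶ B)
    (p : X ⟶ Y) [Mono i] [QuasiIso i] (hp : degreewiseEpiWithInjectiveKernel p)
    [(kernel p).IsKInjective] : HasLiftingProperty i p where
  sq_hasLift {t b} sq := by
    have sq' (n : ℤ) : CommSq (t.f n) (i.f n) (p.f n) (b.f n) :=
      sq.map (HomologicalComplex.eval _ _ n)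
    have (n : ℤ) : (sq' n).HasLift := by
      have := (hp n).hasLiftingProperty (i.f n)
      infer_instance
    obtain ⟨α, hα⟩ := IsKInjective.eq_δ_of_cocycle
      (Lifting.cocycle₁ sq (fun n ↦ { l := (sq' n).lift, fac_left := (sq' n).fac_left,
                                      fac_right := (sq' n).fac_right })
        (cokernelIsCokernel i) (kernelIsKernel p) (hπ := cokernel.condition i)
        (hι := kernel.condition p)) (by
        have : (ShortComplex.mk _ _ (cokernel.condition i)).ShortExact :=
          { exact := ShortComplex.exact_cokernel i }
        exact this.acyclic_X₃ (by dsimp; infer_instance)) 0 (by simp)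
    exact Lifting.hasLift sq _ (cokernelIsCokernel _) (kernelIsKernel _) α hα

lemma degreewiseEpiWithInjectiveKernel_fst_id (L : CochainComplex 𝒜 ℤ)
    (hL : ∀ n, Injective (L.X n)) :
    degreewiseEpiWithInjectiveKernel (mappingCocone.fst (𝟙 L)) := by
  intro n
  rw [Abelian.epiWithInjectiveKernel_iff]
  exact ⟨L.X (n - 1), hL _, (mappingCocone.inr (𝟙 L)).1.v (n - 1) n (by lia), by simp,
    ⟨{ r := (mappingCocone.snd (𝟙 L)).v n (n - 1) (by lia)
       s := (mappingCocone.inl (𝟙 L)).v n n (add_zero n)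
       f_r := by simp
       s_g := by simp
       id := by
        rw [add_comm]
        exact mappingCocone.id_X (𝟙 L) n (n - 1) (by lia) }⟩⟩

instance (L : CochainComplex 𝒜 ℤ) (d : ℤ) [L.IsStrictlyGE d] :
    (mappingCocone (𝟙 L)).IsStrictlyGE d := by
  rw [isStrictlyGE_iff]
  intro i hi
  refine (IsZero.iff_id_eq_zero _).2 ?_
  rw [← mappingCocone.id_X (𝟙 L) i (i - 1) (by lia),
    (L.isZero_of_isStrictlyGE d i hi).eq_of_tgt ((mappingCocone.fst (𝟙 L)).f i) 0,
    (L.isZero_of_isStrictlyGE d (i - 1) (by lia)).eq_of_tgt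
      ((mappingCocone.snd (𝟙 L)).v i (i - 1) (by lia)) 0, zero_comp, zero_comp, add_zero]

lemma isKInjective_kernel_of_isStrictlyGE {X Y : CochainComplex 𝒜 ℤ} (p : X ⟶ Y)
    (hp : degreewiseEpiWithInjectiveKernel p) (d : ℤ) [X.IsStrictlyGE d] :
    (kernel p).IsKInjective := by
  have (n : ℤ) : Injective ((kernel p).X n) :=
    Injective.of_iso
      (asIso (kernelComparison p (HomologicalComplex.eval _ _ n))).symm (hp n).2
  have : (kernel p).IsStrictlyGE d := by
    rw [isStrictlyGE_iff]
    intro i hi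
    rw [IsZero.iff_id_eq_zero, ← cancel_mono ((kernel.ι p).f i)]
    apply (X.isZero_of_isStrictlyGE d i).eq_of_tgt
  exact isKInjective_of_injective _ d

lemma homologyMap_fst_id (L : CochainComplex 𝒜 ℤ) (n : ℤ) :
    HomologicalComplex.homologyMap (mappingCocone.fst (𝟙 L)) n = 0 := by
  have h : Homotopy (-mappingCocone.fst (𝟙 L)) 0 :=
    (Cochain.equivHomotopy _ _).symm
      ⟨mappingCocone.descCochain (𝟙 L) 0 (Cochain.ofHom (𝟙 L)) (by lia), by
        rw [mappingCocone.δ_descCochain _ _ _ _ 1 (by lia)]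
        simp⟩
  have := h.homologyMap_eq n
  simpa [HomologicalComplex.homologyMap_neg] using this

lemma injective_isContractible (I : CochainComplex 𝒜 ℤ) [Injective I] :
    Nonempty (Homotopy (𝟙 I) 0) := by
  have : Mono (mappingCone.inr (𝟙 I)) := by
    have (n : ℤ) : Mono ((mappingCone.inr (𝟙 I)).f n) :=
      mono_of_mono_fac (mappingCone.inr_f_snd_v (𝟙 I) n)
    exact HomologicalComplex.mono_of_mono_f _ this
  let r : mappingCone (𝟙 I) ⟶ I := Injective.factorThru (𝟙 I) (mappingCone.inr (𝟙 I))
  have hr : mappingCone.inr (𝟙 I) ≫ r = 𝟙 I := Injective.comp_factorThru _ _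
  refine ⟨(Cochain.equivHomotopy _ _).symm
    ⟨(mappingCone.inl (𝟙 I)).comp (Cochain.ofHom r) (add_zero _), ?_⟩⟩
  rw [δ_comp_ofHom, mappingCone.δ_inl, ← Cochain.ofHom_comp]
  simp [hr]

end Abelian

end CochainComplex

namespace CochainComplex

open HomComplex MorphismProperty
section

variable {𝒜 : Type u} [Category.{v} 𝒜] [Abelian 𝒜]

/-- An embedding of `E.opcycles n` in an injective gives a chain map to a complex concentrated in
degree `n` that is injective on `H^n`. A lift to the contractible cocone forces it to be zero on
`H^n`. -/
lemma acyclic_of_hasLiftingProperty_fst_id [EnoughInjectives 𝒜] (E : CochainComplex 𝒜 ℤ)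
    (hE : ∀ (n : ℤ) (J : 𝒜) [Injective J] (f : E ⟶ (singleFunctor 𝒜 n).obj J),
      ∃ g : E ⟶ mappingCocone (𝟙 ((singleFunctor 𝒜 n).obj J)),
        g ≫ mappingCocone.fst _ = f) : E.Acyclic := by
  intro n
  rw [HomologicalComplex.exactAt_iff_isZero_homology]
  let j := Injective.ι (E.opcycles n)
  let f : E ⟶ (singleFunctor 𝒜 n).obj (Injective.under (E.opcycles n)) :=
    HomologicalComplex.mkHomToSingle (E.pOpcycles n ≫ j) (by simp)
  obtain ⟨g, hg⟩ := hE n _ f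
  have h₀ : HomologicalComplex.homologyMap f n = 0 := by
    rw [← hg, HomologicalComplex.homologyMap_comp, homologyMap_fst_id, comp_zero]
  have h₁ := HomologicalComplex.homologyι_naturality f n
  rw [h₀, zero_comp] at h₁
  have : IsIso (((singleFunctor 𝒜 n).obj (Injective.under (E.opcycles n))).pOpcycles n) :=
    HomologicalComplex.isIso_pOpcycles _ (n - 1) n (by simp) (by
      apply (HomologicalComplex.isZero_single_obj_X _ _ _ _ (by lia)).eq_of_src)
  have h₂ : HomologicalComplex.opcyclesMap f n = j ≫
      (HomologicalComplex.singleObjXSelf (ComplexShape.up ℤ) n _).inv ≫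
      HomologicalComplex.pOpcycles ((singleFunctor 𝒜 n).obj (Injective.under (E.opcycles n))) n := by
    rw [← cancel_epi (E.pOpcycles n), HomologicalComplex.p_opcyclesMap]
    have : f.f n = (E.pOpcycles n ≫ j) ≫
        (HomologicalComplex.singleObjXSelf (ComplexShape.up ℤ) n _).inv :=
      HomologicalComplex.mkHomToSingle_f _ _
    rw [this]
    exact (Category.assoc _ _ _).trans (Category.assoc _ _ _)
  have h₃ : Mono (HomologicalComplex.opcyclesMap f n) := by
    rw [h₂]
    have : Mono ((HomologicalComplex.singleObjXSelf (ComplexShape.up ℤ) n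
        (Injective.under (E.opcycles n))).inv ≫
      HomologicalComplex.pOpcycles
        ((singleFunctor 𝒜 n).obj (Injective.under (E.opcycles n))) n) :=
      @mono_comp _ _ _ _ _ _ inferInstance _ (@IsIso.mono_of_iso _ _ _ _ _ this)
    exact mono_comp j _
  have h₄ : E.homologyι n = 0 := by
    rw [← cancel_mono (HomologicalComplex.opcyclesMap f n), zero_comp, ← h₁]
  exact IsZero.of_mono_eq_zero _ h₄

lemma quasiIso_of_shortExact_of_acyclic {S : ShortComplex (CochainComplex 𝒜 ℤ)}
    (hS : S.ShortExact) (h : S.X₃.Acyclic) : QuasiIso S.f := by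
  have hz (n : ℤ) : IsZero (S.X₃.homology n) :=
    (HomologicalComplex.exactAt_iff_isZero_homology _ _).1 (h n)
  rw [quasiIso_iff]
  intro n
  rw [quasiIsoAt_iff_isIso_homologyMap]
  have : Mono (HomologicalComplex.homologyMap S.f n) :=
    (hS.homology_exact₁ (n - 1) n (by simp)).mono_g ((hz _).eq_of_src _ _)
  have : Epi (HomologicalComplex.homologyMap S.f n) :=
    (hS.homology_exact₂ n).epi_f ((hz _).eq_of_tgt _ _)
  exact isIso_of_mono_of_epi _

-- Two kinds of test morphisms suffice: `I ⟶ 0` with `I` an injective complex makes `i` a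
-- monomorphism, and `mappingCocone (𝟙 L) ⟶ L` with `L` an injective in one degree makes `cokernel
-- i` acyclic.
open scoped ZeroObject in
lemma acyclicMono_of_llp_rlp [EnoughInjectives 𝒜] [EnoughInjectives (CochainComplex 𝒜 ℤ)] :
    (acyclicMono 𝒜).rlp.llp ≤ acyclicMono 𝒜 := by
  intro A B i hi
  have hI (I : CochainComplex 𝒜 ℤ) [Injective I] : (acyclicMono 𝒜).rlp (0 : I ⟶ 0) := by
    intro K L k hk
    have : Mono k := hk.1
    exact ⟨fun {t b} sq => ⟨⟨{ l := Injective.factorThru t k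
                               fac_right := (isZero_zero _).eq_of_tgt _ _ }⟩⟩⟩
  have hmono : Mono i := by
    have := hi _ (hI (Injective.under A))
    have sq : CommSq (Injective.ι A) i (0 : Injective.under A ⟶ 0) 0 := ⟨by simp⟩
    exact mono_of_mono_fac sq.fac_left
  refine (acyclicMono_iff i).2 ⟨hmono, ?_⟩
  have hS : (ShortComplex.mk _ _ (cokernel.condition i)).ShortExact :=
    { exact := ShortComplex.exact_cokernel i }
  suffices h : (cokernel i).Acyclic from quasiIso_of_shortExact_of_acyclic hS h
  apply acyclic_of_hasLiftingProperty_fst_id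
  intro n J hJ f
  let L := (singleFunctor 𝒜 n).obj J
  have hL : ∀ m, Injective (L.X m) := by
    intro m
    by_cases hm : m = n
    · subst hm
      exact Injective.of_iso (HomologicalComplex.singleObjXSelf (ComplexShape.up ℤ) m J).symm hJ
    · exact (HomologicalComplex.isZero_single_obj_X _ _ _ _ hm).injective
  have hp := degreewiseEpiWithInjectiveKernel_fst_id L hL
  have := isKInjective_kernel_of_isStrictlyGE _ hp n
  have hT : (acyclicMono 𝒜).rlp (mappingCocone.fst (𝟙 L)) := by
    intro K L k hk
    have : Mono k := hk.1
    have : QuasiIso k := hk.2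
    exact hasLiftingProperty_of_isKInjective_kernel k _ hp
  have := hi _ hT
  -- The lift is zero on `A`, so it descends to `cokernel i`.
  have sq : CommSq (0 : A ⟶ _) i (mappingCocone.fst (𝟙 L)) (cokernel.π i ≫ f) := ⟨by simp⟩
  refine ⟨cokernel.desc i sq.lift (by simp), ?_⟩
  rw [← cancel_epi (cokernel.π i)]
  rw [cokernel.π_desc_assoc]
  exact sq.fac_right


lemma acyclic_of_isColimit {J : Type w} [SmallCategory J] [HasColimitsOfShape J 𝒜]
    [HasExactColimitsOfShape J 𝒜] {F : J ⥤ CochainComplex 𝒜 ℤ} {c : Cocone F} (hc : IsColimit c)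
    (h : ∀ j, (F.obj j).Acyclic) : c.pt.Acyclic := by
  intro n
  let X (m : ℤ) : J ⥤ 𝒜 := F ⋙ HomologicalComplex.eval _ _ m
  let δ (m m' : ℤ) : X m ⟶ X m' :=
    { app := fun j => (F.obj j).d m m',
      naturality := fun _ _ f => (F.map f).comm m m' }
  let S : ShortComplex (J ⥤ 𝒜) := ShortComplex.mk (δ (n - 1) n) (δ n (n + 1)) (by
    ext j; exact (F.obj j).d_comp_d _ _ _)
  have hS : S.Exact := by
    rw [ShortComplex.exact_iff_isZero_homology]
    refine Functor.isZero _ fun j => ?_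
    refine IsZero.of_iso ?_ (S.mapHomologyIso ((evaluation J 𝒜).obj j)).symm
    rw [← ShortComplex.exact_iff_isZero_homology]
    exact ((F.obj j).exactAt_iff' (n - 1) n (n + 1) (by simp) (by simp)).1 (h j n)
  have hS' := hS.map colim
  rw [c.pt.exactAt_iff' (n - 1) n (n + 1) (by simp) (by simp)]
  let e (m : ℤ) : colimit (X m) ≅ c.pt.X m :=
    (colimit.isColimit (X m)).coconePointUniqueUpToIso
      (isColimitOfPreserves (HomologicalComplex.eval _ _ m) hc)
  have he (m : ℤ) (j : J) : colimit.ι (X m) j ≫ (e m).hom = (c.ι.app j).f m :=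
    (colimit.isColimit (X m)).comp_coconePointUniqueUpToIso_hom
      (isColimitOfPreserves (HomologicalComplex.eval _ _ m) hc) j
  have hd (m m' : ℤ) : (e m).hom ≫ c.pt.d m m' = colim.map (δ m m') ≫ (e m').hom := by
    refine colimit.hom_ext fun j => ?_
    have h₁ : colimit.ι (X m) j ≫ (e m).hom ≫ c.pt.d m m' = (c.ι.app j).f m ≫ c.pt.d m m' := by
      rw [← Category.assoc, he]; rfl
    have h₂ : colimit.ι (X m) j ≫ colim.map (δ m m') ≫ (e m').hom =
        (F.obj j).d m m' ≫ (c.ι.app j).f m' := by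
      rw [← he, ← Category.assoc, colimit.ι_map, Category.assoc]
      rfl
    exact h₁.trans (((c.ι.app j).comm m m').trans h₂.symm)
  exact ShortComplex.exact_of_iso (ShortComplex.isoMk (e _) (e _) (e _) (hd _ _) (hd _ _)) hS'

instance : (acyclicMono 𝒜).RespectsIso := by
  unfold acyclicMono; infer_instance

instance : (acyclicMono 𝒜).IsMultiplicative := by
  unfold acyclicMono; infer_instance

lemma acyclicMono_of_shortExact {S : ShortComplex (CochainComplex 𝒜 ℤ)}
    (hS : S.ShortExact) (h : S.X₃.Acyclic) : acyclicMono 𝒜 S.f :=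
  (acyclicMono_iff _).2 ⟨hS.mono_f, quasiIso_of_shortExact_of_acyclic hS h⟩

lemma acyclic_cokernel {K L : CochainComplex 𝒜 ℤ} (i : K ⟶ L) (hi : acyclicMono 𝒜 i) :
    (cokernel i).Acyclic := by
  have : Mono i := hi.1
  have : QuasiIso i := hi.2
  have : (ShortComplex.mk _ _ (cokernel.condition i)).ShortExact :=
    { exact := ShortComplex.exact_cokernel i }
  exact this.acyclic_X₃ (by dsimp; infer_instance)

attribute [local instance] IsFiltered.isConnected

/-- The short exact sequences of `K`, `F j` and the cokernels pass to the colimit, where the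
cokernel stays acyclic. Connectedness of `J` identifies the colimit of the constant diagram with
`K`. -/
lemma acyclicMono_of_isColimit {J : Type w} [SmallCategory J] [IsFiltered J]
    [HasColimitsOfShape J 𝒜] [HasExactColimitsOfShape J 𝒜]
    {K : CochainComplex 𝒜 ℤ} {F : J ⥤ CochainComplex 𝒜 ℤ} (α : (Functor.const J).obj K ⟶ F)
    {c : Cocone F} (hc : IsColimit c) (h : ∀ j, acyclicMono 𝒜 (α.app j)) (f : K ⟶ c.pt)
    (hf : ∀ j, α.app j ≫ c.ι.app j = f) : acyclicMono 𝒜 f := by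
  have (j : J) : Mono (α.app j) := (h j).1
  have := NatTrans.mono_of_mono_app α
  have hS : (ShortComplex.mk _ _ (cokernel.condition α)).ShortExact :=
    { exact := ShortComplex.exact_cokernel α }
  have hS' := hS.map_of_exact colim
  have hac : (colimit (cokernel α)).Acyclic := acyclic_of_isColimit (colimit.isColimit _) fun j => by
    have e : (cokernel α).obj j ≅ cokernel (α.app j) :=
      PreservesCokernel.iso ((evaluation _ _).obj j) α
    exact fun n => (acyclic_cokernel _ (h j) n).of_iso e.symm
  refine (MorphismProperty.arrow_mk_iso_iff _ ?_).1 (acyclicMono_of_shortExact hS' hac)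
  exact Arrow.isoMk
    ((colimit.isColimit _).coconePointUniqueUpToIso (isColimitConstCocone J K))
    ((colimit.isColimit _).coconePointUniqueUpToIso hc) (by
      refine colimit.hom_ext fun j => ?_
      have h₁ := (colimit.isColimit _).comp_coconePointUniqueUpToIso_hom
        (isColimitConstCocone J K) j
      have h₂ := (colimit.isColimit F).comp_coconePointUniqueUpToIso_hom hc j
      have h₃ := colimit.ι_map α j
      refine ((Category.assoc _ _ _).symm.trans (h₁ =≫ f)).trans ?_
      refine Eq.trans ?_ ((Category.assoc _ _ _).symm.trans ((h₃ =≫ _).trans (Category.assoc _ _ _))).symm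
      refine Eq.trans ?_ (α.app j ≫= h₂).symm
      rw [hf]
      exact Category.id_comp _)

/-- As `Z` has zero differential, the differential of the cone maps the `inl` copy of `Z` onto the
`inr` copy, so the `inl` copy generates the cone. -/
lemma exists_decomp_mappingCone_id {Z : CochainComplex 𝒜 ℤ} (hZ : ∀ i j, Z.d i j = 0) {T : 𝒜}
    {n n' n'' : ℤ} (hn : n' + (-1) = n) (hn' : n'' + (-1) = n') (z : T ⟶ (mappingCone (𝟙 Z)).X n') :
    ∃ (a : T ⟶ Z.X n'') (b : T ⟶ Z.X n'), z = a ≫ (mappingCone.inl (𝟙 Z)).v n'' n' hn' +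
      b ≫ (mappingCone.inl (𝟙 Z)).v n' n hn ≫ (mappingCone (𝟙 Z)).d n n' := by
  obtain ⟨a, b, hab⟩ := mappingCone.decomp_to (𝟙 Z) z n'' (by omega)
  refine ⟨a, b, ?_⟩
  rw [mappingCone.inl_v_d (𝟙 Z) n' n n'' (by omega) (by omega), hab]
  simp [hZ]

end

/-! ### Acyclic subcomplexes of bounded size in an acyclic complex -/

section Cover

variable {𝒜 : Type u} [Category.{v} 𝒜] [Abelian 𝒜] [HasCoproducts.{v} 𝒜] (G : 𝒜)

/-- The iterated covers of an object `G` by copies of `G`. -/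
noncomputable def coverSeq : ℕ → 𝒜
  | 0 => G
  | k + 1 => ∐ fun _ : G ⟶ coverSeq k => G

/-- The cone of the identity of a complex with zero differential, which is given by `coverSeq G`
in degrees `≤ n₀ + 1`. -/
noncomputable def coverComplex (n₀ : ℤ) : CochainComplex 𝒜 ℤ where
  -- The `inl` copy of degree `p` lies in degree `p - 1` of the cone, so the first `G` lands in
  -- degree `n₀`. Above degree `n₀ + 1` truncated subtraction gives more copies of `G`, on which the
  -- morphism constructed below vanishes.
  X p := coverSeq G (n₀ + 1 - p).toNat
  d _ _ := 0

variable {G} {Y E : CochainComplex 𝒜 ℤ} (π : Y ⟶ E)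

open scoped Classical in
/-- Morphisms from `coverSeq G` to a complex `Y`, where in each step all preimages under the
differential that exist after composition with `π : Y ⟶ E` are chosen. -/
noncomputable def coverHom {n₀ : ℤ} (g : G ⟶ Y.X n₀) :
    ∀ (k : ℕ) (q : ℤ) (_ : q + k = n₀), coverSeq G k ⟶ Y.X q
  | 0, q, hq => g ≫ (Y.XIsoOfEq (by simpa using hq.symm)).hom
  | k + 1, q, hq => Sigma.desc fun u : G ⟶ coverSeq G k =>
      -- A single preimage is chosen for each `u`, with default `0`, so that the source does not
      -- depend on `Y` or `E`.
      if h : ∃ y : G ⟶ Y.X q, y ≫ π.f q ≫ E.d q (q + 1) =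
        u ≫ coverHom g k (q + 1) (by push_cast at hq; lia) ≫ π.f (q + 1) then h.choose else 0

lemma exists_coverHom {n₀ : ℤ} (g : G ⟶ Y.X n₀) (k k' : ℕ) (q q' : ℤ) (hk : k' = k + 1)
    (hq' : q + 1 = q') (hq : q' + k = n₀) (u : G ⟶ coverSeq G k) (y : G ⟶ Y.X q)
    (hy : y ≫ π.f q ≫ E.d q q' = u ≫ coverHom π g k q' hq ≫ π.f q') :
    ∃ v : G ⟶ coverSeq G k', v ≫ coverHom π g k' q (by lia) ≫ π.f q ≫ E.d q q' =
      u ≫ coverHom π g k q' hq ≫ π.f q' := by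
  subst hk hq'
  have h : ∃ y : G ⟶ Y.X q, y ≫ π.f q ≫ E.d q (q + 1) =
        u ≫ coverHom π g k (q + 1) (by lia) ≫ π.f (q + 1) := ⟨y, hy⟩
  refine ⟨Sigma.ι (fun _ : G ⟶ coverSeq G k => G) u, ?_⟩
  have : Sigma.ι (fun _ : G ⟶ coverSeq G k => G) u ≫ coverHom π g (k + 1) q (by lia) =
      h.choose := by
    rw [coverHom]
    refine (Sigma.ι_desc _ _).trans ?_
    rw [dif_pos h]
  exact (Category.assoc _ _ _).symm.trans ((this =≫ _).trans h.choose_spec)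

/-- A cycle of `I` lifts to the cone as a generator plus a boundary. The generator part is a
boundary in `E`, hence, after a cover by copies of `G`, the boundary of elements `y` coming from
`Y`. Hypothesis `h` replaces each `y` by a generator of the cone, whose image lies in `I`. -/
lemma acyclic_of_isSeparator (hG : IsSeparator G) [Epi π] (hE : E.Acyclic)
    {Z : CochainComplex 𝒜 ℤ} (hZ : ∀ i j, Z.d i j = 0) (m : mappingCone (𝟙 Z) ⟶ Y)
    (h : ∀ (n n' n'' : ℤ) (hn : n' + (-1) = n) (hn' : n'' + (-1) = n') (u : G ⟶ Z.X n'')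
      (y : G ⟶ Y.X n) (_ : y ≫ π.f n ≫ E.d n n' =
        u ≫ (mappingCone.inl (𝟙 Z)).v n'' n' hn' ≫ m.f n' ≫ π.f n'),
      ∃ v : G ⟶ Z.X n', v ≫ (mappingCone.inl (𝟙 Z)).v n' n hn ≫ m.f n ≫ π.f n ≫ E.d n n' =
        u ≫ (mappingCone.inl (𝟙 Z)).v n'' n' hn' ≫ m.f n' ≫ π.f n')
    {I : CochainComplex 𝒜 ℤ} (ψ : mappingCone (𝟙 Z) ⟶ I) (ι : I ⟶ E) [Epi ψ] [Mono ι]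
    (fac : ψ ≫ ι = m ≫ π) : I.Acyclic := by
  intro n
  have hn₀ : n + (-1) = n - 1 := by omega
  have hn₁ : n + 1 + (-1) = n := by omega
  have hE' := (HomologicalComplex.exactAt_iff_exact_up_to_refinements _ (n - 1) n (n + 1) (by simp)
      (by simp)).1 (hE n)
  rw [HomologicalComplex.exactAt_iff_exact_up_to_refinements _ (n - 1) n (n + 1) (by simp)
    (by simp)]
  intro T x hx
  have hψ (i : ℤ) : ψ.f i ≫ ι.f i = m.f i ≫ π.f i := by
    rw [← HomologicalComplex.comp_f, fac, HomologicalComplex.comp_f]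
  obtain ⟨T₁, p₁, _, z, hz⟩ := surjective_up_to_refinements_of_epi (ψ.f n) x
  obtain ⟨a, b, hab⟩ := exists_decomp_mappingCone_id hZ hn₀ hn₁ z
  have h := h _ _ _ hn₀ hn₁
  generalize (mappingCone.inl (𝟙 Z)).v (n + 1) n hn₁ = l₁ at *
  generalize (mappingCone.inl (𝟙 Z)).v n (n - 1) hn₀ = l₀ at *
  have h₀ : (a ≫ l₁ ≫ m.f n ≫ π.f n) ≫ E.d n (n + 1) = 0 := by
    have h₁ : p₁ ≫ x ≫ I.d n (n + 1) = 0 := by rw [hx, comp_zero]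
    rw [reassoc_of% hz, hab] at h₁
    have h₂ := h₁ =≫ ι.f (n + 1)
    rw [Preadditive.add_comp, Preadditive.add_comp] at h₂
    have h₃ : (b ≫ l₀ ≫ (mappingCone (𝟙 Z)).d (n - 1) n) ≫ ψ.f n ≫ I.d n (n + 1) = 0 := by
      simp
    simp only [Category.assoc] at h₂ h₃ ⊢
    rw [reassoc_of% h₃, zero_comp, add_zero, ← HomologicalComplex.Hom.comm,
      reassoc_of% hψ] at h₂
    exact h₂
  obtain ⟨T₂, p₂, _, e, he⟩ := hE' _ h₀
  obtain ⟨T₃, p₃, _, y, hy⟩ := surjective_up_to_refinements_of_epi (π.f (n - 1)) e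
  have hq := (isSeparator_iff_epi G).1 hG T₃
  have H (f : G ⟶ T₃) := h (f ≫ p₃ ≫ p₂ ≫ a) (f ≫ y) (by
    rw [Category.assoc, ← reassoc_of% hy, ← he]; simp)
  -- One replacement for each `f : G ⟶ T₃`; together they are defined on the coproduct of copies of
  -- `G` that covers `T₃`.
  choose v hv using H
  refine ⟨_, Sigma.desc (fun f : G ⟶ T₃ => f) ≫ p₃ ≫ p₂ ≫ p₁, inferInstance,
    (Sigma.desc v ≫ l₀ ≫ ψ.f (n - 1)) +
      Sigma.desc (fun f : G ⟶ T₃ => f) ≫ p₃ ≫ p₂ ≫ b ≫ l₀ ≫ ψ.f (n - 1), ?_⟩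
  rw [Category.assoc, Category.assoc, Category.assoc, hz, hab]
  simp only [Category.assoc, Preadditive.add_comp, Preadditive.comp_add,
    HomologicalComplex.Hom.comm]
  congr 1
  rw [← cancel_mono (ι.f n)]
  refine Sigma.hom_ext _ _ fun f => ?_
  simp only [Category.assoc, Sigma.ι_desc_assoc, hψ]
  simpa using (hv f).symm

-- Starting from a `g : G ⟶ Y.X n₀` that is nonzero in `E`, preimages under the differential are
-- added in each lower degree, for everything that has one. The source of `m` depends only on `G`
-- and `n₀`, which is why a set of generating monomorphisms suffices.
set_option maxRecDepth 4000 in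
lemma exists_coverComplex_hom (hG : IsSeparator G) [Epi π] (hE : E.Acyclic)
    (hE₀ : ¬ IsZero E) :
    ∃ (n₀ : ℤ) (m : mappingCone (𝟙 (coverComplex G n₀)) ⟶ Y), m ≫ π ≠ 0 ∧
      (image (m ≫ π)).Acyclic := by
  obtain ⟨n₀, g, hg⟩ : ∃ (n₀ : ℤ) (g : G ⟶ Y.X n₀), g ≫ π.f n₀ ≠ 0 := by
    by_contra! H
    refine hE₀ ((IsZero.iff_id_eq_zero _).2 ?_)
    rw [← cancel_epi π]
    ext n
    rw [isSeparator_def] at hG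
    refine hG _ _ fun h => ?_
    simpa using H n h
  obtain ⟨α, hα, hα₀⟩ : ∃ α : Cochain (coverComplex G n₀) Y (-1),
      (∀ (p q : ℤ) (hpq : p + (-1) = q) (h : q ≤ n₀),
        α.v p q hpq = coverHom π g (n₀ + 1 - p).toNat q (by omega)) ∧
      ∀ (p q : ℤ) (hpq : p + (-1) = q) (_ : ¬ q ≤ n₀), α.v p q hpq = 0 :=
    ⟨Cochain.mk fun p q hpq =>
      if h : q ≤ n₀ then coverHom π g (n₀ + 1 - p).toNat q (by omega) else 0,
      fun p q hpq h => dif_pos h, fun p q hpq h => dif_neg h⟩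
  -- A chain map from the cone is determined by its restriction `α` to the `inl` copy; on the `inr`
  -- copy it is the coboundary of `α`.
  obtain ⟨m, hm⟩ : ∃ m : mappingCone (𝟙 (coverComplex G n₀)) ⟶ Y, ∀ (p q : ℤ) (hpq : p + (-1) = q),
      (mappingCone.inl (𝟙 _)).v p q hpq ≫ m.f q = α.v p q hpq :=
    ⟨mappingCone.desc (𝟙 _) α (Cocycle.homOf (Cocycle.mk (δ (-1) 0 α) 1 (zero_add 1) (δ_δ _ _ _ _)))
      (by simp), fun p q hpq => by simp⟩
  refine ⟨n₀, m, fun h => hg ?_, acyclic_of_isSeparator π hG hE (fun _ _ => rfl) m ?_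
    (factorThruImage (m ≫ π)) (image.ι _) (image.fac _)⟩
  · have h₁ : (mappingCone.inl (𝟙 (coverComplex G n₀))).v (n₀ + 1) n₀ (by omega) ≫
        (m ≫ π).f n₀ = 0 := by rw [h]; simp
    rw [HomologicalComplex.comp_f, reassoc_of% hm, hα _ _ _ le_rfl] at h₁
    have h₂ : ∀ (k : ℕ) (hk : n₀ + k = n₀), coverHom π g k n₀ hk ≫ π.f n₀ = 0 →
        g ≫ π.f n₀ = 0 := by
      intro k hk
      obtain rfl : k = 0 := by omega
      intro h'
      have e : coverHom π g 0 n₀ hk = g := Category.comp_id g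
      rwa [e] at h'
    exact h₂ _ _ h₁
  · intro n n' n'' hn hn' u y hy
    rw [reassoc_of% hm] at hy ⊢
    rw [reassoc_of% hm]
    by_cases h : n' ≤ n₀
    · rw [hα _ _ _ h] at hy ⊢
      rw [hα _ _ _ (by omega)]
      exact exists_coverHom π g _ _ n n' (by omega) (by omega) _ u y hy
    -- In degrees above `n₀` the element to be hit is already zero.
    · exact ⟨0, by simp [hα₀ _ _ _ h]⟩

end Cover
end CochainComplex

namespace CochainComplex
open scoped ZeroObject

open HomComplex MorphismProperty

/-! ### Generating acyclic monomorphisms and the small object argument -/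

section Grothendieck

variable {𝒜 : Type u} [Category.{v} 𝒜] [Abelian 𝒜]

/-- The inclusions of subobjects of the complexes `mappingCone (𝟙 (coverComplex G n₀))` that
are quasi-isomorphisms. -/
def generatingAcyclicMono [HasCoproducts.{v} 𝒜] (G : 𝒜) :
    MorphismProperty (CochainComplex 𝒜 ℤ) :=
  ofHoms (fun p : Σ n₀ : ℤ, {N : Subobject (mappingCone (𝟙 (coverComplex G n₀))) //
    acyclicMono 𝒜 N.arrow} => p.2.1.arrow)

/-- An extension of `f` to the cone of `𝟙 K` is a null-homotopy, and `K ⟶ mappingCone (𝟙 K)` is an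
acyclic monomorphism because both complexes are acyclic. -/
lemma IsInjectiveFibrant.isKInjective {X : CochainComplex 𝒜 ℤ} (hX : IsInjectiveFibrant X) :
    X.IsKInjective where
  nonempty_homotopy_zero {K} f hK := by
    have hm : Mono (mappingCone.inr (𝟙 K)) := by
      have (n : ℤ) : Mono ((mappingCone.inr (𝟙 K)).f n) :=
        mono_of_mono_fac (mappingCone.inr_f_snd_v (𝟙 K) n)
      exact HomologicalComplex.mono_of_mono_f _ this
    have hq : QuasiIso (mappingCone.inr (𝟙 K)) := by
      rw [quasiIso_iff]
      intro n
      rw [quasiIsoAt_iff_isIso_homologyMap]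
      refine ⟨0, (hK n).isZero_homology.eq_of_src _ _, IsZero.eq_of_src ?_ _ _⟩
      rw [IsZero.iff_id_eq_zero, ← HomologicalComplex.homologyMap_id,
        (mappingCone.homotopyToZeroOfId K).homologyMap_eq, HomologicalComplex.homologyMap_zero]
    obtain ⟨r, hr⟩ := hX (mappingCone.inr (𝟙 K)) f
    refine ⟨(Cochain.equivHomotopy _ _).symm
      ⟨(mappingCone.inl (𝟙 K)).comp (Cochain.ofHom r) (add_zero _), ?_⟩⟩
    rw [δ_comp_ofHom, mappingCone.δ_inl, ← Cochain.ofHom_comp]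
    simp [hr]

variable [IsGrothendieckAbelian.{v} 𝒜]

lemma generatingAcyclicMono_le (G : 𝒜) : generatingAcyclicMono G ≤ acyclicMono 𝒜 := by
  rintro _ _ _ ⟨p⟩
  exact p.2.2

instance (G : 𝒜) : MorphismProperty.IsSmall.{v} (generatingAcyclicMono G) := by
  unfold generatingAcyclicMono
  infer_instance

/-- This characterization by lifting makes stability under pushouts formal. -/
lemma acyclicMono_llp_rlp : (acyclicMono 𝒜).rlp.llp = acyclicMono 𝒜 :=
  le_antisymm acyclicMono_of_llp_rlp (le_llp_rlp _)

instance : (acyclicMono 𝒜).IsStableUnderCobaseChange := by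
  rw [← acyclicMono_llp_rlp]; infer_instance

lemma exists_hasSmallObjectArgument_cardinal {I : MorphismProperty (CochainComplex 𝒜 ℤ)}
    [MorphismProperty.IsSmall.{v} I] (hI : I ≤ monomorphisms _) :
    ∃ κ : Cardinal.{v}, κ.IsRegular ∧ ∀ {A B : CochainComplex 𝒜 ℤ} (i : A ⟶ B), I i →
      HasCardinalLT (Subobject A) κ := by
  obtain ⟨ι, A, B, f, rfl⟩ := (isSmall_iff_eq_ofHoms.{v} I).1 inferInstance
  obtain ⟨κ, hκ, h⟩ := HasCardinalLT.exists_regular_cardinal.{v} (Σ i : ι, Subobject (A i))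
  refine ⟨κ, hκ, ?_⟩
  rintro _ _ _ ⟨i⟩
  exact h.of_injective (fun S => ⟨i, S⟩) (fun S S' h => by simpa using h)

/-- The stages of a relative cell complex are joined by monomorphisms. When `κ` exceeds the number
of subobjects of `A`, morphisms from `A` commute with the union of a chain of length `κ` of
monomorphisms. -/
lemma hasSmallObjectArgument {I : MorphismProperty (CochainComplex 𝒜 ℤ)}
    [MorphismProperty.IsSmall.{v} I] (hI : I ≤ monomorphisms _) :
    HasSmallObjectArgument.{v} I := by
  obtain ⟨κ, hκ', hκ⟩ := exists_hasSmallObjectArgument_cardinal hI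
  have : Fact κ.IsRegular := ⟨hκ'⟩
  have : Nonempty κ.ord.ToType := by simpa using hκ'.ne_zero
  have := WellFoundedLT.toOrderBot κ.ord.ToType
  exact ⟨κ, inferInstance, inferInstance,
    { preservesColimit {A B X Y} i hi f hf := by
        let hf' : (monomorphisms _).TransfiniteCompositionOfShape κ.ord.ToType f :=
          { toTransfiniteCompositionOfShape := hf.toTransfiniteCompositionOfShape
            map_mem j hj := by
              have := (hf.attachCells j hj).pushouts_coproducts
              simp only [ofHoms_homFamily] at this
              refine (?_ : _ ≤ monomorphisms _) _ this
              simp only [pushouts_le_iff, coproducts_le_iff]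
              exact hI }
        have (j j' : κ.ord.ToType) (φ : j ⟶ j') : Mono (hf'.F.map φ) := hf'.mem_map φ
        apply IsGrothendieckAbelian.preservesColimit_coyoneda_obj_of_mono (Y := hf'.F) (κ := κ)
        exact hκ i hi }⟩

/-! ### From the generating acyclic monomorphisms to all acyclic monomorphisms -/

section Zorn

variable {G : 𝒜} {X : CochainComplex 𝒜 ℤ}

/-- One step of the extension. -/
lemma exists_larger_of_not_epi (hG : IsSeparator G)
    (hX : ∀ ⦃K L : CochainComplex 𝒜 ℤ⦄ (i : K ⟶ L) (_ : generatingAcyclicMono G i) (f : K ⟶ X),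
      ∃ g : L ⟶ X, i ≫ g = f) {S L : CochainComplex 𝒜 ℤ} (s : S ⟶ L)
    (hs : acyclicMono 𝒜 s) (hs' : ¬ Epi s) (f : S ⟶ X) :
    ∃ (S' : CochainComplex 𝒜 ℤ) (j : S ⟶ S') (s' : S' ⟶ L) (f' : S' ⟶ X), acyclicMono 𝒜 j ∧
      Mono s' ∧ j ≫ s' = s ∧ j ≫ f' = f ∧ ¬ ∃ r : S' ⟶ S, r ≫ s = s' := by
  have : Mono s := hs.1
  obtain ⟨n₀, m, hm, hac⟩ := exists_coverComplex_hom (cokernel.π s) hG (acyclic_cokernel s hs)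
    (fun h => hs' (Preadditive.epi_of_isZero_cokernel _ h))
  -- The pullback is the kernel of the epimorphism from the cone to the acyclic image of `m ≫
  -- cokernel.π s`, so its inclusion in the cone is a generating acyclic monomorphism up to
  -- isomorphism. The pushout of `S` and the cone over it is the sum of `S` and the image of `m` in
  -- `L`.
  let P := pullback s m
  have hP : IsPullback (pullback.fst s m) (pullback.snd s m) s m := IsPullback.of_hasPullback _ _
  let T : ShortComplex (CochainComplex 𝒜 ℤ) :=
    ShortComplex.mk (pullback.snd s m) (factorThruImage (m ≫ cokernel.π s)) (by
      rw [← cancel_mono (image.ι _), Category.assoc, image.fac, zero_comp, ← pullback.condition_assoc,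
        cokernel.condition, comp_zero])
  have hk : IsLimit (KernelFork.ofι T.f T.zero) := by
    have hw {W : CochainComplex 𝒜 ℤ} (k : W ⟶ T.X₂) (hk : k ≫ T.g = 0) :
        (k ≫ m) ≫ cokernel.π s = 0 := by
      have := hk =≫ image.ι _
      simpa [T] using this
    exact KernelFork.IsLimit.ofι' _ _ fun {W} k hk =>
      ⟨pullback.lift ((Abelian.monoIsKernelOfCokernel _ (cokernelIsCokernel s)).lift
        (KernelFork.ofι (k ≫ m) (hw k hk))) k
        ((Abelian.monoIsKernelOfCokernel _ (cokernelIsCokernel s)).fac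
          (KernelFork.ofι (k ≫ m) (hw k hk)) WalkingParallelPair.zero),
        pullback.lift_snd _ _ _⟩
  have hT : T.ShortExact :=
    { exact := T.exact_of_f_is_kernel hk
      mono_f := inferInstanceAs (Mono (pullback.snd s m))
      epi_g := inferInstanceAs (Epi (factorThruImage (m ≫ cokernel.π s))) }
  have hW : acyclicMono 𝒜 (pullback.snd s m) := acyclicMono_of_shortExact hT hac
  have hpo := IsPushout.of_hasPushout (pullback.fst s m) (pullback.snd s m)
  obtain ⟨g, hg⟩ : ∃ g : mappingCone (𝟙 (coverComplex G n₀)) ⟶ X,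
      pullback.snd s m ≫ g = pullback.fst s m ≫ f := by
    have hW' : acyclicMono 𝒜 (Subobject.mk (pullback.snd s m)).arrow := by
      rw [← Subobject.underlyingIso_hom_comp_eq_mk]
      exact (MorphismProperty.cancel_left_of_respectsIso _ _ _).2 hW
    obtain ⟨g, hg⟩ := hX _ ⟨⟨n₀, ⟨Subobject.mk (pullback.snd s m), hW'⟩⟩⟩
      ((Subobject.underlyingIso _).hom ≫ pullback.fst s m ≫ f)
    refine ⟨g, ?_⟩
    dsimp at hg
    rw [← Subobject.underlyingIso_hom_comp_eq_mk, Category.assoc] at hg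
    exact (cancel_epi _).1 hg
  refine ⟨pushout (pullback.fst s m) (pullback.snd s m), pushout.inl _ _,
    pushout.desc s m pullback.condition, pushout.desc f g hg.symm,
    MorphismProperty.of_isPushout hpo hW,
    hpo.mono_of_isPullback_of_mono hP _ (pushout.inl_desc _ _ _) (pushout.inr_desc _ _ _),
    pushout.inl_desc _ _ _, pushout.inl_desc _ _ _, ?_⟩
  -- If the pushout were contained in `S`, then `m` would factor through `s` and vanish in the
  -- cokernel.
  rintro ⟨r, hr⟩
  apply hm
  have := pushout.inr _ _ ≫= hr
  rw [pushout.inr_desc] at this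
  rw [← this]
  simp

/-- By AB5 the colimit of a directed system of subobjects is again a subobject of `L`, and the
partial extensions glue on it. This bounds the chains in Zorn's lemma. -/
lemma exists_extension_of_directed {J : Type v} [Preorder J] [IsDirectedOrder J] [Nonempty J]
    {K L X : CochainComplex 𝒜 ℤ} (S : J → Subobject L) (hS : Monotone S)
    (g : ∀ a, (S a : CochainComplex 𝒜 ℤ) ⟶ X)
    (hg : ∀ a b (h : a ≤ b), Subobject.ofLE _ _ (hS h) ≫ g b = g a)
    (j : ∀ a, K ⟶ (S a : CochainComplex 𝒜 ℤ)) (hj : ∀ a, acyclicMono 𝒜 (j a))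
    (i : K ⟶ L) (hji : ∀ a, j a ≫ (S a).arrow = i) (f : K ⟶ X) (hjf : ∀ a, j a ≫ g a = f) :
    ∃ (S' : Subobject L) (g' : (S' : CochainComplex 𝒜 ℤ) ⟶ X)
      (j' : K ⟶ (S' : CochainComplex 𝒜 ℤ)), acyclicMono 𝒜 j' ∧ j' ≫ S'.arrow = i ∧
      j' ≫ g' = f ∧ ∀ a, ∃ h : S a ≤ S', Subobject.ofLE _ _ h ≫ g' = g a := by
  let Φ : J ⥤ MonoOver L :=
    { obj a := MonoOver.mk (S a).arrow
      map {a b} h := MonoOver.homMk (Subobject.ofLE _ _ (hS (leOfHom h)))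
        (Subobject.ofLE_arrow _) }
  let Ψ : J ⥤ CochainComplex 𝒜 ℤ := Φ ⋙ MonoOver.forget _ ⋙ Over.forget _
  let μ : colimit Ψ ⟶ L := colimit.desc Ψ (Cocone.mk L
    { app a := (S a).arrow
      naturality a b h := (Subobject.ofLE_arrow _).trans (Category.comp_id _).symm })
  have hμ (a) : colimit.ι Ψ a ≫ μ = (S a).arrow := colimit.ι_desc _ _
  have : Mono μ := IsGrothendieckAbelian.mono_of_isColimit_monoOver Φ (colimit.isColimit _) μ hμ
  let γ : colimit Ψ ⟶ X := colimit.desc Ψ (Cocone.mk X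
    { app a := g a
      naturality a b h := (hg _ _ (leOfHom h)).trans (Category.comp_id _).symm })
  have hγ (a) : colimit.ι Ψ a ≫ γ = g a := colimit.ι_desc _ _
  have hjj (a b) (h : a ≤ b) : j a ≫ Subobject.ofLE _ _ (hS h) = j b := by
    rw [← cancel_mono (S b).arrow, Category.assoc, Subobject.ofLE_arrow, hji, hji]
  let α : (Functor.const _).obj K ⟶ Ψ :=
    { app := j
      naturality a b h := (Category.id_comp _).trans (hjj a b (leOfHom h)).symm }
  obtain ⟨a₀⟩ := ‹Nonempty J›
  obtain ⟨κ, hκ⟩ : ∃ κ, j a₀ ≫ colimit.ι Ψ a₀ = κ := ⟨_, rfl⟩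
  have hκμ : κ ≫ μ = i := by rw [← hκ]; exact (Category.assoc _ _ _).trans ((j a₀ ≫= hμ a₀).trans (hji a₀))
  have hκγ : κ ≫ γ = f := by rw [← hκ]; exact (Category.assoc _ _ _).trans ((j a₀ ≫= hγ a₀).trans (hjf a₀))
  have hκ' (a) : j a ≫ colimit.ι Ψ a = κ := by
    rw [← cancel_mono μ, hκμ]
    exact (Category.assoc _ _ _).trans ((j a ≫= hμ a).trans (hji a))
  have hκW : acyclicMono 𝒜 κ := acyclicMono_of_isColimit α (colimit.isColimit Ψ) hj κ hκ'
  refine ⟨Subobject.mk μ, (Subobject.underlyingIso μ).hom ≫ γ,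
    κ ≫ (Subobject.underlyingIso μ).inv,
    (MorphismProperty.cancel_right_of_respectsIso _ _ _).2 hκW, by simp [hκμ],
    by simp [hκγ], fun a => ?_⟩
  have hle : S a ≤ Subobject.mk μ := Subobject.le_mk_of_comm (colimit.ι Ψ a) (hμ a)
  refine ⟨hle, ?_⟩
  let l : (S a : CochainComplex 𝒜 ℤ) ⟶ colimit Ψ := colimit.ι Ψ a
  have hlμ : l ≫ μ = (S a).arrow := hμ a
  have hlγ : l ≫ γ = g a := hγ a
  have : Subobject.ofLE _ _ hle = l ≫ (Subobject.underlyingIso μ).inv := by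
    rw [← cancel_mono (Subobject.mk μ).arrow, Subobject.ofLE_arrow, Category.assoc,
      Subobject.underlyingIso_arrow, hlμ]
  rw [this, Category.assoc, Iso.inv_hom_id_assoc, hlγ]

/-- Zorn's lemma for partial extensions of `f` to subobjects of `L` in which `K` embeds by an
acyclic monomorphism: by `exists_larger_of_not_epi` a maximal one is defined on all of `L`. -/
lemma isInjectiveFibrant_of_generatingAcyclicMono (hG : IsSeparator G)
    (hX : ∀ ⦃K L : CochainComplex 𝒜 ℤ⦄ (i : K ⟶ L) (_ : generatingAcyclicMono G i) (f : K ⟶ X),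
      ∃ g : L ⟶ X, i ≫ g = f) : IsInjectiveFibrant X := by
  intro K L i _ _ f
  have hi : acyclicMono 𝒜 i := (acyclicMono_iff i).2 ⟨inferInstance, inferInstance⟩
  let T := {p : Σ S : Subobject L, ((S : CochainComplex 𝒜 ℤ) ⟶ X) //
    ∃ j : K ⟶ (p.1 : CochainComplex 𝒜 ℤ), acyclicMono 𝒜 j ∧ j ≫ p.1.arrow = i ∧ j ≫ p.2 = f}
  let r (p q : T) : Prop := ∃ h : p.1.1 ≤ q.1.1, Subobject.ofLE _ _ h ≫ q.1.2 = p.1.2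
  have r_refl (p : T) : r p p := ⟨le_rfl, by simp⟩
  have r_trans {p q s : T} (h₁ : r p q) (h₂ : r q s) : r p s := by
    obtain ⟨h₁, h₁'⟩ := h₁
    obtain ⟨h₂, h₂'⟩ := h₂
    exact ⟨h₁.trans h₂, by rw [← h₁', ← h₂', ← Category.assoc, Subobject.ofLE_comp_ofLE]⟩
  have hi₀ : acyclicMono 𝒜 (Subobject.underlyingIso i).inv :=
    (acyclicMono_iff _).2 ⟨inferInstance, inferInstance⟩
  let p₀ : T := ⟨⟨Subobject.mk i, (Subobject.underlyingIso i).hom ≫ f⟩,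
    (Subobject.underlyingIso i).inv, hi₀, by simp, by simp⟩

  obtain ⟨p, hp⟩ : ∃ p, ∀ q, r p q → r q p := by
    refine exists_maximal_of_chains_bounded (r := r) (fun c hc => ?_) r_trans
    by_cases hne : c.Nonempty
    -- A chain is `v`-small, since `L` has a small set of subobjects, so the colimit over it is
    -- available.
    · have e := (equivShrink.{v} c).symm
      have hdir (a b : Shrink.{v} c) : ∃ d, r (e a).1 (e d).1 ∧ r (e b).1 (e d).1 := by
        by_cases hab : e a = e b
        · exact ⟨a, r_refl _, by rw [hab]; exact r_refl _⟩
        · obtain h | h := hc (e a).2 (e b).2 (fun h => hab (Subtype.ext h))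
          · exact ⟨b, h, r_refl _⟩
          · exact ⟨a, r_refl _, h⟩
      let : Preorder (Shrink.{v} c) :=
        { le := fun a b => r (e a).1 (e b).1
          le_refl := fun a => r_refl _
          le_trans := fun _ _ _ h₁ h₂ => r_trans h₁ h₂ }
      have : IsDirectedOrder (Shrink.{v} c) := ⟨hdir⟩
      have : Nonempty (Shrink.{v} c) := by
        obtain ⟨a, ha⟩ := hne
        exact ⟨equivShrink _ ⟨a, ha⟩⟩
      choose j hj hji hjf using fun a => (e a).1.2
      obtain ⟨S', g', j', h₁, h₂, h₃, h₄⟩ := exists_extension_of_directed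
        (fun a => (e a).1.1.1) (fun a b h => Exists.choose h) (fun a => (e a).1.1.2)
        (fun a b h => Exists.choose_spec h) j hj i hji f hjf
      refine ⟨⟨⟨S', g'⟩, j', h₁, h₂, h₃⟩, fun a ha => ?_⟩
      obtain ⟨b, hb⟩ := e.surjective ⟨a, ha⟩
      obtain rfl : (e b).1 = a := by rw [hb]
      exact h₄ b
    · exact ⟨p₀, fun a ha => (hne ⟨a, ha⟩).elim⟩
  obtain ⟨⟨S, g⟩, j, hj, hji, hjf⟩ := p
  by_cases hepi : Epi S.arrow
  · have := isIso_of_mono_of_epi S.arrow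
    refine ⟨inv S.arrow ≫ g, ?_⟩
    rw [← hji, Category.assoc, IsIso.hom_inv_id_assoc, hjf]
  · have hS : acyclicMono 𝒜 S.arrow := by
      have h₁ : QuasiIso j := hj.2
      have h₂ : QuasiIso (j ≫ S.arrow) := by rw [hji]; infer_instance
      exact (acyclicMono_iff _).2 ⟨inferInstance, quasiIso_of_comp_left j _⟩
    obtain ⟨S', k, s', g', hk, _, hks, hkg, hns⟩ :=
      exists_larger_of_not_epi hG hX S.arrow hS hepi g
    have hle : S ≤ Subobject.mk s' := Subobject.le_mk_of_comm k hks
    let q : T := ⟨⟨Subobject.mk s', (Subobject.underlyingIso s').hom ≫ g'⟩,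
      j ≫ k ≫ (Subobject.underlyingIso s').inv, by
        refine ⟨(acyclicMono 𝒜).comp_mem _ _ hj
          ((MorphismProperty.cancel_right_of_respectsIso _ _ _).2 hk), ?_, ?_⟩
        · simp [hks, hji]
        · simp [hkg, hjf]⟩
    obtain ⟨hle', -⟩ := hp q ⟨hle, by
      have : Subobject.ofLE S _ hle = k ≫ (Subobject.underlyingIso s').inv := by
        rw [← cancel_mono (Subobject.mk s').arrow]
        simp [hks]
      dsimp [q]
      rw [this]
      simp [hkg]⟩
    exact (hns ⟨Subobject.ofMkLE s' S hle', Subobject.ofMkLE_arrow hle'⟩).elim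

end Zorn

/-- The small object argument is applied to `Y ⟶ 0`; lifting against the second factor is the
extension property. -/
lemma exists_acyclicMono_isInjectiveFibrant (Y : CochainComplex 𝒜 ℤ) :
    ∃ (K : CochainComplex 𝒜 ℤ) (k : Y ⟶ K), acyclicMono 𝒜 k ∧ IsInjectiveFibrant K := by
  have hG := isSeparator_separator 𝒜
  have : HasSmallObjectArgument.{v} (generatingAcyclicMono (separator 𝒜)) :=
    hasSmallObjectArgument ((generatingAcyclicMono_le _).trans inf_le_left)
  let fac := (functorialFactorizationData (generatingAcyclicMono (separator 𝒜)).rlp.llp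
    (generatingAcyclicMono (separator 𝒜)).rlp).factorizationData (0 : Y ⟶ 0)
  refine ⟨fac.Z, fac.i, ?_, isInjectiveFibrant_of_generatingAcyclicMono hG ?_⟩
  · exact acyclicMono_of_llp_rlp _
      (antitone_llp (antitone_rlp (generatingAcyclicMono_le _)) _ fac.hi)
  · intro K L i hi f
    have := fac.hp i hi
    have sq : CommSq f i fac.p 0 := ⟨(isZero_zero _).eq_of_tgt _ _⟩
    exact ⟨sq.lift, sq.fac_left⟩

end Grothendieck
end CochainComplex

/-! ### The category of enriched functors is a Grothendieck category -/

namespace EnrichedDerived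

noncomputable section

open MonoidalCategory MonoidalClosed

attribute [local instance] monoidalPreadditive

variable {V : Type u} [Category.{v} V] [MonoidalCategory V] [MonoidalClosed V]
  [SymmetricCategory V] [Abelian V] {C : Type v} [EnrichedCategory V C]

namespace VFun

/-! ### Pointwise colimits of enriched functors -/

section Colimits

variable {K : Type w} [Category.{w₁} K] [HasColimitsOfShape K V] (F : K ⥤ VFun V C)

/-- The value of the pointwise colimit. -/
def colVal (a : C) : V := colimit (F ⋙ ev V a)

/-- The inclusions in the value of the pointwise colimit. -/
def colι (j : K) (a : C) : (F.obj j).obj a ⟶ colVal F a := colimit.ι (F ⋙ ev V a) j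

lemma colι_w {j j' : K} (f : j ⟶ j') (a : C) : Hom.app (F.map f) a ≫ colι F j' a = colι F j a :=
  colimit.w (F ⋙ ev V a) f

variable {F} in
lemma colVal_hom_ext {a : C} {Z : V} {f g : colVal F a ⟶ Z}
    (h : ∀ j, colι F j a ≫ f = colι F j a ≫ g) : f = g :=
  colimit.hom_ext h

-- Tensoring with `W` is a left adjoint, so it preserves the colimit.
variable {F} in
lemma colVal_whisker_hom_ext {a : C} {W Z : V} {f g : colVal F a ⊗ W ⟶ Z}
    (h : ∀ j, colι F j a ▷ W ≫ f = colι F j a ▷ W ≫ g) : f = g :=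
  (isColimitOfPreserves (tensorRight W) (colimit.isColimit (F ⋙ ev V a))).hom_ext h

/-- The action on the pointwise colimit. -/
def colAct (a b : C) : colVal F a ⊗ (a ⟶[V] b) ⟶ colVal F b :=
  (isColimitOfPreserves (tensorRight (a ⟶[V] b)) (colimit.isColimit (F ⋙ ev V a))).desc
    (Cocone.mk (colVal F b)
      { app j := (F.obj j).act a b ≫ colι F j b
        naturality j j' f := by
          have h := Hom.naturality (F.map f) a b
          refine Eq.trans ?_ (Category.comp_id _).symm
          exact (Category.assoc _ _ _).symm.trans ((h.symm =≫ _).trans ((Category.assoc _ _ _).trans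
            (_ ≫= colι_w F f b))) })

lemma colι_act (a b : C) (j : K) : colι F j a ▷ (a ⟶[V] b) ≫ colAct F a b =
    (F.obj j).act a b ≫ colι F j b :=
  (isColimitOfPreserves (tensorRight (a ⟶[V] b)) (colimit.isColimit (F ⋙ ev V a))).fac _ j

/-- The pointwise colimit. -/
def colObj : VFun V C :=
  ofAct (colVal F) (colAct F)
    (fun a => by
      refine colVal_whisker_hom_ext fun j => ?_
      rw [← whisker_exchange_assoc, colι_act, ← Category.assoc, act_id]
      exact (rightUnitor_naturality _).symm)
    (fun a b c => by
      refine colVal_whisker_hom_ext fun j => ?_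
      rw [← whisker_exchange_assoc, colι_act, ← Category.assoc, act_comp,
        associator_inv_naturality_left_assoc, ← comp_whiskerRight_assoc, colι_act]
      simp only [Category.assoc, comp_whiskerRight, colι_act])

lemma colObj_act (a b : C) : (colObj F).act a b = colAct F a b := ofAct_act _ _ _ _ a b

/-- The inclusions in the pointwise colimit. -/
def colIncl (j : K) : F.obj j ⟶ colObj F where
  app a := colι F j a
  naturality a b := by rw [colObj_act]; exact (colι_act F a b j).symm

/-- The pointwise colimit cocone. -/
def colCocone : Cocone F where
  pt := colObj F
  ι :=
    { app j := colIncl F j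
      naturality j j' f := by
        ext a
        exact (colι_w F f a).trans (Category.comp_id _).symm }

/-- The universal property of the pointwise colimit. -/
def colValDesc (s : Cocone F) (a : C) : colVal F a ⟶ s.pt.obj a :=
  colimit.desc (F ⋙ ev V a) ((ev V a).mapCocone s)

lemma colι_desc (s : Cocone F) (a : C) (j : K) :
    colι F j a ≫ colValDesc F s a = Hom.app (s.ι.app j) a :=
  colimit.ι_desc _ _

lemma colDesc_nat (s : Cocone F) (a b : C) :
    colAct F a b ≫ colValDesc F s b = colValDesc F s a ▷ _ ≫ s.pt.act a b := by
  refine colVal_whisker_hom_ext fun j => ?_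
  rw [← Category.assoc, colι_act, Category.assoc, colι_desc, ← comp_whiskerRight_assoc,
    colι_desc]
  exact Hom.naturality (s.ι.app j) a b

/-- The pointwise colimit cocone is a colimit cocone. -/
def colIsColimit : IsColimit (colCocone F) where
  desc s :=
    { app a := colValDesc F s a
      naturality a b :=
        (congrArg (fun t => t ≫ _) (colObj_act F a b)).trans (colDesc_nat F s a b) }
  fac s j := by ext a; exact colι_desc _ _ _ _
  uniq s m h := by
    ext a
    refine colVal_hom_ext fun j => ?_
    exact (congrArg (fun t => Hom.app t a) (h j)).trans (colι_desc _ _ _ _).symm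

instance : HasColimitsOfShape K (VFun V C) where
  has_colimit F := ⟨⟨⟨_, colIsColimit F⟩⟩⟩

instance (c : C) : PreservesColimitsOfShape K (ev V c) where
  preservesColimit {F} := preservesColimit_of_preserves_colimit_cocone (colIsColimit F)
    (colimit.isColimit (F ⋙ ev V c))

end Colimits

/-! ### The enriched Yoneda adjunction -/

section Repr

variable (c : C)

lemma reprTensor_act (g : V) (a b : C) : ((reprTensor V c).obj g).act a b =
    (α_ g (c ⟶[V] a) (a ⟶[V] b)).hom ≫ g ◁ eComp V c a b :=
  uncurry_curry _

/-- The unit of the adjunction between `reprTensor V c` and the evaluation at `c`. -/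
def reprUnit (g : V) : g ⟶ g ⊗ (c ⟶[V] c) :=
  (ρ_ g).inv ≫ g ◁ eId V c

lemma reprDesc_nat {g : V} {X : VFun V C} (k : g ⟶ X.obj c) (a b : C) :
    ((α_ g (c ⟶[V] a) (a ⟶[V] b)).hom ≫ g ◁ eComp V c a b) ≫ k ▷ (c ⟶[V] b) ≫ X.act c b =
      (k ▷ (c ⟶[V] a) ≫ X.act c a) ▷ (a ⟶[V] b) ≫ X.act a b := by
  have h' := X.act_comp c a b
  rw [Iso.eq_inv_comp] at h'
  simp only [Category.assoc, comp_whiskerRight]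
  rw [← h', whisker_exchange_assoc]
  simp

/-- The morphism `C(c, -) ⊘ g ⟶ X` that corresponds to `g ⟶ X(c)`. -/
def reprDesc {g : V} {X : VFun V C} (k : g ⟶ X.obj c) : (reprTensor V c).obj g ⟶ X where
  app b := k ▷ (c ⟶[V] b) ≫ X.act c b
  naturality a b :=
    (congrArg (fun t => t ≫ _) (reprTensor_act c g a b)).trans (reprDesc_nat c k a b)

lemma reprUnit_desc {g : V} {X : VFun V C} (k : g ⟶ X.obj c) :
    reprUnit c g ≫ k ▷ (c ⟶[V] c) ≫ X.act c c = k := by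
  dsimp [reprUnit]
  rw [Category.assoc, Iso.inv_comp_eq, whisker_exchange_assoc, act_id]
  simp

lemma reprUnit_act (g : V) (b : C) : reprUnit c g ▷ (c ⟶[V] b) ≫
    ((α_ g (c ⟶[V] c) (c ⟶[V] b)).hom ≫ g ◁ eComp V c c b) = 𝟙 _ := by
  have e := e_id_comp V c b
  rw [Iso.inv_comp_eq, Category.comp_id] at e
  dsimp [reprUnit]
  rw [comp_whiskerRight, Category.assoc, associator_naturality_middle_assoc,
    ← MonoidalCategory.whiskerLeft_comp, e]
  simp

lemma reprDesc_unit {g : V} {X : VFun V C} (f : (reprTensor V c).obj g ⟶ X) (b : C) :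
    (reprUnit c g ≫ Hom.app f c) ▷ (c ⟶[V] b) ≫ X.act c b = Hom.app f b := by
  have h := (congrArg (fun t => t ≫ Hom.app f b) (reprTensor_act c g c b)).symm.trans
    (Hom.naturality f c b)
  refine (comp_whiskerRight (reprUnit c g) (Hom.app f c) _ =≫ _).trans
    ((Category.assoc _ _ _).trans ?_)
  exact (reprUnit c g ▷ (c ⟶[V] b) ≫= h.symm).trans ((Category.assoc _ _ _).symm.trans
    ((reprUnit_act c g b =≫ _).trans (Category.id_comp _)))

variable (V) in
/-- `reprTensor V c` is left adjoint to the evaluation at `c`. -/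
def reprAdj : reprTensor V c ⊣ ev V c :=
  Adjunction.mkOfHomEquiv
    { homEquiv g X :=
        { toFun f := reprUnit c g ≫ Hom.app f c
          invFun k := reprDesc c k
          left_inv f := by ext b; exact reprDesc_unit c f b
          right_inv k := reprUnit_desc c k }
      homEquiv_naturality_left_symm {g g' X} f k := by
        ext b
        exact (congrArg (fun t => t ≫ _) (comp_whiskerRight f k _)).trans (Category.assoc _ _ _)
      homEquiv_naturality_right f g := (Category.assoc _ _ _).symm }

end Repr

/-! ### Separator and AB5 for enriched functors -/

section Grothendieck

lemma exact_map_whiskeringRight {K : Type*} [Category* K] {X Y : Type*} [Category* X] [Category* Y]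
    [Abelian X] [Abelian Y] (S : ShortComplex (K ⥤ X)) (hS : S.Exact) (F : X ⥤ Y)
    [F.PreservesZeroMorphisms] [F.PreservesHomology] :
    (ShortComplex.mk (Functor.whiskerRight S.f F) (Functor.whiskerRight S.g F)
      (by
        ext j
        have h := congrArg (fun t => t.app j) S.zero
        dsimp at h ⊢
        rw [← F.map_comp, h, F.map_zero])).Exact := by
  rw [ShortComplex.exact_iff_isZero_homology]
  refine Functor.isZero _ fun j => ?_
  refine IsZero.of_iso ?_ (ShortComplex.mapHomologyIso _ ((evaluation K Y).obj j)).symm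
  rw [← ShortComplex.exact_iff_isZero_homology]
  exact (hS.map ((evaluation K X).obj j)).map F

variable [IsGrothendieckAbelian.{v} V]

/-- Morphisms from `C(c, -) ⊘ G` to `X` are morphisms `G ⟶ X(c)`, so the coproduct over all `c`
separates when `G` does. -/
instance : HasSeparator (VFun V C) := by
  let G := separator V
  refine ⟨∐ fun c : C => (reprTensor V c).obj G, ?_⟩
  rw [isSeparator_sigma]
  intro X Y f g h
  ext c
  refine (isSeparator_def _).1 (isSeparator_separator V) _ _ fun k => ?_
  have := h _ ⟨c⟩ (reprDesc c k)
  have := (reprAdj V c).homEquiv G Y |>.injective.eq_iff.2 this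
  rw [Adjunction.homEquiv_naturality_right, Adjunction.homEquiv_naturality_right] at this
  have h' : (reprAdj V c).homEquiv G X (reprDesc c k) = k := by
    rw [reprAdj, Adjunction.mkOfHomEquiv_homEquiv]
    exact reprUnit_desc c k
  rwa [h'] at this

instance : HasColimitsOfSize.{v, v} (VFun V C) where
  has_colimits_of_shape _ _ := inferInstance

instance (K : Type v) [SmallCategory K] [IsFiltered K] : HasExactColimitsOfShape K (VFun V C) where
  preservesFiniteLimits := by
    have : (colim : (K ⥤ VFun V C) ⥤ VFun V C).PreservesHomology :=
      Functor.preservesHomology_of_map_exact _ fun S hS => exact_of_ev _ fun a => by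
        have h := (exact_map_whiskeringRight S hS (ev V a)).map colim
        refine ShortComplex.exact_of_iso ?_ h
        have e := (preservesColimitNatIso (J := K) (ev V a)).symm
        exact ShortComplex.isoMk (e.app _) (e.app _) (e.app _) (e.hom.naturality _).symm
          (e.hom.naturality _).symm
    exact Functor.preservesFiniteLimits_of_preservesHomology _

instance : IsGrothendieckAbelian.{v} (VFun V C) where
  hasFilteredColimitsOfSize := ⟨fun _ _ _ => inferInstance⟩
  ab5OfSize := ⟨fun _ _ _ => inferInstance⟩

end Grothendieck

end VFun

end

end EnrichedDerived

/-! ### Coproducts in the derived category of a Grothendieck category -/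

namespace CategoryTheory.Limits

variable {𝒳 𝒟 ℰ : Type*} [Category* 𝒳] [Category* 𝒟] [Category* ℰ] (L : 𝒳 ⥤ 𝒟) [L.EssSurj]
  (K : Type w)

/-- Every family of objects in the target of an essentially surjective functor comes from the
source. -/
noncomputable def discreteLiftIso (D : Discrete K ⥤ 𝒟) :
    Discrete.functor (fun k => L.objPreimage (D.obj ⟨k⟩)) ⋙ L ≅ D :=
  Discrete.natIso fun k => L.objObjPreimageIso (D.obj k)

lemma hasColimitsOfShape_discrete_of_essSurj [HasColimitsOfShape (Discrete K) 𝒳]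
    [PreservesColimitsOfShape (Discrete K) L] : HasColimitsOfShape (Discrete K) 𝒟 where
  has_colimit D := hasColimit_of_iso (discreteLiftIso L K D).symm

lemma preservesColimitsOfShape_discrete_of_essSurj [HasColimitsOfShape (Discrete K) 𝒳]
    [PreservesColimitsOfShape (Discrete K) L] (G : 𝒟 ⥤ ℰ)
    [PreservesColimitsOfShape (Discrete K) (L ⋙ G)] :
    PreservesColimitsOfShape (Discrete K) G where
  preservesColimit {D} := by
    have : PreservesColimit
        (Discrete.functor (fun k => L.objPreimage (D.obj ⟨k⟩)) ⋙ L) G :=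
      preservesColimit_of_preserves_colimit_cocone
        (isColimitOfPreserves L (colimit.isColimit _))
        (isColimitOfPreserves (L ⋙ G) (colimit.isColimit _))
    exact preservesColimit_of_iso_diagram G (discreteLiftIso L K D)

end CategoryTheory.Limits

/-! ### Null-homotopies as lifts and as extensions -/

namespace CochainComplex

open HomComplex

variable {𝒜 : Type u} [Category.{v} 𝒜] [Abelian 𝒜]

lemma exists_lift_of_homotopy {X Y : CochainComplex 𝒜 ℤ} {f : X ⟶ Y} (h : Homotopy f 0) :
    ∃ l : X ⟶ mappingCocone (𝟙 Y), l ≫ mappingCocone.fst (𝟙 Y) = f := by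
  obtain ⟨z, hz⟩ := (Cochain.equivHomotopy _ _) h
  refine ⟨mappingCocone.lift (𝟙 Y) f (-z) ?_, mappingCocone.lift_fst _ _ _ _⟩
  rw [δ_neg]
  simp [hz]

lemma exists_homotopy_of_extension {X Y : CochainComplex 𝒜 ℤ} {f : X ⟶ Y}
    (r : mappingCone (𝟙 X) ⟶ Y) (hr : mappingCone.inr (𝟙 X) ≫ r = f) :
    Nonempty (Homotopy f 0) := by
  refine ⟨(Cochain.equivHomotopy _ _).symm
    ⟨(mappingCone.inl (𝟙 X)).comp (Cochain.ofHom r) (add_zero _), ?_⟩⟩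
  rw [δ_comp_ofHom, mappingCone.δ_inl, ← Cochain.ofHom_comp]
  simp [hr]

lemma homotopy_fst_id (L : CochainComplex 𝒜 ℤ) :
    Nonempty (Homotopy (mappingCocone.fst (𝟙 L)) 0) :=
  ⟨(Cochain.equivHomotopy _ _).symm
    ⟨-mappingCocone.descCochain (𝟙 L) 0 (Cochain.ofHom (𝟙 L)) (by lia), by
      rw [δ_neg, mappingCocone.δ_descCochain _ _ _ _ 1 (by lia)]
      simp⟩⟩

/-- A null-homotopy is a lift through the contractible cocone of `𝟙 Y`, and lifts on the summands
assemble to a lift on the coproduct. -/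
lemma exists_homotopy_sigma {K : Type w} {X : K → CochainComplex 𝒜 ℤ} [HasCoproduct X]
    {Y : CochainComplex 𝒜 ℤ} (f : ∐ X ⟶ Y)
    (h : ∀ k, Nonempty (Homotopy (Sigma.ι X k ≫ f) 0)) : Nonempty (Homotopy f 0) := by
  choose l hl using fun k => exists_lift_of_homotopy (h k).some
  obtain ⟨h₀⟩ := homotopy_fst_id Y
  have : Sigma.desc l ≫ mappingCocone.fst (𝟙 Y) = f := Sigma.hom_ext _ _ fun k => by simp [hl]
  exact ⟨(Homotopy.ofEq this.symm).trans ((h₀.compLeft (Sigma.desc l)).trans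
    (Homotopy.ofEq comp_zero))⟩

end CochainComplex

/-! ### Morphisms and coproducts in the derived category -/

namespace DerivedCategory

variable {𝒜 : Type u} [Category.{v} 𝒜] [Abelian 𝒜] [HasDerivedCategory.{w₁} 𝒜]

section

variable {K L : CochainComplex 𝒜 ℤ}

lemma Q_map_surjective_iff : Function.Surjective (Q.map : (K ⟶ L) → _) ↔
    Function.Surjective (Qh.map :
      ((HomotopyCategory.quotient _ _).obj K ⟶ (HomotopyCategory.quotient _ _).obj L) → _) := by
  constructor
  · intro h f
    obtain ⟨g, hg⟩ := h ((quotientCompQhIso 𝒜).inv.app K ≫ f ≫ (quotientCompQhIso 𝒜).hom.app L)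
    refine ⟨(HomotopyCategory.quotient _ _).map g, ?_⟩
    rw [← cancel_mono ((quotientCompQhIso 𝒜).hom.app L)]
    have := quotientCompQhIso_hom_naturality g
    rw [hg] at this
    simpa using this
  · intro h f
    obtain ⟨g, hg⟩ := h ((quotientCompQhIso 𝒜).hom.app K ≫ f ≫ (quotientCompQhIso 𝒜).inv.app L)
    obtain ⟨g, rfl⟩ := (HomotopyCategory.quotient _ _).map_surjective g
    refine ⟨g, ?_⟩
    rw [← cancel_epi ((quotientCompQhIso 𝒜).hom.app K), ← quotientCompQhIso_hom_naturality g, hg]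
    simp

lemma homotopy_of_Q_map_eq_zero (h : Function.Injective (Qh.map :
      ((HomotopyCategory.quotient _ _).obj K ⟶ (HomotopyCategory.quotient _ _).obj L) → _))
    {g : K ⟶ L} (hg : Q.map g = 0) : Nonempty (Homotopy g 0) := by
  refine ⟨HomotopyCategory.homotopyOfEq _ _ (h ?_)⟩
  rw [← cancel_mono ((quotientCompQhIso 𝒜).hom.app L), quotientCompQhIso_hom_naturality, hg]
  simp

lemma exists_Q_map_eq_of_isKInjective [L.IsKInjective] (f : Q.obj K ⟶ Q.obj L) :
    ∃ g, Q.map g = f :=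
  Q_map_surjective_iff.2 (CochainComplex.IsKInjective.Qh_map_bijective _ L).2 f

lemma homotopy_of_isKInjective [L.IsKInjective] {g : K ⟶ L} (hg : Q.map g = 0) :
    Nonempty (Homotopy g 0) :=
  homotopy_of_Q_map_eq_zero (CochainComplex.IsKInjective.Qh_map_bijective _ L).1 hg

lemma exists_Q_map_eq_of_isKProjective [K.IsKProjective] (f : Q.obj K ⟶ Q.obj L) :
    ∃ g, Q.map g = f :=
  Q_map_surjective_iff.2 (CochainComplex.IsKProjective.Qh_map_bijective K _).2 f

lemma homotopy_of_isKProjective [K.IsKProjective] {g : K ⟶ L} (hg : Q.map g = 0) :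
    Nonempty (Homotopy g 0) :=
  homotopy_of_Q_map_eq_zero (CochainComplex.IsKProjective.Qh_map_bijective K _).1 hg

lemma Q_map_eq_zero_of_homotopy {g : K ⟶ L} (h : Nonempty (Homotopy g 0)) : Q.map g = 0 :=
  (Q_map_eq_of_homotopy _ h.some).trans (Functor.map_zero _ _ _)

end

variable [IsGrothendieckAbelian.{v} 𝒜]

lemma exists_Q_iso_isInjectiveFibrant (X : DerivedCategory 𝒜) :
    ∃ Y : CochainComplex 𝒜 ℤ, IsInjectiveFibrant Y ∧ Nonempty (X ≅ Q.obj Y) := by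
  obtain ⟨Y, k, hk, hY⟩ := CochainComplex.exists_acyclicMono_isInjectiveFibrant (Q.objPreimage X)
  have : QuasiIso k := hk.2
  exact ⟨Y, hY, ⟨(Q.objObjPreimageIso X).symm ≪≫ asIso (Q.map k)⟩⟩

/-- With a K-injective complex in place of the target, morphisms are homotopy classes of chain maps.
Existence is the universal property of the coproduct of complexes, uniqueness is
`exists_homotopy_sigma`. -/
instance (K : Type v) : PreservesColimitsOfShape (Discrete K)
    (Q : CochainComplex 𝒜 ℤ ⥤ DerivedCategory 𝒜) := by
  suffices ∀ X : K → CochainComplex 𝒜 ℤ, PreservesColimit (Discrete.functor X) Q from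
    preservesColimitsOfShape_of_discrete _
  intro X
  refine preservesColimit_of_preserves_colimit_cocone (coproductIsCoproduct X)
    ((isColimitMapCoconeCofanMkEquiv Q X _).symm ?_)
  have key (T : DerivedCategory 𝒜) (f : ∀ k, Q.obj (X k) ⟶ T) :
      ∃! g : Q.obj (∐ X) ⟶ T, ∀ k, Q.map (Sigma.ι X k) ≫ g = f k := by
    obtain ⟨Y, hY, ⟨e⟩⟩ := exists_Q_iso_isInjectiveFibrant T
    have := CochainComplex.IsInjectiveFibrant.isKInjective hY
    choose g hg using fun k => exists_Q_map_eq_of_isKInjective (f k ≫ e.hom)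
    refine ⟨Q.map (Sigma.desc g) ≫ e.inv, fun k => ?_, fun g' hg' => ?_⟩
    · rw [← Q.map_comp_assoc, Sigma.ι_desc, hg]
      simp
    · rw [← cancel_mono e.hom, Category.assoc, e.inv_hom_id, Category.comp_id]
      obtain ⟨t, ht⟩ := exists_Q_map_eq_of_isKInjective (g' ≫ e.hom)
      rw [← ht, ← sub_eq_zero, ← Functor.map_sub]
      apply Q_map_eq_zero_of_homotopy
      refine CochainComplex.exists_homotopy_sigma _ fun k => homotopy_of_isKInjective ?_
      simp only [Preadditive.comp_sub, Functor.map_sub, Functor.map_comp, ht, Sigma.ι_desc, hg]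
      rw [reassoc_of% (hg' k), sub_self]
  choose d hd hd' using key
  exact Cofan.IsColimit.mk _ (fun s => d s.pt s.inj) (fun s k => hd s.pt s.inj k)
    (fun s m hm => hd' s.pt s.inj m hm)

instance : HasCoproducts.{v} (DerivedCategory 𝒜) :=
  fun K => hasColimitsOfShape_discrete_of_essSurj Q K

lemma preservesCoproducts_mapDerivedCategory {ℬ : Type*} [Category.{v} ℬ] [Abelian ℬ]
    [HasDerivedCategory.{w₂} ℬ] [IsGrothendieckAbelian.{v} ℬ] (F : 𝒜 ⥤ ℬ) [F.Additive]
    [PreservesFiniteLimits F] [PreservesFiniteColimits F] (K : Type v)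
    [PreservesColimitsOfShape (Discrete K) F] :
    PreservesColimitsOfShape (Discrete K) F.mapDerivedCategory := by
  have : PreservesColimitsOfShape (Discrete K) (onComplexes F) :=
    HomologicalComplex.preservesColimitsOfShape_of_eval _ fun n =>
      inferInstanceAs (PreservesColimitsOfShape (Discrete K) (HomologicalComplex.eval _ _ n ⋙ F))
  have : PreservesColimitsOfShape (Discrete K) (Q ⋙ F.mapDerivedCategory) :=
    preservesColimitsOfShape_of_natIso F.mapDerivedCategoryFactors.symm
  exact preservesColimitsOfShape_discrete_of_essSurj Q K _

end DerivedCategory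

/-! ### Compact objects and localizing subcategories of triangulated categories -/

namespace CategoryTheory

open Pretriangulated
open scoped ZeroObject

/-! ### Compact objects -/

section Compact

variable {𝒟 : Type*} [Category* 𝒟] [Preadditive 𝒟]

/-- Compactness of `G`: every morphism from `G` to a coproduct indexed by a set in `Type v` is a
finite sum of morphisms that factor through the summands. -/
def IsCompactObject (G : 𝒟) : Prop :=
  ∀ ⦃K : Type v⦄ ⦃X : K → 𝒟⦄ (c : Cofan X) (_ : IsColimit c) (f : G ⟶ c.pt),
    f ∈ AddSubgroup.closure {g | ∃ (k : K) (h : G ⟶ X k), h ≫ c.inj k = g}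

/-- The quotient map of `Hom(G, c.pt)` by the subgroup of finite sums vanishes on each `Hom(G, X
k)`. As `Hom(G, c.pt)` is their coproduct, it is zero. -/
lemma isCompactObject_of_preservesCoproducts {G : 𝒟}
    (h : ∀ K : Type v, PreservesColimitsOfShape (Discrete K)
      (preadditiveCoyoneda.obj (Opposite.op G))) : IsCompactObject.{v} G := by
  intro K X c hc f
  have := h K
  set F := preadditiveCoyoneda.obj (Opposite.op G) with hF
  let S : AddSubgroup (F.obj c.pt) :=
    AddSubgroup.closure {g | ∃ (k : K) (h : G ⟶ X k), h ≫ c.inj k = g}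
  have hcol := (isColimitMapCoconeCofanMkEquiv F X c.inj)
    (isColimitOfPreserves F (hc.ofIsoColimit (Cocone.ext (Iso.refl _) (fun ⟨_⟩ => Category.comp_id _))))
  let q : F.obj c.pt ⟶ AddCommGrpCat.of (F.obj c.pt ⧸ S) :=
    AddCommGrpCat.ofHom (QuotientAddGroup.mk' S)
  have hq : q = 0 := by
    refine Cofan.IsColimit.hom_ext hcol _ _ fun k => ?_
    ext g
    exact (QuotientAddGroup.eq_zero_iff _).2 (AddSubgroup.subset_closure ⟨k, g, rfl⟩)
  have := congrArg (fun t => t.hom f) hq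
  exact (QuotientAddGroup.eq_zero_iff (N := S) f).1 this

lemma IsCompactObject.of_iso {G G' : 𝒟} (e : G ≅ G') (h : IsCompactObject.{v} G) :
    IsCompactObject.{v} G' := by
  intro K X c hc f
  have h1 := AddSubgroup.mem_map_of_mem (Preadditive.leftComp c.pt e.inv) (h c hc (e.hom ≫ f))
  rw [AddMonoidHom.map_closure] at h1
  have h2 : (Preadditive.leftComp c.pt e.inv) (e.hom ≫ f) = f := e.inv_hom_id_assoc f
  rw [h2] at h1
  refine AddSubgroup.closure_mono ?_ h1
  rintro _ ⟨_, ⟨k, g, rfl⟩, rfl⟩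
  exact ⟨k, e.inv ≫ g, Category.assoc _ _ _⟩

/-- An object `G` that represents `Hom(G', R -)` is compact if `G'` is compact and `R` preserves
coproducts. -/
lemma IsCompactObject.of_corepresents {𝒟' : Type*} [Category* 𝒟'] [Preadditive 𝒟'] {R : 𝒟 ⥤ 𝒟'}
    [R.Additive] (hR : ∀ K : Type v, PreservesColimitsOfShape (Discrete K) R) {G : 𝒟} {G' : 𝒟'}
    (u : G' ⟶ R.obj G) (hu : ∀ X : 𝒟, Function.Bijective fun f : G ⟶ X => u ≫ R.map f)
    (h : IsCompactObject.{v} G') : IsCompactObject.{v} G := by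
  intro K X c hc f
  have := hR K
  have hcol := (isColimitMapCoconeCofanMkEquiv R X c.inj)
    (isColimitOfPreserves R (hc.ofIsoColimit (Cocone.ext (Iso.refl _) (fun ⟨_⟩ => Category.comp_id _))))
  let e : (G ⟶ c.pt) →+ (G' ⟶ R.obj c.pt) :=
    { toFun f := u ≫ R.map f, map_zero' := by simp, map_add' := by simp }
  have h1 := h _ hcol (u ≫ R.map f)
  suffices ∀ t : G' ⟶ R.obj c.pt, t ∈ AddSubgroup.closure
      {g | ∃ (k : K) (h : G' ⟶ R.obj (X k)), h ≫ R.map (c.inj k) = g} →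
      t ∈ (AddSubgroup.closure {g | ∃ (k : K) (h : G ⟶ X k), h ≫ c.inj k = g}).map e by
    obtain ⟨f', hf', he⟩ := this _ h1
    rwa [← (hu _).1 he]
  intro t ht
  rw [AddMonoidHom.map_closure]
  refine AddSubgroup.closure_mono ?_ ht
  rintro _ ⟨k, g, rfl⟩
  obtain ⟨g, rfl⟩ := (hu _).2 g
  exact ⟨_, ⟨k, g, rfl⟩, by simp [e]⟩

lemma IsCompactObject.shift {G : 𝒟} [HasShift 𝒟 ℤ] [∀ n : ℤ, (shiftFunctor 𝒟 n).Additive]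
    (h : IsCompactObject.{v} G) (n : ℤ) : IsCompactObject.{v} (G⟦n⟧) := by
  let adj := (shiftEquiv 𝒟 n).toAdjunction
  refine IsCompactObject.of_corepresents (R := shiftFunctor 𝒟 (-n)) (fun K => inferInstance)
    (adj.unit.app G) (fun X => ?_) h
  exact (adj.homEquiv G X).bijective

end Compact

/-! ### Bousfield localization by a telescope -/

section Telescope

variable {𝒟 : Type u} [Category.{w₁} 𝒟] [Preadditive 𝒟] [HasZeroObject 𝒟] [HasShift 𝒟 ℤ]
  [∀ n : ℤ, (shiftFunctor 𝒟 n).Additive] [Pretriangulated 𝒟]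

/-! Exactness properties of distinguished triangles in terms of their three morphisms. -/

section

variable {X Y Z : 𝒟} {f : X ⟶ Y} {g : Y ⟶ Z} {h : Z ⟶ X⟦(1 : ℤ)⟧}

lemma dist_comp₁₂ (hT : Triangle.mk f g h ∈ distTriang 𝒟) : f ≫ g = 0 := comp_distTriang_mor_zero₁₂ _ hT

lemma dist_comp₃₁ (hT : Triangle.mk f g h ∈ distTriang 𝒟) :
    h ≫ f⟦(1 : ℤ)⟧' = 0 := comp_distTriang_mor_zero₃₁ _ hT

lemma dist_lift₂ (hT : Triangle.mk f g h ∈ distTriang 𝒟)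
    {W : 𝒟} (a : W ⟶ Y) (ha : a ≫ g = 0) : ∃ b : W ⟶ X, a = b ≫ f :=
  Triangle.coyoneda_exact₂ _ hT a ha

lemma dist_lift₃ (hT : Triangle.mk f g h ∈ distTriang 𝒟)
    {W : 𝒟} (a : W ⟶ Z) (ha : a ≫ h = 0) : ∃ b : W ⟶ Y, a = b ≫ g :=
  Triangle.coyoneda_exact₃ _ hT a ha

lemma dist_desc₂ (hT : Triangle.mk f g h ∈ distTriang 𝒟)
    {W : 𝒟} (a : Y ⟶ W) (ha : f ≫ a = 0) : ∃ b : Z ⟶ W, a = g ≫ b :=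
  Triangle.yoneda_exact₂ _ hT a ha

end

section

variable {K : Type v} (G : K → 𝒟)

lemma le_localizingClosure (k : K) : localizingClosure.{w₁, v} G (G k) := fun _ _ h => h k

lemma isLocalizing_localizingClosure : IsLocalizing.{w₁, v} (localizingClosure.{w₁, v} G) := by
  refine ⟨?_, ⟨fun e h S hS hG => hS.2.1.of_iso e (h S hS hG)⟩, fun K' => ⟨?_⟩⟩
  · exact
      { exists_zero := ⟨0, isZero_zero _, fun S hS _ =>
          have := hS.1; have := hS.2.1; ObjectProperty.prop_zero S⟩
        isStableUnderShiftBy n := ⟨fun X h S hS hG =>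
          have := hS.1; ObjectProperty.le_shift S n _ (h S hS hG)⟩
        toIsTriangulatedClosed₂ :=
          have : (localizingClosure.{w₁, v} G).IsClosedUnderIsomorphisms :=
            ⟨fun e h S hS hG => hS.2.1.of_iso e (h S hS hG)⟩
          .mk' fun T hT h₁ h₃ S hS hG =>
          have := hS.1; have := hS.2.1
          ObjectProperty.ext_of_isTriangulatedClosed₂ S T hT (h₁ S hS hG) (h₃ S hS hG) }
  · rintro X ⟨p, hp⟩ S hS hG
    have := hS.2.2 K'
    exact ObjectProperty.prop_of_isColimit _ p.isColimit (fun j => hp j S hS hG)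

/-- An object with no nonzero morphisms from the shifts of the generators has no nonzero morphisms
from the localizing subcategory that they generate. -/
lemma eq_zero_of_localizingClosure {X Z : 𝒟} (hX : localizingClosure.{w₁, v} G X)
    (hZ : ∀ (k : K) (n : ℤ) (f : (G k)⟦n⟧ ⟶ Z), f = 0) (f : X ⟶ Z) : f = 0 := by
  let P : ObjectProperty 𝒟 := fun Z => ∀ (k : K) (n : ℤ) (f : (G k)⟦n⟧ ⟶ Z), f = 0
  have hP : P.IsStableUnderShift ℤ :=
    { isStableUnderShiftBy m := ⟨fun Y hY k n f => by
        obtain ⟨g, rfl⟩ := ((shiftEquiv 𝒟 m).symm.toAdjunction.homEquiv _ _).surjective f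
        have hg : g = 0 := (cancel_epi ((shiftFunctorAdd' 𝒟 n (-m) (n - m) (by lia)).hom.app
          (G k))).1 ((hY k _ _).trans comp_zero.symm)
        rw [hg, Adjunction.homEquiv_unit, Functor.map_zero, comp_zero]
        rfl⟩ }
  -- The left orthogonal of a shift-stable class is localizing, and it contains every `G k`.
  have hloc : IsLocalizing.{w₁, v} P.leftOrthogonal := by
    refine ⟨inferInstance, inferInstance, fun K' => ⟨?_⟩⟩
    rintro X ⟨p, hp⟩ Y f hY
    exact p.isColimit.hom_ext fun j => (hp j (p.ι.app j ≫ f) hY).trans comp_zero.symm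
  refine hX _ hloc (fun k Y g hY => ?_) f hZ
  rw [← cancel_epi ((shiftFunctorZero 𝒟 ℤ).hom.app (G k)), comp_zero]
  exact hY k 0 _

end

/-- An object of a subcategory over `X`. -/
structure ObjectProperty.OverStage (S : ObjectProperty 𝒟) (X : 𝒟) where
  pt : 𝒟
  hom : pt ⟶ X
  prop : S pt

open ObjectProperty

variable [HasCoproducts.{v} 𝒟] [LocallySmall.{v} 𝒟] {ι : Type v} (G : ι → 𝒟)
  {S : ObjectProperty 𝒟}

lemma prop_sigma (hS : IsLocalizing.{w₁, v} S) {K : Type v} (X : K → 𝒟) (h : ∀ k, S (X k)) :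
    S (∐ X) :=
  have := hS.2.2 K
  S.prop_of_isColimit (coproductIsCoproduct X) fun ⟨j⟩ => h j

instance (T : 𝒟) (i : ι) (p : (G i ⟶ T) → Prop) : Small.{v} {f : G i ⟶ T // p f} :=
  have : Small.{v} (G i ⟶ T) := LocallySmall.hom_small _ _
  inferInstance

variable {G}

lemma exists_initial_stage (hS : IsLocalizing.{w₁, v} S) (hG : ∀ i, S (G i)) (X : 𝒟) :
    ∃ T : S.OverStage X, ∀ i (f : G i ⟶ X), ∃ g, g ≫ T.hom = f := by
  have (i : ι) : Small.{v} (G i ⟶ X) := LocallySmall.hom_small _ _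
  let K := Shrink.{v} (Σ i, (G i ⟶ X))
  let d (k : K) := (equivShrink (Σ i, (G i ⟶ X))).symm k
  refine ⟨⟨∐ fun k => G (d k).1, Limits.Sigma.desc fun k => (d k).2,
    prop_sigma hS _ fun _ => hG _⟩, fun i f => ?_⟩
  have hk : d (equivShrink _ ⟨i, f⟩) = ⟨i, f⟩ := Equiv.symm_apply_apply _ _
  have := Sigma.ι_desc (fun k => (d k).2) (equivShrink _ ⟨i, f⟩)
  generalize hι : Sigma.ι (fun k => G (d k).1) (equivShrink _ ⟨i, f⟩) = t at this
  clear hι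
  revert t
  rw [hk]
  exact fun t ht => ⟨t, ht⟩

/-- The new stage is the cone of the sum of all morphisms from generators to `T.pt` that die in `X`;
`T.hom` extends to it because it kills them. -/
lemma exists_next_stage (hS : IsLocalizing.{w₁, v} S) (hG : ∀ i, S (G i)) {X : 𝒟}
    (T : S.OverStage X) : ∃ (T' : S.OverStage X) (u : T.pt ⟶ T'.pt), u ≫ T'.hom = T.hom ∧
      ∀ i (f : G i ⟶ T.pt), f ≫ T.hom = 0 → f ≫ u = 0 := by
  have := hS.1
  have := hS.2.1
  let K := Shrink.{v} (Σ i, {f : G i ⟶ T.pt // f ≫ T.hom = 0})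
  let d (k : K) := (equivShrink (Σ i, {f : G i ⟶ T.pt // f ≫ T.hom = 0})).symm k
  obtain ⟨T', u, δ, h⟩ := distinguished_cocone_triangle (Limits.Sigma.desc fun k => (d k).2.1)
  obtain ⟨p', hp'⟩ := dist_desc₂ h T.hom
    (Sigma.hom_ext _ _ fun k => by
      rw [← Category.assoc, Sigma.ι_desc, (d k).2.2, comp_zero])
  refine ⟨⟨T', p', S.ext_of_isTriangulatedClosed₃ _ h (prop_sigma hS _ fun _ => hG _) T.prop⟩, u,
    hp'.symm, fun i f hf => ?_⟩
  have hk : d (equivShrink _ ⟨i, f, hf⟩) = ⟨i, f, hf⟩ := Equiv.symm_apply_apply _ _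
  have h1 : (d (equivShrink _ ⟨i, f, hf⟩)).2.1 ≫ u = 0 := by
    have h2 := dist_comp₁₂ h
    have := Sigma.ι_desc (fun k => (d k).2.1) (equivShrink _ ⟨i, f, hf⟩)
    rw [← this, Category.assoc, h2, comp_zero]
  rw [hk] at h1
  exact h1

section

variable {T : ULift.{v} ℕ → 𝒟} (t : ∀ n, T ⟨n⟩ ⟶ T ⟨n + 1⟩)

/-- The endomorphism `1 - s` of the coproduct of a sequence. -/
noncomputable def telescopeMap : ∐ T ⟶ ∐ T :=
  Limits.Sigma.desc fun n => Sigma.ι T n - t n.1 ≫ Sigma.ι T ⟨n.1 + 1⟩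

lemma ι_telescopeMap (n : ULift.{v} ℕ) :
    Sigma.ι T n ≫ telescopeMap t = Sigma.ι T n - t n.1 ≫ Sigma.ι T ⟨n.1 + 1⟩ :=
  Sigma.ι_desc _ _

/-- The projection of a coproduct on a summand. -/
noncomputable def sigmaProj {K : Type v} (X : K → 𝒟) (k : K) : ∐ X ⟶ X k :=
  open scoped Classical in
  Limits.Sigma.desc fun k' => if h : k' = k then eqToHom (congrArg X h) else 0

lemma ι_sigmaProj_self {K : Type v} (X : K → 𝒟) (k : K) :
    Sigma.ι X k ≫ sigmaProj X k = 𝟙 _ := by simp [sigmaProj]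

lemma ι_sigmaProj_ne {K : Type v} (X : K → 𝒟) {k k' : K} (h : k' ≠ k) :
    Sigma.ι X k' ≫ sigmaProj X k = 0 := by simp [sigmaProj, h]

lemma telescopeMap_proj_zero : telescopeMap t ≫ sigmaProj T ⟨0⟩ = sigmaProj T ⟨0⟩ := by
  refine Sigma.hom_ext _ _ fun n => ?_
  rw [← Category.assoc, ι_telescopeMap, Preadditive.sub_comp, Category.assoc,
    ι_sigmaProj_ne T (k' := ⟨n.1 + 1⟩) (k := ⟨0⟩) (by simp)]
  simp

lemma telescopeMap_proj_succ (m : ℕ) : telescopeMap t ≫ sigmaProj T ⟨m + 1⟩ =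
    sigmaProj T ⟨m + 1⟩ - sigmaProj T ⟨m⟩ ≫ t m := by
  refine Sigma.hom_ext _ _ fun ⟨n⟩ => ?_
  rw [← Category.assoc, ι_telescopeMap, Preadditive.sub_comp, Category.assoc,
    Preadditive.comp_sub]
  congr 1
  by_cases h : n = m
  · subst h
    rw [ι_sigmaProj_self, ← Category.assoc, ι_sigmaProj_self, Category.comp_id, Category.id_comp]
  · rw [ι_sigmaProj_ne T (by simpa using h), ← Category.assoc,
      ι_sigmaProj_ne T (by simpa using h), comp_zero, zero_comp]

lemma eq_zero_of_sigmaProj {H : 𝒟} (hH : IsCompactObject.{v} H) {K : Type v} (X : K → 𝒟)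
    (h : H ⟶ ∐ X) (h0 : ∀ k, h ≫ sigmaProj X k = 0) : h = 0 := by
  classical
  -- By compactness `h` is a finite sum of its components. Allowing every larger finite set lets two
  -- such sums be compared on a union.
  suffices ∃ s : Finset K, ∀ s', s ⊆ s' → h = ∑ k ∈ s', (h ≫ sigmaProj X k) ≫ Sigma.ι X k by
    obtain ⟨s, hs⟩ := this
    rw [hs s subset_rfl]
    exact Finset.sum_eq_zero fun k _ => by rw [h0, zero_comp]
  clear h0
  have := hH _ (coproductIsCoproduct X) h
  induction this using AddSubgroup.closure_induction with
  | mem x hx =>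
    obtain ⟨k, g, rfl⟩ := hx
    refine ⟨{k}, fun s' hs' => ?_⟩
    change g ≫ Sigma.ι X k = ∑ k' ∈ s', ((g ≫ Sigma.ι X k) ≫ _) ≫ _
    rw [Finset.sum_eq_single k]
    · rw [Category.assoc g, ι_sigmaProj_self, Category.comp_id]
    · intro k' _ hk'
      rw [Category.assoc g, ι_sigmaProj_ne X hk'.symm, comp_zero, zero_comp]
    · intro hk
      exact absurd (hs' (Finset.mem_singleton_self k)) hk
  | zero => exact ⟨∅, fun s' _ => by
      rw [Finset.sum_eq_zero]; intro k _; rw [zero_comp, zero_comp]⟩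
  | add x y _ _ hx hy =>
    obtain ⟨s, hs⟩ := hx
    obtain ⟨s₁, hs₁⟩ := hy
    refine ⟨s ∪ s₁, fun s' hs' => ?_⟩
    simp only [Preadditive.add_comp, Finset.sum_add_distrib]
    exact congrArg₂ _ (hs _ (Finset.union_subset_left hs')) (hs₁ _ (Finset.union_subset_right hs'))
  | neg x _ hx =>
    obtain ⟨s, hs⟩ := hx
    refine ⟨s, fun s' hs' => ?_⟩
    simp only [Preadditive.neg_comp, Finset.sum_neg_distrib]
    exact congrArg _ (hs _ hs')

/-- The component of `h ≫ telescopeMap t` at `m + 1` is that of `h` minus the one at `m` followed by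
`t m`, so all components of `h` vanish by induction. -/
lemma eq_zero_of_comp_telescopeMap {H : 𝒟} (hH : IsCompactObject.{v} H) (h : H ⟶ ∐ T)
    (h0 : h ≫ telescopeMap t = 0) : h = 0 := by
  refine eq_zero_of_sigmaProj hH T h fun ⟨n⟩ => ?_
  induction n with
  | zero => rw [← telescopeMap_proj_zero t, ← Category.assoc, h0, zero_comp]
  | succ m hm =>
    have := congrArg (fun f => h ≫ f) (telescopeMap_proj_succ t m)
    rw [← Category.assoc, h0, zero_comp, Preadditive.comp_sub, ← Category.assoc, hm, zero_comp,
      sub_zero] at this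
    exact this.symm

/-- As `a` kills `1 - s`, a morphism to stage `n` can be pushed to any later stage without changing
its composite with `a`. Thus a finite sum can be moved to one common stage. -/
lemma exists_factor_stage {H : 𝒟} (hH : IsCompactObject.{v} H) {W : 𝒟} (a : ∐ T ⟶ W)
    (ha : telescopeMap t ≫ a = 0) (g : H ⟶ ∐ T) :
    ∃ (n : ℕ) (g' : H ⟶ T ⟨n⟩), g' ≫ Sigma.ι T ⟨n⟩ ≫ a = g ≫ a := by
  have hn (n : ℕ) : t n ≫ Sigma.ι T ⟨n + 1⟩ ≫ a = Sigma.ι T ⟨n⟩ ≫ a := by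
    have := congrArg (fun f => Sigma.ι T ⟨n⟩ ≫ f) ha
    rw [← Category.assoc, ι_telescopeMap, Preadditive.sub_comp, comp_zero, sub_eq_zero] at this
    rw [this, Category.assoc]
  have hle (n k : ℕ) (g' : H ⟶ T ⟨n⟩) : ∃ g'' : H ⟶ T ⟨n + k⟩,
      g'' ≫ Sigma.ι T ⟨n + k⟩ ≫ a = g' ≫ Sigma.ι T ⟨n⟩ ≫ a := by
    induction k with
    | zero => exact ⟨g', rfl⟩
    | succ k hk =>
      obtain ⟨g'', h⟩ := hk
      exact ⟨g'' ≫ t (n + k), by rw [← h, Category.assoc, ← hn (n + k)]; rfl⟩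
  have := hH _ (coproductIsCoproduct T) g
  induction this using AddSubgroup.closure_induction with
  | mem x hx =>
    obtain ⟨⟨n⟩, g, rfl⟩ := hx
    exact ⟨n, g, (Category.assoc _ _ _).symm⟩
  | zero => exact ⟨0, 0, by rw [zero_comp]; exact zero_comp.symm⟩
  | add x y _ _ hx hy =>
    obtain ⟨n, x', hx'⟩ := hx
    obtain ⟨m, y', hy'⟩ := hy
    obtain ⟨x'', hx''⟩ := hle n m x'
    obtain ⟨y'', hy''⟩ : ∃ y'' : H ⟶ T ⟨n + m⟩, _ := Nat.add_comm m n ▸ hle m n y'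
    refine ⟨n + m, x'' + y'', ?_⟩
    rw [Preadditive.add_comp, hx'', hy'', hx', hy']
    exact (Preadditive.add_comp _ _ _ _ _ _).symm
  | neg x _ hx =>
    obtain ⟨n, x', hx'⟩ := hx
    refine ⟨n, -x', ?_⟩
    rw [Preadditive.neg_comp, hx']
    exact (Preadditive.neg_comp _ _).symm

end

lemma eq_zero_of_comp_shift {H H' X Y : 𝒟} (e : H ≅ H'⟦(1 : ℤ)⟧) {φ : X ⟶ Y}
    (hφ : ∀ h : H' ⟶ X, h ≫ φ = 0 → h = 0) {f : H ⟶ X⟦(1 : ℤ)⟧} (hf : f ≫ φ⟦(1 : ℤ)⟧' = 0) :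
    f = 0 := by
  obtain ⟨h, hh⟩ := (shiftFunctor 𝒟 (1 : ℤ)).map_surjective (e.inv ≫ f)
  have : h = 0 := hφ h ((shiftFunctor 𝒟 (1 : ℤ)).map_injective (by
    rw [Functor.map_comp, hh, Category.assoc, hf, comp_zero, Functor.map_zero]))
  rw [← cancel_epi e.inv, ← hh, this, Functor.map_zero, comp_zero]

/-- A family of compact objects that is closed under desuspension generates its localizing
subcategory in the sense that every object is an extension of an orthogonal object by an object of
this subcategory. -/
theorem exists_distinguished_triangle_of_compact (hS : IsLocalizing.{w₁, v} S) (hG : ∀ i, S (G i))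
    (hc : ∀ i, IsCompactObject.{v} (G i))
    (hs : ∀ i, ∃ i', Nonempty (G i ≅ (G i')⟦(1 : ℤ)⟧)) (X : 𝒟) :
    ∃ (T Z : 𝒟) (p : T ⟶ X) (q : X ⟶ Z) (δ : Z ⟶ T⟦(1 : ℤ)⟧),
      Triangle.mk p q δ ∈ distTriang 𝒟 ∧ S T ∧ ∀ i (f : G i ⟶ Z), f = 0 := by
  have := hS.1
  have := hS.2.1
  obtain ⟨T₀, hT₀⟩ := exists_initial_stage hS hG X
  choose next u hu hu' using fun T : S.OverStage X => exists_next_stage hS hG T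
  let st : ℕ → S.OverStage X := fun n => Nat.rec T₀ (fun _ T => next T) n
  let T : ULift.{v} ℕ → 𝒟 := fun n => (st n.1).pt
  let t : ∀ n, T ⟨n⟩ ⟶ T ⟨n + 1⟩ := fun n => u (st n)
  have ht (n : ℕ) : t n ≫ (st (n + 1)).hom = (st n).hom := hu (st n)
  -- `W` is the homotopy colimit of the stages.
  obtain ⟨W, a, δ, hW⟩ := distinguished_cocone_triangle (telescopeMap t)
  have hSig : S (∐ T) := prop_sigma hS _ fun n => (st n.1).prop
  have hSW : S W := S.ext_of_isTriangulatedClosed₃ _ hW hSig hSig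
  have ha : telescopeMap t ≫ a = 0 := dist_comp₁₂ hW
  obtain ⟨p, hp⟩ := dist_desc₂ hW (Limits.Sigma.desc fun n => (st n.1).hom) (by
    refine Sigma.hom_ext _ _ fun n => ?_
    rw [← Category.assoc, ι_telescopeMap, Preadditive.sub_comp, Category.assoc, Sigma.ι_desc,
      Sigma.ι_desc, ht, sub_self, comp_zero])
  have hp' (n : ℕ) : Sigma.ι T ⟨n⟩ ≫ a ≫ p = (st n).hom := by
    have := congrArg (fun f => Sigma.ι T ⟨n⟩ ≫ f) hp
    rw [Sigma.ι_desc] at this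
    exact this.symm
  -- Morphisms from generators to `W` are detected in `X`: each comes from a finite stage, and what
  -- dies in `X` dies at the next stage.
  have inj (i : ι) (f : G i ⟶ W) (hf : f ≫ p = 0) : f = 0 := by
    obtain ⟨i', ⟨e⟩⟩ := hs i
    have h1 : f ≫ δ = 0 := by
      refine eq_zero_of_comp_shift e (φ := telescopeMap t)
        (fun h => eq_zero_of_comp_telescopeMap t (hc i') h) ?_
      rw [Category.assoc]
      rw [dist_comp₃₁ hW, comp_zero]
    obtain ⟨g, hg⟩ := dist_lift₃ hW f h1
    obtain ⟨n, g', hg'⟩ := exists_factor_stage t (hc i) a ha g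
    rw [← hg'] at hg
    have h2 : g' ≫ (st n).hom = 0 := by
      rw [← hp' n, ← hf, hg]
      simp only [Category.assoc]
    have h3 : g' ≫ t n = 0 := hu' (st n) i g' h2
    have h4 := congrArg (fun f => Sigma.ι T ⟨n⟩ ≫ f) ha
    rw [← Category.assoc, ι_telescopeMap, Preadditive.sub_comp, comp_zero, sub_eq_zero] at h4
    rw [hg, h4, ← Category.assoc, ← Category.assoc, h3, zero_comp, zero_comp]
  obtain ⟨Z, q, ε, hZ⟩ := distinguished_cocone_triangle p
  refine ⟨W, Z, p, q, ε, hZ, hSW, fun i f => ?_⟩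
  obtain ⟨i', ⟨e⟩⟩ := hs i
  -- By `inj` for the desuspension, `f` lifts to `X`; since this lift factors through the initial
  -- stage, hence through `p`, it dies in `Z`.
  have h1 : f ≫ ε = 0 := by
    refine eq_zero_of_comp_shift e (φ := p) (inj i') ?_
    rw [Category.assoc]
    rw [dist_comp₃₁ hZ, comp_zero]
  obtain ⟨g, hg⟩ := dist_lift₃ hZ f h1
  obtain ⟨g₀, hg₀⟩ := hT₀ i g
  have h2 : p ≫ q = 0 := dist_comp₁₂ hZ
  have h3 : (st 0).hom = T₀.hom := rfl
  rw [hg, ← hg₀, ← h3, ← hp' 0]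
  simp only [Category.assoc]
  rw [h2]
  simp only [comp_zero]

end Telescope

end CategoryTheory

/-! ### Adjunctions and derived categories -/

namespace CategoryTheory

/-- The adjunction between categories of complexes that is given degreewise by an adjunction of
additive functors. -/
def Adjunction.onComplexes {𝒜 ℬ : Type*} [Category* 𝒜] [Category* ℬ] [Preadditive 𝒜]
    [Preadditive ℬ] {L : 𝒜 ⥤ ℬ} {R : ℬ ⥤ 𝒜} [L.Additive] [R.Additive] (adj : L ⊣ R) :
    EnrichedDerived.onComplexes L ⊣ EnrichedDerived.onComplexes R :=
  Adjunction.mkOfUnitCounit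
    { unit :=
        { app X :=
            { f i := adj.unit.app (X.X i)
              comm' i j _ := (adj.unit.naturality (X.d i j)).symm }
          naturality X Y f := by ext i; exact adj.unit.naturality (f.f i) }
      counit :=
        { app X :=
            { f i := adj.counit.app (X.X i)
              comm' i j _ := (adj.counit.naturality (X.d i j)).symm }
          naturality X Y f := by ext i; exact adj.counit.naturality (f.f i) }
      left_triangle := by ext X i; simp; exact adj.left_triangle_components (X.X i)
      right_triangle := by ext X i; simp; exact adj.right_triangle_components (X.X i) }

end CategoryTheory

namespace DerivedCategory

variable {𝒜 : Type u} [Category.{v} 𝒜] [Abelian 𝒜] [HasDerivedCategory.{w₁} 𝒜]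

instance [IsGrothendieckAbelian.{v} 𝒜] : LocallySmall.{v} (DerivedCategory 𝒜) where
  hom_small X Y := by
    obtain ⟨I, hI, ⟨e⟩⟩ := exists_Q_iso_isInjectiveFibrant Y
    have := CochainComplex.IsInjectiveFibrant.isKInjective hI
    refine small_of_surjective (f := fun g : Q.objPreimage X ⟶ I =>
      (Q.objObjPreimageIso X).inv ≫ Q.map g ≫ e.inv) fun f => ?_
    obtain ⟨g, hg⟩ := exists_Q_map_eq_of_isKInjective ((Q.objObjPreimageIso X).hom ≫ f ≫ e.hom)
    exact ⟨g, by simp [hg]⟩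

/-- Morphisms from `X` to `W` in the derived category are homotopy classes of morphisms of
complexes. -/
structure HomIsHomotopyClass (X W : CochainComplex 𝒜 ℤ) : Prop where
  surj (f : Q.obj X ⟶ Q.obj W) : ∃ g, Q.map g = f
  homotopy (g : X ⟶ W) (hg : Q.map g = 0) : Nonempty (Homotopy g 0)

lemma homIsHomotopyClass_of_isKInjective (X W : CochainComplex 𝒜 ℤ) [W.IsKInjective] :
    HomIsHomotopyClass X W :=
  ⟨exists_Q_map_eq_of_isKInjective, fun _ => homotopy_of_isKInjective⟩

lemma homIsHomotopyClass_of_isKProjective (X W : CochainComplex 𝒜 ℤ) [X.IsKProjective] :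
    HomIsHomotopyClass X W :=
  ⟨exists_Q_map_eq_of_isKProjective, fun _ => homotopy_of_isKProjective⟩

-- A morphism that becomes zero in the localization is right homotopic to `0`. Extending the
-- homotopy along the cofibration from `X` to the cone of `𝟙 X` extends `g` to the cone, which is a
-- chain null-homotopy.
open HomotopicalAlgebra in
lemma homIsHomotopyClass_of_modelCategory [ModelCategory (CochainComplex 𝒜 ℤ)]
    (h : weakEquivalences (CochainComplex 𝒜 ℤ) =
      HomologicalComplex.quasiIso 𝒜 (ComplexShape.up ℤ)) (X W : CochainComplex 𝒜 ℤ)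
    [IsCofibrant X] [IsFibrant W] [Cofibration (CochainComplex.mappingCone.inr (𝟙 X))] :
    HomIsHomotopyClass X W := by
  have : (Q (C := 𝒜)).IsLocalization (weakEquivalences (CochainComplex 𝒜 ℤ)) := by
    rw [h]; infer_instance
  refine ⟨map_surjective_of_isLocalization _ _ _, fun g hg => ?_⟩
  obtain ⟨P, hP, ⟨r⟩⟩ := ((RightHomotopyRel.iff_map_eq Q (X := X) (Y := W) (f := 0) (g := g)).2
    ((Functor.map_zero _ _ _).trans hg.symm)).exists_good_pathObject
  obtain ⟨l, r', hr'⟩ := PathObject.RightHomotopy.homotopy_extension r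
    (CochainComplex.mappingCone.inr (𝟙 X)) 0 comp_zero
  refine CochainComplex.exists_homotopy_of_extension l ?_
  rw [← r'.h₁, ← Category.assoc, hr', r.h₁]

/-! ### Derived adjunctions in which one adjoint is exact -/

section Adjunction

variable {ℬ : Type*} [Category.{v} ℬ] [Abelian ℬ] [HasDerivedCategory.{w₂} ℬ]
  {L : 𝒜 ⥤ ℬ} {R : ℬ ⥤ 𝒜} [L.Additive] [R.Additive] (adj : L ⊣ R)

section Unit

variable [PreservesFiniteLimits R] [PreservesFiniteColimits R]

/-- The derived unit of an adjunction with exact right adjoint. -/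
noncomputable def derivedUnit (X : CochainComplex 𝒜 ℤ) :
    Q.obj X ⟶ R.mapDerivedCategory.obj (Q.obj ((onComplexes L).obj X)) :=
  Q.map (adj.onComplexes.unit.app X) ≫ R.mapDerivedCategoryFactors.inv.app _

lemma derivedUnit_comp (X : CochainComplex 𝒜 ℤ) {Y : CochainComplex ℬ ℤ}
    (g : (onComplexes L).obj X ⟶ Y) :
    derivedUnit adj X ≫ R.mapDerivedCategory.map (Q.map g) =
      Q.map (adj.onComplexes.homEquiv _ _ g) ≫ R.mapDerivedCategoryFactors.inv.app Y := by
  rw [Adjunction.homEquiv_unit, Q.map_comp, Category.assoc, derivedUnit, Category.assoc]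
  exact congrArg _ (R.mapDerivedCategoryFactors.inv.naturality g).symm

/-- For `Z` represented by an injective fibrant `Y`, both sides are homotopy classes: on the left
because `Y` is K-injective, on the right by `hX`. The adjunction of complexes respects homotopies.
Exactness of `L` is replaced by `hX`. -/
lemma derivedUnit_bijective [IsGrothendieckAbelian.{v} ℬ] (X : CochainComplex 𝒜 ℤ)
    (hX : ∀ Y : CochainComplex ℬ ℤ, IsInjectiveFibrant Y →
      HomIsHomotopyClass X ((onComplexes R).obj Y)) (Z : DerivedCategory ℬ) :
    Function.Bijective fun f : Q.obj ((onComplexes L).obj X) ⟶ Z =>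
      derivedUnit adj X ≫ R.mapDerivedCategory.map f := by
  obtain ⟨Y, hY, ⟨e⟩⟩ := exists_Q_iso_isInjectiveFibrant Z
  have := CochainComplex.IsInjectiveFibrant.isKInjective hY
  constructor
  · suffices ∀ f : Q.obj ((onComplexes L).obj X) ⟶ Z,
        derivedUnit adj X ≫ R.mapDerivedCategory.map f = 0 → f = 0 from fun f f' h =>
      sub_eq_zero.1 (this _ (by
        rw [Functor.map_sub, Preadditive.comp_sub]; exact sub_eq_zero.2 h))
    intro f hf
    obtain ⟨g, hg⟩ := exists_Q_map_eq_of_isKInjective (f ≫ e.hom)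
    have h1 : Q.map (adj.onComplexes.homEquiv _ _ g) = 0 := by
      rw [← cancel_mono (R.mapDerivedCategoryFactors.inv.app Y), ← derivedUnit_comp, hg,
        Functor.map_comp, ← Category.assoc, hf, zero_comp, zero_comp]
    obtain ⟨h2⟩ := (hX Y hY).homotopy _ h1
    have h3 : Q.map g = 0 := by
      apply Q_map_eq_zero_of_homotopy
      rw [← (adj.onComplexes.homEquiv _ _).symm_apply_apply g, Adjunction.homEquiv_counit]
      exact ⟨((L.mapHomotopy h2).compRight _).trans
        (Homotopy.ofEq (by rw [Functor.map_zero, zero_comp]))⟩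
    rw [← cancel_mono e.hom, ← hg, h3, zero_comp]
  · intro f
    obtain ⟨g, hg⟩ := (hX Y hY).surj
      (f ≫ R.mapDerivedCategory.map e.hom ≫ R.mapDerivedCategoryFactors.hom.app Y)
    refine ⟨Q.map ((adj.onComplexes.homEquiv _ _).symm g) ≫ e.inv, ?_⟩
    dsimp only
    rw [Functor.map_comp, ← Category.assoc, derivedUnit_comp, Equiv.apply_symm_apply, hg]
    simp only [Category.assoc, Iso.hom_inv_id_app_assoc, ← Functor.map_comp, Iso.hom_inv_id]
    exact (congrArg _ (CategoryTheory.Functor.map_id _ _)).trans (Category.comp_id f)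

end Unit

section Counit

variable [PreservesFiniteLimits L] [PreservesFiniteColimits L]

/-- The exact functor `L` preserves acyclicity, and null-homotopies can be transposed. -/
lemma isKInjective_onComplexes_obj (adj : L ⊣ R) (K : CochainComplex ℬ ℤ) [K.IsKInjective] :
    ((onComplexes R).obj K).IsKInjective where
  nonempty_homotopy_zero {X} f hX := by
    have hLX : ((onComplexes L).obj X).Acyclic := by
      intro n
      have := hX n
      rw [HomologicalComplex.exactAt_iff] at this ⊢
      exact this.map L
    obtain ⟨h⟩ := CochainComplex.IsKInjective.nonempty_homotopy_zero
      ((adj.onComplexes.homEquiv _ _).symm f) hLX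
    rw [← (adj.onComplexes.homEquiv _ _).apply_symm_apply f, Adjunction.homEquiv_unit]
    exact ⟨((R.mapHomotopy h).compLeft _).trans
        (Homotopy.ofEq (by rw [Functor.map_zero, comp_zero]))⟩

/-- The derived counit of an adjunction with exact left adjoint. -/
noncomputable def derivedCounit (K : CochainComplex ℬ ℤ) :
    L.mapDerivedCategory.obj (Q.obj ((onComplexes R).obj K)) ⟶ Q.obj K :=
  L.mapDerivedCategoryFactors.hom.app _ ≫ Q.map (adj.onComplexes.counit.app K)

lemma derivedCounit_naturality {K K' : CochainComplex ℬ ℤ} (f : K ⟶ K') :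
    L.mapDerivedCategory.map (Q.map ((onComplexes R).map f)) ≫ derivedCounit adj K' =
      derivedCounit adj K ≫ Q.map f := by
  have h := L.mapDerivedCategoryFactors_hom_naturality ((onComplexes R).map f)
  rw [derivedCounit, derivedCounit, ← Category.assoc, h, Category.assoc, Category.assoc,
    ← Q.map_comp, ← Q.map_comp]
  exact congrArg (fun t => _ ≫ Q.map t) (adj.onComplexes.counit.naturality f)

lemma comp_derivedCounit (K : CochainComplex ℬ ℤ) {X : CochainComplex 𝒜 ℤ}
    (g : X ⟶ (onComplexes R).obj K) :
    L.mapDerivedCategory.map (Q.map g) ≫ derivedCounit adj K =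
      L.mapDerivedCategoryFactors.hom.app X ≫ Q.map ((adj.onComplexes.homEquiv _ _).symm g) := by
  rw [Adjunction.homEquiv_counit, Q.map_comp, derivedCounit, ← Category.assoc,
    L.mapDerivedCategoryFactors_hom_naturality, Category.assoc]

lemma derivedCounit_bijective (K : CochainComplex ℬ ℤ) [K.IsKInjective] (X : DerivedCategory 𝒜) :
    Function.Bijective fun f : X ⟶ Q.obj ((onComplexes R).obj K) =>
      L.mapDerivedCategory.map f ≫ derivedCounit adj K := by
  have := isKInjective_onComplexes_obj adj K
  let Y := Q.objPreimage X
  let e : Q.obj Y ≅ X := Q.objObjPreimageIso X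
  constructor
  · suffices ∀ f : X ⟶ Q.obj ((onComplexes R).obj K),
        L.mapDerivedCategory.map f ≫ derivedCounit adj K = 0 → f = 0 from fun f f' h =>
      sub_eq_zero.1 (this _ (by
        rw [Functor.map_sub, Preadditive.sub_comp]; exact sub_eq_zero.2 h))
    intro f hf
    obtain ⟨g, hg⟩ := exists_Q_map_eq_of_isKInjective (e.hom ≫ f)
    have h1 : Q.map ((adj.onComplexes.homEquiv _ _).symm g) = 0 := by
      rw [← cancel_epi (L.mapDerivedCategoryFactors.hom.app Y), ← comp_derivedCounit, hg,
        Functor.map_comp, Category.assoc, hf, comp_zero, comp_zero]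
    obtain ⟨h2⟩ := homotopy_of_isKInjective h1
    have h3 : Q.map g = 0 := by
      apply Q_map_eq_zero_of_homotopy
      rw [← (adj.onComplexes.homEquiv _ _).apply_symm_apply g, Adjunction.homEquiv_unit]
      exact ⟨((R.mapHomotopy h2).compLeft _).trans
        (Homotopy.ofEq (by rw [Functor.map_zero, comp_zero]))⟩
    rw [← cancel_epi e.hom, ← hg, h3, comp_zero]
  · intro f
    obtain ⟨g, hg⟩ := exists_Q_map_eq_of_isKInjective
      (L.mapDerivedCategoryFactors.inv.app Y ≫ L.mapDerivedCategory.map e.hom ≫ f)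
    refine ⟨e.inv ≫ Q.map (adj.onComplexes.homEquiv _ _ g), ?_⟩
    dsimp only
    rw [Functor.map_comp, Category.assoc, comp_derivedCounit, Equiv.symm_apply_apply, hg]
    rw [Iso.hom_inv_id_app_assoc, ← Category.assoc, ← Functor.map_comp, Iso.inv_hom_id,
      CategoryTheory.Functor.map_id, Category.id_comp]

end Counit

end Adjunction

end DerivedCategory

/-! ### Restriction and right Kan extension of enriched functors -/

namespace EnrichedDerived

namespace VFun

noncomputable section

open MonoidalCategory MonoidalClosed

variable {V : Type u} [Category.{v} V] [MonoidalCategory V] [MonoidalClosed V]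
  [SymmetricCategory V] [Abelian V]

attribute [local instance] monoidalPreadditive

variable {C : Type v} [EnrichedCategory V C] {A : Set C} [HasLimitsOfSize.{v, v} V]

section

variable (H : VFun V A)

/-- The evaluation of the end at the identity of `b`. -/
def ranCounitVal (b : A) : ranVal H (b : C) ⟶ H.obj b :=
  (ρ_ _).inv ≫ _ ◁ eId V (b : C) ≫ ranEv H (b : C) b

lemma ranAct_counitVal (c : C) (b : A) :
    ranAct H c (b : C) ≫ ranCounitVal H b = ranEv H c b := by
  have e := e_comp_id V c (b : C)
  rw [Iso.inv_comp_eq, Category.comp_id] at e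
  rw [ranCounitVal, rightUnitor_inv_naturality_assoc, ← whisker_exchange_assoc, ranAct_ev,
    associator_naturality_right_assoc, ← MonoidalCategory.whiskerLeft_comp_assoc, e]
  simp

lemma ranCounitVal_act (b b' : A) :
    ranCounitVal H b ▷ ((b : C) ⟶[V] (b' : C)) ≫ subAct H b b' = ranEv H (b : C) b' := by
  have h := ranEv_nat H (b : C) b b'
  rw [Iso.inv_comp_eq] at h
  have e := e_id_comp V (b : C) (b' : C)
  rw [Iso.inv_comp_eq, Category.comp_id] at e
  rw [ranCounitVal, comp_whiskerRight, comp_whiskerRight, Category.assoc, Category.assoc, h,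
    associator_naturality_middle_assoc, ← MonoidalCategory.whiskerLeft_comp_assoc, e]
  simp

/-- The counit of the adjunction between restriction and right Kan extension. -/
def ranCounit : (restr V A).obj ((ran V A).obj H) ⟶ H where
  app b := ranCounitVal H b
  naturality b b' :=
    (congrArg (fun t => t ≫ ranCounitVal H b') (ranObj_act H (b : C) (b' : C))).trans
      ((ranAct_counitVal H (b : C) b').trans (ranCounitVal_act H b b').symm)

lemma isNat_subAct (b : A) : IsNat H (b : C) (fun b' => subAct H b b') := fun b' b'' =>
  (H.act_comp b b' b'').symm

lemma ranLift_subAct_counitVal (b : A) :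
    ranLift H (b : C) _ (isNat_subAct H b) ≫ ranCounitVal H b = 𝟙 _ := by
  rw [ranCounitVal, rightUnitor_inv_naturality_assoc, ← whisker_exchange_assoc, ranLift_ev,
    Iso.inv_comp_eq, Category.comp_id]
  exact H.act_id b

lemma ranCounitVal_ranLift_subAct (b : A) :
    ranCounitVal H b ≫ ranLift H (b : C) _ (isNat_subAct H b) = 𝟙 _ := by
  refine ran_hom_ext H _ fun b' => ?_
  rw [comp_whiskerRight, Category.assoc, ranLift_ev, ranCounitVal_act, id_whiskerRight,
    Category.id_comp]

/-- This is the enriched Yoneda lemma: as `A` is full, evaluation of the end at the identity of `b`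
is inverse to the action on `H b`. -/
lemma isIso_ranCounit : IsIso (ranCounit H) :=
  isIso_of_app _ fun b => ⟨ranLift H (b : C) _ (isNat_subAct H b),
    ranCounitVal_ranLift_subAct H b, ranLift_subAct_counitVal H b⟩

end

section

variable {X : VFun V C} {H : VFun V A} (f : (restr V A).obj X ⟶ H)

/-- The components of a morphism from the restriction of `X`. -/
def restrApp (b : A) : X.obj (b : C) ⟶ H.obj b := Hom.app f b

lemma restrApp_nat (b b' : A) : X.act (b : C) (b' : C) ≫ restrApp f b' =
    restrApp f b ▷ ((b : C) ⟶[V] (b' : C)) ≫ subAct H b b' := Hom.naturality f b b'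

lemma isNat_restr (c : C) : IsNat H c (fun b => X.act c (b : C) ≫ restrApp f b) := by
  intro b b'
  rw [← Category.assoc (_ ◁ _), act_comp, comp_whiskerRight, Category.assoc, Category.assoc,
    Category.assoc, ← restrApp_nat]

/-- The components of the morphism to the right Kan extension that corresponds to `f`. -/
def ranHomVal (c : C) : X.obj c ⟶ ranVal H c :=
  ranLift H c _ (isNat_restr f c)

lemma ranHomVal_ev (c : C) (b : A) :
    ranHomVal f c ▷ _ ≫ ranEv H c b = X.act c (b : C) ≫ restrApp f b := ranLift_ev _ _ _ _ _

lemma ranHomVal_nat (c c' : C) :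
    X.act c c' ≫ ranHomVal f c' = ranHomVal f c ▷ (c ⟶[V] c') ≫ ranAct H c c' := by
  refine ran_hom_ext H _ fun b => ?_
  rw [comp_whiskerRight, comp_whiskerRight, Category.assoc, Category.assoc, ranHomVal_ev,
    ranAct_ev, associator_naturality_left_assoc, ← whisker_exchange_assoc, ranHomVal_ev,
    ← Category.assoc (_ ◁ _), act_comp]
  simp

/-- The morphism to the right Kan extension that corresponds to `f`. -/
def ranHom : X ⟶ (ran V A).obj H where
  app c := ranHomVal f c
  naturality c c' := (ranHomVal_nat f c c').trans
    (congrArg (fun t => ranHomVal f c ▷ (c ⟶[V] c') ≫ t) (ranObj_act H c c').symm)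

lemma ranHomVal_counitVal (b : A) : ranHomVal f (b : C) ≫ ranCounitVal H b = restrApp f b := by
  rw [ranCounitVal, rightUnitor_inv_naturality_assoc, ← whisker_exchange_assoc, ranHomVal_ev,
    Iso.inv_comp_eq, ← Category.assoc, act_id]

/-- The components of a morphism to the right Kan extension. -/
def toRanApp (g : X ⟶ (ran V A).obj H) (c : C) : X.obj c ⟶ ranVal H c := Hom.app g c

lemma toRanApp_nat (g : X ⟶ (ran V A).obj H) (c c' : C) :
    X.act c c' ≫ toRanApp g c' = toRanApp g c ▷ (c ⟶[V] c') ≫ ranAct H c c' :=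
  (Hom.naturality g c c').trans
    (congrArg (fun t => toRanApp g c ▷ (c ⟶[V] c') ≫ t) (ranObj_act H c c'))

lemma ranHomVal_of_toRanApp (g : X ⟶ (ran V A).obj H)
    (h : ∀ b : A, restrApp f b = toRanApp g (b : C) ≫ ranCounitVal H b) (c : C) :
    ranHomVal f c = toRanApp g c := by
  refine ran_hom_ext H _ fun b => ?_
  rw [ranHomVal_ev, h, ← Category.assoc, toRanApp_nat, Category.assoc, ranAct_counitVal]

lemma ranHomVal_comp_ranMapVal {H' : VFun V A} (h : H ⟶ H') (c : C) :
    ranHomVal (f ≫ h) c = ranHomVal f c ≫ ranMapVal h c := by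
  refine ran_hom_ext H' _ fun b => ?_
  rw [comp_whiskerRight, Category.assoc, ranMapVal_ev, ranHomVal_ev, ← Category.assoc,
    ranHomVal_ev, Category.assoc]
  rfl

end

variable (V A) in
/-- Right Kan extension is right adjoint to restriction. -/
def restrRanAdj : restr V A ⊣ ran V A :=
  Adjunction.mkOfHomEquiv
    { homEquiv X H :=
        { toFun f := ranHom f
          invFun g := (restr V A).map g ≫ ranCounit H
          left_inv f := by
            ext b
            exact ranHomVal_counitVal f b
          right_inv g := by
            ext c
            exact ranHomVal_of_toRanApp _ g (fun b => rfl) c }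
      homEquiv_naturality_left_symm f g := by
        rw [Equiv.coe_fn_symm_mk, Functor.map_comp, Category.assoc]
        rfl
      homEquiv_naturality_right f g := by
        ext c
        exact ranHomVal_comp_ranMapVal f g c }

instance (H : VFun V A) : IsIso ((restrRanAdj V A).counit.app H) := by
  have : (restrRanAdj V A).counit.app H = ranCounit H := by
    change (restr V A).map (𝟙 _) ≫ ranCounit H = _
    exact (congrArg (fun t => t ≫ ranCounit H) (CategoryTheory.Functor.map_id _ _)).trans
      (Category.id_comp _)
  rw [this]
  exact isIso_ranCounit H

end

end VFun

end EnrichedDerived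

/-! ### Construction of recollements -/

namespace CategoryTheory

open Pretriangulated

namespace Adjunction

variable {𝒟 ℰ : Type*} [Category* 𝒟] [Category* ℰ]

/-- A functor has a left adjoint if there is a universal arrow from each object. -/
lemma exists_of_universal_left {G : ℰ ⥤ 𝒟} (obj : 𝒟 → ℰ) (u : ∀ X, X ⟶ G.obj (obj X))
    (h : ∀ X Y, Function.Bijective fun f : obj X ⟶ Y => u X ≫ G.map f) :
    ∃ F : 𝒟 ⥤ ℰ, Nonempty (F ⊣ G) :=
  ⟨_, ⟨adjunctionOfEquivLeft (F_obj := obj) (fun X Y => Equiv.ofBijective _ (h X Y))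
    (fun X Y Y' g k => by
      change u X ≫ G.map (k ≫ g) = (u X ≫ G.map k) ≫ G.map g
      rw [G.map_comp, Category.assoc])⟩⟩

/-- A functor has a right adjoint if there is a universal arrow to each object. -/
lemma exists_of_universal_right {F : 𝒟 ⥤ ℰ} (obj : ℰ → 𝒟) (v : ∀ Y, F.obj (obj Y) ⟶ Y)
    (h : ∀ X Y, Function.Bijective fun f : X ⟶ obj Y => F.map f ≫ v Y) :
    ∃ (G : ℰ ⥤ 𝒟) (adj : F ⊣ G), ∀ Y, (∀ (_ : IsIso (v Y)), IsIso (adj.counit.app Y)) := by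
  let e := fun X Y => (Equiv.ofBijective _ (h X Y)).symm
  have he : ∀ X' X Y (f : X' ⟶ X) (g : F.obj X ⟶ Y), e X' Y (F.map f ≫ g) = f ≫ e X Y g := by
    intro X' X Y f g
    obtain ⟨g, rfl⟩ := (h X Y).2 g
    rw [Equiv.symm_apply_eq]
    change F.map f ≫ F.map g ≫ v Y = F.map (f ≫ (Equiv.ofBijective _ (h X Y)).symm
      (Equiv.ofBijective _ (h X Y) g)) ≫ v Y
    rw [Equiv.symm_apply_apply, F.map_comp, Category.assoc]
  refine ⟨_, adjunctionOfEquivRight (G_obj := obj) e he, fun Y hv => ?_⟩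
  have : (adjunctionOfEquivRight (G_obj := obj) e he).counit.app Y = v Y := by
    change F.map (𝟙 _) ≫ v Y = v Y
    rw [CategoryTheory.Functor.map_id, Category.id_comp]
  rwa [this]

end Adjunction

variable {𝒟 ℰ : Type*} [Category* 𝒟] [Category* ℰ]
    [Preadditive 𝒟] [Preadditive ℰ] [HasZeroObject 𝒟] [HasZeroObject ℰ]
    [HasShift 𝒟 ℤ] [HasShift ℰ ℤ]
    [∀ n : ℤ, (shiftFunctor 𝒟 n).Additive] [∀ n : ℤ, (shiftFunctor ℰ n).Additive]
    [Pretriangulated 𝒟] [Pretriangulated ℰ]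

lemma dist_unique_lift {X Y Z W : 𝒟} {f : X ⟶ Y} {g : Y ⟶ Z} {h : Z ⟶ X⟦(1 : ℤ)⟧}
    (hT : Triangle.mk f g h ∈ distTriang 𝒟) (h₁ : ∀ a : W ⟶ Z, a = 0)
    (h₂ : ∀ a : W⟦(1 : ℤ)⟧ ⟶ Z, a = 0) : Function.Bijective fun a : W ⟶ X => a ≫ f := by
  refine ⟨?_, fun a => ?_⟩
  · suffices ∀ a : W ⟶ X, a ≫ f = 0 → a = 0 from fun a a' haa' =>
      sub_eq_zero.1 (this _ (by rw [Preadditive.sub_comp]; exact sub_eq_zero.2 haa'))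
    intro a ha
    apply (shiftFunctor 𝒟 (1 : ℤ)).map_injective
    -- The obstruction to injectivity lies in `Hom(W, Z⟦-1⟧)`; after a shift and two rotations it
    -- becomes a morphism `W⟦1⟧ ⟶ Z`.
    obtain ⟨b, hb⟩ := dist_lift₂ (rot_of_distTriang _ (rot_of_distTriang _ hT)) (a⟦(1 : ℤ)⟧') (by
      change a⟦(1 : ℤ)⟧' ≫ (-f⟦(1 : ℤ)⟧') = 0
      rw [Preadditive.comp_neg, ← Functor.map_comp, ha, Functor.map_zero, neg_zero])
    rw [Functor.map_zero]
    exact hb.trans ((congrArg (fun t => t ≫ h) (h₂ b)).trans zero_comp)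
  · obtain ⟨b, hb⟩ := dist_lift₂ hT a (h₁ _)
    exact ⟨b, hb.symm⟩

lemma dist_unique_desc {X Y Z W : 𝒟} {f : X ⟶ Y} {g : Y ⟶ Z} {h : Z ⟶ X⟦(1 : ℤ)⟧}
    (hT : Triangle.mk f g h ∈ distTriang 𝒟) (h₁ : ∀ a : X ⟶ W, a = 0)
    (h₂ : ∀ a : X⟦(1 : ℤ)⟧ ⟶ W, a = 0) : Function.Bijective fun a : Z ⟶ W => g ≫ a := by
  refine ⟨?_, fun a => ?_⟩
  · suffices ∀ a : Z ⟶ W, g ≫ a = 0 → a = 0 from fun a a' haa' =>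
      sub_eq_zero.1 (this _ (by rw [Preadditive.comp_sub]; exact sub_eq_zero.2 haa'))
    intro a ha
    obtain ⟨b, hb⟩ := Triangle.yoneda_exact₃ _ hT a ha
    rw [hb]
    exact (congrArg (fun t => h ≫ t) (h₂ b)).trans comp_zero
  · obtain ⟨b, hb⟩ := dist_desc₂ hT a (h₁ _)
    exact ⟨b, hb.symm⟩

variable {r : 𝒟 ⥤ ℰ} [r.CommShift ℤ] [r.IsTriangulated] {rR : ℰ ⥤ 𝒟} (adj : r ⊣ rR)
  {E T : ObjectProperty 𝒟} [E.IsTriangulated] [E.IsClosedUnderIsomorphisms]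
  [T.IsTriangulated]

lemma isIso_map_unit [∀ Y, IsIso (adj.counit.app Y)] (X : 𝒟) : IsIso (r.map (adj.unit.app X)) := by
  rw [IsIso.eq_inv_of_inv_hom_id (adj.left_triangle_components X)]
  infer_instance

lemma isIso_map_of_isZero_map {X Y Z : 𝒟} {f : X ⟶ Y} {g : Y ⟶ Z} {h : Z ⟶ X⟦(1 : ℤ)⟧}
    (hT : Triangle.mk f g h ∈ distTriang 𝒟) (hZ : IsZero (r.obj Z)) : IsIso (r.map f) :=
  (Triangle.isZero₃_iff_isIso₁ _ (r.map_distinguished _ hT)).1 hZ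

lemma isZero_map_of_isIso_map {X Y Z : 𝒟} {f : X ⟶ Y} {g : Y ⟶ Z} {h : Z ⟶ X⟦(1 : ℤ)⟧}
    (hT : Triangle.mk f g h ∈ distTriang 𝒟) (hf : IsIso (r.map f)) : IsZero (r.obj Z) :=
  (Triangle.isZero₃_iff_isIso₁ _ (r.map_distinguished _ hT)).2 hf

/-- If `X` is left orthogonal to the kernel of a localization functor `r`, then `r` is bijective
on morphisms with source `X`. -/
lemma map_bijective_of_orthogonal [∀ Y, IsIso (adj.counit.app Y)] {X : 𝒟}
    (hX : ∀ Z (f : X ⟶ Z), IsZero (r.obj Z) → f = 0)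
    (hX' : ∀ Z (f : X⟦(1 : ℤ)⟧ ⟶ Z), IsZero (r.obj Z) → f = 0) (Y : 𝒟) :
    Function.Bijective (r.map : (X ⟶ Y) → (r.obj X ⟶ r.obj Y)) := by
  -- The cone of the unit is killed by `r`, so composition with the unit is bijective on morphisms
  -- from `X`; the adjunction turns this into `r.map`.
  obtain ⟨Z, g, h, hT⟩ := distinguished_cocone_triangle (adj.unit.app Y)
  have hZ := isZero_map_of_isIso_map hT (isIso_map_unit adj Y)
  have h1 := dist_unique_lift hT (fun a => hX Z a hZ) (fun a => hX' Z a hZ)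
  have : (r.map : (X ⟶ Y) → (r.obj X ⟶ r.obj Y)) =
      (adj.homEquiv X (r.obj Y)).symm ∘ fun a : X ⟶ Y => a ≫ adj.unit.app Y := by
    ext a
    simp [Adjunction.homEquiv_counit]
  rw [this]
  exact (Equiv.bijective _).comp h1

lemma map_bijective_of_generated (adj : r ⊣ rR) [∀ Y, IsIso (adj.counit.app Y)]
    (hE : ∀ X, E X ↔ IsZero (r.obj X)) (hTE : ∀ X Z (f : X ⟶ Z), T X → E Z → f = 0)
    {X : 𝒟} (hX : T X) (Y : 𝒟) :
    Function.Bijective (r.map : (X ⟶ Y) → (r.obj X ⟶ r.obj Y)) :=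
  map_bijective_of_orthogonal adj (fun _ f hZ => hTE _ _ f hX ((hE _).2 hZ))
    (fun _ f hZ => hTE _ _ f (T.le_shift 1 _ hX) ((hE _).2 hZ)) Y

/-- The restriction of the localization functor to the left orthogonal of its kernel is an
equivalence. -/
lemma isEquivalence_of_decomposition (adj : r ⊣ rR) [∀ Y, IsIso (adj.counit.app Y)]
    (hE : ∀ X, E X ↔ IsZero (r.obj X)) (hTE : ∀ X Z (f : X ⟶ Z), T X → E Z → f = 0)
    (hdec : ∀ X : 𝒟, ∃ (Y Z : 𝒟) (p : Y ⟶ X) (q : X ⟶ Z) (δ : Z ⟶ Y⟦(1 : ℤ)⟧),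
      Triangle.mk p q δ ∈ distTriang 𝒟 ∧ T Y ∧ E Z) :
    (T.ι ⋙ r).IsEquivalence where
  faithful := ⟨fun {X Y} f g h => by
    have := (map_bijective_of_generated adj hE hTE X.property Y.obj).1 h
    exact T.ι.map_injective this⟩
  full := ⟨fun {X Y} f => by
    obtain ⟨g, hg⟩ := (map_bijective_of_generated adj hE hTE X.property Y.obj).2 f
    obtain ⟨g, rfl⟩ := T.ι.map_surjective g
    exact ⟨g, hg⟩⟩
  essSurj := ⟨fun Y => by
    obtain ⟨X, Z, p, q, δ, hT, hX, hZ⟩ := hdec (rR.obj Y)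
    have := isIso_map_of_isZero_map hT ((hE Z).1 hZ)
    exact ⟨⟨X, hX⟩, ⟨asIso (r.map p) ≪≫ asIso (adj.counit.app Y)⟩⟩⟩

/-- By orthogonality, `q : X ⟶ Z` in the decomposition triangle is a universal arrow to `E`. -/
lemma exists_reflection (hTE : ∀ X Z (f : X ⟶ Z), T X → E Z → f = 0)
    (hdec : ∀ X : 𝒟, ∃ (Y Z : 𝒟) (p : Y ⟶ X) (q : X ⟶ Z) (δ : Z ⟶ Y⟦(1 : ℤ)⟧),
      Triangle.mk p q δ ∈ distTriang 𝒟 ∧ T Y ∧ E Z) :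
    ∃ iL : 𝒟 ⥤ E.FullSubcategory, Nonempty (iL ⊣ E.ι) := by
  choose Y Z p q δ hT hY hZ using hdec
  refine Adjunction.exists_of_universal_left (fun X => ⟨Z X, hZ X⟩) q fun X W => ?_
  have h1 := dist_unique_desc (hT X) (W := W.obj) (fun a => hTE _ _ a (hY X) W.property)
    (fun a => hTE _ _ a (T.le_shift 1 _ (hY X)) W.property)
  exact h1.comp (E.fullyFaithfulι.homEquiv (X := ⟨Z X, hZ X⟩) (Y := W)).bijective

/-- The fibre of the unit lies in the kernel `E` of `r`, and it is universal because objects of `E`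
have no nonzero morphisms to the image of `rR`. -/
lemma exists_coreflection (adj : r ⊣ rR) [∀ Y, IsIso (adj.counit.app Y)]
    (hE : ∀ X, E X ↔ IsZero (r.obj X)) :
    ∃ iR : 𝒟 ⥤ E.FullSubcategory, Nonempty (E.ι ⊣ iR) := by
  have hdec (X : 𝒟) : ∃ (W : 𝒟) (f : W ⟶ X) (h : rR.obj (r.obj X) ⟶ W⟦(1 : ℤ)⟧),
      Triangle.mk f (adj.unit.app X) h ∈ distTriang 𝒟 ∧ E W := by
    obtain ⟨W, f, h, hT⟩ := distinguished_cocone_triangle₁ (adj.unit.app X)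
    refine ⟨W, f, h, hT, (hE W).2 ?_⟩
    exact (Triangle.isZero₁_iff_isIso₂ _ (r.map_distinguished _ hT)).2 (isIso_map_unit adj X)
  choose W f h hT hW using hdec
  have orth (U : 𝒟) (hU : E U) (Y : ℰ) (a : U ⟶ rR.obj Y) : a = 0 := by
    apply (adj.homEquiv _ _).symm.injective
    exact ((hE U).1 hU).eq_of_src _ _
  obtain ⟨G, adj', -⟩ := Adjunction.exists_of_universal_right (F := E.ι)
    (fun X => ⟨W X, hW X⟩) f fun U X => by
      have h1 := dist_unique_lift (hT X) (W := U.obj) (orth _ U.property _)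
        (orth _ (E.le_shift 1 _ U.property) _)
      exact h1.comp (E.fullyFaithfulι.homEquiv (X := U) (Y := ⟨W X, hW X⟩)).bijective
  exact ⟨G, ⟨adj'⟩⟩

/-- With `F = T.ι ⋙ r`, one has `Hom(F⁻¹ Y, X) ≅ Hom(r F⁻¹ Y, r X) ≅ Hom(Y, r X)`, since `r` is
bijective on morphisms out of `T`. -/
lemma exists_left_adjoint (adj : r ⊣ rR) [∀ Y, IsIso (adj.counit.app Y)]
    (hE : ∀ X, E X ↔ IsZero (r.obj X)) (hTE : ∀ X Z (f : X ⟶ Z), T X → E Z → f = 0)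
    [(T.ι ⋙ r).IsEquivalence] : Nonempty ((T.ι ⋙ r).inv ⋙ T.ι ⊣ r) := by
  let F := T.ι ⋙ r
  let c : F.inv ⋙ F ≅ 𝟭 ℰ := F.asEquivalence.counitIso
  have hb (Y : ℰ) (X : 𝒟) : Function.Bijective
      fun f : T.ι.obj (F.inv.obj Y) ⟶ X => c.inv.app Y ≫ r.map f := by
    have h1 := map_bijective_of_generated adj hE hTE (F.inv.obj Y).property X
    exact ((c.symm.app Y).homFromEquiv (Z := r.obj X)).symm.bijective.comp h1
  exact ⟨Adjunction.mkOfHomEquiv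
    { homEquiv Y X := Equiv.ofBijective _ (hb Y X)
      homEquiv_naturality_left_symm {Y Y' X} f g := by
        rw [Equiv.symm_apply_eq]
        obtain ⟨g, rfl⟩ := (Equiv.ofBijective _ (hb Y' X)).surjective g
        rw [Equiv.symm_apply_apply]
        change f ≫ c.inv.app Y' ≫ r.map g = c.inv.app Y ≫ r.map (T.ι.map (F.inv.map f) ≫ g)
        have := c.inv.naturality f
        rw [r.map_comp, ← Category.assoc, ← Category.assoc]
        exact congrArg (fun t => t ≫ r.map g) this
      homEquiv_naturality_right {Y X X'} f g := by
        change c.inv.app Y ≫ r.map (f ≫ g) = (c.inv.app Y ≫ r.map f) ≫ r.map g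
        rw [r.map_comp, Category.assoc] }⟩

/-- A localization functor whose kernel has a left orthogonal complement gives a recollement. -/
theorem exists_recollement (adj : r ⊣ rR) [∀ Y, IsIso (adj.counit.app Y)]
    (hE : ∀ X, E X ↔ IsZero (r.obj X)) (hTE : ∀ X Z (f : X ⟶ Z), T X → E Z → f = 0)
    (hdec : ∀ X : 𝒟, ∃ (Y Z : 𝒟) (p : Y ⟶ X) (q : X ⟶ Z) (δ : Z ⟶ Y⟦(1 : ℤ)⟧),
      Triangle.mk p q δ ∈ distTriang 𝒟 ∧ T Y ∧ E Z) :
    ∃ (_ : (T.ι ⋙ r).IsEquivalence) (R : Recollement E.ι r),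
      Nonempty (R.rL ≅ (T.ι ⋙ r).inv ⋙ T.ι) := by
  have hF := isEquivalence_of_decomposition adj hE hTE hdec
  obtain ⟨iL, ⟨adjL⟩⟩ := exists_reflection hTE hdec
  obtain ⟨iR, ⟨adjR⟩⟩ := exists_coreflection adj hE
  obtain ⟨adj'⟩ := exists_left_adjoint adj hE hTE
  have : IsIso adj.counit := NatIso.isIso_of_isIso_app _
  -- Adjoints of triangulated functors are triangulated, for the shift structure transported along
  -- the adjunction.
  let := adjL.leftAdjointCommShift ℤ
  let := adjR.rightAdjointCommShift ℤ
  let := adj.rightAdjointCommShift ℤ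
  let := adj'.leftAdjointCommShift ℤ
  have := adjL.commShift_of_rightAdjoint ℤ
  have := adjR.commShift_of_leftAdjoint ℤ
  have := adj.commShift_of_leftAdjoint ℤ
  have := adj'.commShift_of_rightAdjoint ℤ
  exact ⟨hF,
    { iL := iL
      iR := iR
      rL := (T.ι ⋙ r).inv ⋙ T.ι
      rR := rR
      isTriangulated_iL := adjL.isTriangulated_leftAdjoint
      isTriangulated_iR := adjR.isTriangulated_rightAdjoint
      isTriangulated_rL := adj'.isTriangulated_leftAdjoint
      isTriangulated_rR := adj.isTriangulated_rightAdjoint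
      iL_adj := adjL
      adj_iR := adjR
      rL_adj := adj'
      adj_rR := adj
      full_i := inferInstance
      faithful_i := inferInstance
      full_rL := inferInstance
      faithful_rL := inferInstance
      full_rR := adj.fullyFaithfulROfIsIsoCounit.full
      faithful_rR := adj.fullyFaithfulROfIsIsoCounit.faithful
      image_eq_kernel X := by
        rw [← hE]
        exact ⟨fun ⟨Y, ⟨e⟩⟩ => E.prop_of_iso e Y.property, fun h => ⟨⟨X, h⟩, ⟨Iso.refl _⟩⟩⟩ }, ⟨Iso.refl _⟩⟩

end CategoryTheory

/-! ### The recollement of derived categories of enriched functors -/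

namespace DerivedCategory

variable {𝒜 : Type*} [Category* 𝒜] [Abelian 𝒜] [HasDerivedCategory.{w₁} 𝒜]
  {ℬ : Type*} [Category* ℬ] [Abelian ℬ] [HasDerivedCategory.{w₂} ℬ]

lemma isZero_iff (X : DerivedCategory 𝒜) :
    IsZero X ↔ ∀ n : ℤ, IsZero ((homologyFunctor 𝒜 n).obj X) := by
  refine ⟨fun h n => (homologyFunctor 𝒜 n).map_isZero h, fun h => ?_⟩
  have : IsIso (0 : X ⟶ X) := (isIso_iff 𝒜 _).2 fun n =>
    ⟨0, (h n).eq_of_src _ _, (h n).eq_of_src _ _⟩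
  rw [IsZero.iff_id_eq_zero, ← IsIso.hom_inv_id (0 : X ⟶ X), zero_comp]

variable (F : 𝒜 ⥤ ℬ) [F.Additive] [PreservesFiniteLimits F] [PreservesFiniteColimits F]

lemma isZero_homology_map_iff (X : DerivedCategory 𝒜) (n : ℤ) :
    IsZero ((homologyFunctor ℬ n).obj (F.mapDerivedCategory.obj X)) ↔
      IsZero (F.obj ((homologyFunctor 𝒜 n).obj X)) := by
  let Y := Q.objPreimage X
  let e : Q.obj Y ≅ X := Q.objObjPreimageIso X
  let e₁ : (homologyFunctor ℬ n).obj (F.mapDerivedCategory.obj X) ≅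
      ((onComplexes F).obj Y).homology n :=
    (homologyFunctor ℬ n).mapIso (F.mapDerivedCategory.mapIso e.symm ≪≫
      F.mapDerivedCategoryFactors.app Y) ≪≫ (homologyFunctorFactors ℬ n).app _
  let e₂ : F.obj ((homologyFunctor 𝒜 n).obj X) ≅ F.obj (Y.homology n) :=
    F.mapIso ((homologyFunctor 𝒜 n).mapIso e.symm ≪≫ (homologyFunctorFactors 𝒜 n).app _)
  let e₃ : ((onComplexes F).obj Y).homology n ≅ F.obj (Y.homology n) :=
    (Y.sc n).mapHomologyIso F
  exact (e₁ ≪≫ e₃ ≪≫ e₂.symm).isZero_iff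

end DerivedCategory

namespace CategoryTheory

lemma shift_orthogonal_iff {𝒟 : Type*} [Category* 𝒟] [Preadditive 𝒟] [HasShift 𝒟 ℤ]
    [∀ n : ℤ, (shiftFunctor 𝒟 n).Additive] (G X : 𝒟) :
    (∀ (n : ℤ) (f : G⟦n⟧ ⟶ X), f = 0) ↔ ∀ (n : ℤ) (f : G ⟶ X⟦n⟧), f = 0 := by
  constructor
  · intro h n f
    obtain ⟨f, rfl⟩ := ((shiftEquiv 𝒟 n).symm.toAdjunction.homEquiv _ _).surjective f
    rw [show f = 0 from h (-n) f, Adjunction.homEquiv_unit, Functor.map_zero, comp_zero]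
    rfl
  · intro h n f
    obtain ⟨f, rfl⟩ := ((shiftEquiv 𝒟 n).toAdjunction.homEquiv _ _).symm.surjective f
    rw [show f = 0 from h (-n) f, Adjunction.homEquiv_counit, Functor.map_zero, zero_comp]
    rfl

end CategoryTheory

namespace EnrichedDerived

open HomotopicalAlgebra DerivedCategory Pretriangulated

variable {V : Type u} [Category.{v} V] [MonoidalCategory V] [SymmetricCategory V]
  [MonoidalClosed V] [Abelian V] [HasDerivedCategory.{w₁} V]
  {C : Type v} [EnrichedCategory V C] [HasDerivedCategory.{w₂} (VFun V C)]
  {A : Set C} [HasDerivedCategory.{w₃} (VFun V A)]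

lemma acyclicOn_iff_isZero_ev (X : DerivedCategory (VFun V C)) :
    acyclicOn A X ↔ ∀ a : A, IsZero ((VFun.ev V (a : C)).mapDerivedCategory.obj X) :=
  forall_congr' fun _ => (isZero_iff _).symm

/-- Evaluation and restriction are exact, so both sides say that the homology of `X` vanishes at
every `a ∈ A`. -/
lemma acyclicOn_iff_isZero_restrDerived (X : DerivedCategory (VFun V C)) :
    acyclicOn A X ↔ IsZero ((restrDerived V A).obj X) := by
  rw [isZero_iff]
  constructor
  · intro h n
    rw [isZero_homology_map_iff]
    exact VFun.isZero_of_ev _ fun a => (isZero_homology_map_iff _ X n).1 (h a n)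
  · intro h a n
    rw [isZero_homology_map_iff]
    exact (VFun.ev V a).map_isZero ((isZero_homology_map_iff _ X n).1 (h n))

variable {J : Type v} {P Q : J → CochainComplex V ℤ}

lemma GeneratorCondition.nonempty_iso (hQ : GeneratorCondition C P Q) (j : J) :
    Nonempty (DerivedCategory.Q.obj (Q j) ≅ DerivedCategory.Q.obj (P j)) := by
  obtain ⟨-, rfl⟩ | ⟨-, rfl⟩ | ⟨_, hW, -, h⟩ := hQ
  · exact ⟨Iso.refl _⟩
  · exact ⟨Iso.refl _⟩
  · obtain ⟨-, ⟨q, hq⟩, -⟩ := h j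
    have : QuasiIso q := by
      rw [weakEquivalence_iff, hW] at hq
      exact hq
    exact ⟨asIso (DerivedCategory.Q.map q)⟩

variable [IsGrothendieckAbelian.{v} V]

/-- The three alternatives are used only here and for `Q j ≅ P j` in `D(V)`: the source is
K-projective, or the target is K-injective, or they are cofibrant and fibrant. -/
lemma GeneratorCondition.homIsHomotopyClass (hQ : GeneratorCondition C P Q) (j : J) (c : C)
    (Y : CochainComplex (VFun V C) ℤ) (hY : IsInjectiveFibrant Y) :
    HomIsHomotopyClass (Q j) (evalAt Y c) := by
  obtain ⟨h, rfl⟩ | ⟨h, rfl⟩ | ⟨_, hW, hF, h⟩ := hQ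
  · have := h j
    exact homIsHomotopyClass_of_isKProjective _ _
  · have := h Y (CochainComplex.IsInjectiveFibrant.isKInjective hY) c
    exact homIsHomotopyClass_of_isKInjective _ _
  · obtain ⟨_, -, _⟩ := h j
    have := hF Y hY c
    exact homIsHomotopyClass_of_modelCategory hW _ _

/-- The object `C(c, -) ⊘ X` of the derived category. -/
noncomputable abbrev reprTensorDerived (c : C) (X : CochainComplex V ℤ) :
    DerivedCategory (VFun V C) :=
  DerivedCategory.Q.obj (reprTensorComplex c X)

lemma GeneratorCondition.derivedUnit_bijective (hQ : GeneratorCondition C P Q) (j : J) (c : C)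
    (X : DerivedCategory (VFun V C)) :
    Function.Bijective fun f : reprTensorDerived c (Q j) ⟶ X =>
      derivedUnit (VFun.reprAdj V c) (Q j) ≫ (VFun.ev V c).mapDerivedCategory.map f :=
  DerivedCategory.derivedUnit_bijective (VFun.reprAdj V c) (Q j)
    (fun Y hY => hQ.homIsHomotopyClass j c Y hY) X

/-- The object represents `Hom(Q j, X(c))`, where `Q j ≅ P j` is compact and evaluation preserves
coproducts. -/
lemma isCompactObject_reprTensorComplex
    (hP : IsCompactGenerators fun j => DerivedCategory.Q.obj (P j))
    (hQ : GeneratorCondition C P Q) (j : J) (c : C) :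
    IsCompactObject.{v} (reprTensorDerived c (Q j)) := by
  obtain ⟨e⟩ := hQ.nonempty_iso j
  exact IsCompactObject.of_corepresents
    (fun K => preservesCoproducts_mapDerivedCategory (VFun.ev V c) K) _
    (hQ.derivedUnit_bijective j c)
    ((isCompactObject_of_preservesCoproducts (hP.1 j)).of_iso e.symm)

/-- Orthogonality to the shifts says that `Hom(P j, X(a)⟦n⟧) = 0` for all `j` and `n`, that is,
`X(a) = 0`, because the `P j` generate `D(V)`. -/
lemma orthogonal_reprTensorComplex_iff
    (hP : IsCompactGenerators fun j => DerivedCategory.Q.obj (P j))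
    (hQ : GeneratorCondition C P Q) (X : DerivedCategory (VFun V C)) :
    (∀ (a : A) (j : J) (n : ℤ)
      (f : (reprTensorDerived (a : C) (Q j))⟦n⟧ ⟶ X), f = 0) ↔
      acyclicOn A X := by
  rw [acyclicOn_iff_isZero_ev]
  refine forall_congr' fun a => ?_
  let R := (VFun.ev V (a : C)).mapDerivedCategory
  constructor
  · intro h
    refine hP.2 _ fun j n f => ?_
    obtain ⟨e⟩ := hQ.nonempty_iso j
    obtain ⟨g, hg⟩ := (hQ.derivedUnit_bijective j (a : C) (X⟦n⟧)).2
      (e.hom ≫ f ≫ (R.commShiftIso n).inv.app X)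
    have hg0 : g = 0 := (shift_orthogonal_iff _ _).1 (h j) n g
    rw [← cancel_epi e.hom, ← cancel_mono ((R.commShiftIso n).inv.app X), Category.assoc, ← hg,
      hg0]
    simp
  · intro h j
    rw [shift_orthogonal_iff]
    intro n f
    apply (hQ.derivedUnit_bijective j (a : C) (X⟦n⟧)).1
    have h0 : IsZero (R.obj (X⟦n⟧)) :=
      ((shiftFunctor (DerivedCategory V) n).map_isZero h).of_iso ((R.commShiftIso n).app X)
    exact h0.eq_of_tgt _ _

lemma exists_triangle_generatedBy
    (hP : IsCompactGenerators fun j => DerivedCategory.Q.obj (P j))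
    (hQ : GeneratorCondition C P Q) (X : DerivedCategory (VFun V C)) :
    ∃ (Y Z : DerivedCategory (VFun V C)) (p : Y ⟶ X) (q : X ⟶ Z) (δ : Z ⟶ Y⟦(1 : ℤ)⟧),
      Triangle.mk p q δ ∈ distTriang _ ∧ generatedBy A Q Y ∧ acyclicOn A Z := by
  -- All shifts are included so that the family is closed under desuspension.
  let G : A × J × ℤ → DerivedCategory (VFun V C) := fun i =>
    (reprTensorDerived (i.1 : C) (Q i.2.1))⟦i.2.2⟧
  have hS : IsLocalizing.{w₂, v} (generatedBy (C := C) A Q) := isLocalizing_localizingClosure _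
  have := hS.1
  obtain ⟨Y, Z, p, q, δ, hT, hY, hZ⟩ := exists_distinguished_triangle_of_compact (G := G) hS
    (fun i => ObjectProperty.le_shift (generatedBy (C := C) A Q) i.2.2 _
      (le_localizingClosure (fun p : A × J =>
        reprTensorDerived (p.1 : C) (Q p.2)) (i.1, i.2.1)))
    (fun i => (isCompactObject_reprTensorComplex hP hQ i.2.1 (i.1 : C)).shift i.2.2)
    (fun i => ⟨(i.1, i.2.1, i.2.2 - 1),
      ⟨(shiftFunctorAdd' _ (i.2.2 - 1) 1 i.2.2 (by lia)).app _⟩⟩) X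
  exact ⟨Y, Z, p, q, δ, hT, hY, (orthogonal_reprTensorComplex_iff hP hQ Z).1
    fun a j n => hZ (a, j, n)⟩

lemma eq_zero_of_generatedBy
    (hP : IsCompactGenerators fun j => DerivedCategory.Q.obj (P j))
    (hQ : GeneratorCondition C P Q) {X Z : DerivedCategory (VFun V C)} (f : X ⟶ Z)
    (hX : generatedBy A Q X) (hZ : acyclicOn A Z) : f = 0 :=
  eq_zero_of_localizingClosure _ hX
    (fun p n => (orthogonal_reprTensorComplex_iff hP hQ Z).2 hZ p.1 p.2 n) f

/-- No K-injectivity is needed: the underived counit is already invertible in each degree. -/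
instance (K : CochainComplex (VFun V A) ℤ) :
    IsIso (derivedCounit (VFun.restrRanAdj V A) K) := by
  have : IsIso ((VFun.restrRanAdj V A).onComplexes.counit.app K) :=
    have : ∀ i, IsIso (((VFun.restrRanAdj V A).onComplexes.counit.app K).f i) := fun i =>
      inferInstanceAs (IsIso ((VFun.restrRanAdj V A).counit.app (K.X i)))
    HomologicalComplex.Hom.isIso_of_components _
  rw [derivedCounit]
  infer_instance

variable (V A) in
lemma exists_restrDerived_adj :
    ∃ (rR : DerivedCategory (VFun V A) ⥤ DerivedCategory (VFun V C))
      (adj : restrDerived V A ⊣ rR), ∀ Y, IsIso (adj.counit.app Y) := by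
  choose K hK e using fun Y : DerivedCategory (VFun V A) => exists_Q_iso_isInjectiveFibrant Y
  have hK' (Y) : (K Y).IsKInjective := CochainComplex.IsInjectiveFibrant.isKInjective (hK Y)
  obtain ⟨rR, adj, h⟩ := Adjunction.exists_of_universal_right (F := restrDerived V A)
    (fun Y => DerivedCategory.Q.obj ((onComplexes (VFun.ran V A)).obj (K Y)))
    (fun Y => derivedCounit (VFun.restrRanAdj V A) (K Y) ≫ (e Y).some.inv)
    (fun X Y => by
      have h1 := derivedCounit_bijective (VFun.restrRanAdj V A) (K Y) X
      simp only [← Category.assoc]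
      exact ((e Y).some.symm.homToEquiv).bijective.comp h1)
  exact ⟨rR, adj, fun Y => h Y inferInstance⟩

/-- The comparison of the degreewise right Kan extension with the right adjoint of the restriction
functor of derived categories. -/
lemma exists_ran_comparison {rR : DerivedCategory (VFun V A) ⥤ DerivedCategory (VFun V C)}
    (adj : restrDerived V A ⊣ rR) :
    ∃ α : onComplexes (VFun.ran V A) ⋙ DerivedCategory.Q ⟶ DerivedCategory.Q ⋙ rR,
      ∀ K : CochainComplex (VFun V A) ℤ, K.IsKInjective → IsIso (α.app K) := by
  let t (K : CochainComplex (VFun V A) ℤ) := derivedCounit (VFun.restrRanAdj V A) K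
  -- The comparison is the transpose of the derived counit. For K-injective `K` that counit is a
  -- universal arrow, so Yoneda makes the transpose invertible.
  refine ⟨{ app K := adj.homEquiv _ _ (t K)
            naturality K K' f := ?_ }, fun K hK => ?_⟩
  · have h := derivedCounit_naturality (VFun.restrRanAdj V A) f
    exact (adj.homEquiv_naturality_left _ _).symm.trans
      ((congrArg _ h).trans (adj.homEquiv_naturality_right _ _))
  · refine isIso_of_yoneda_map_bijective _ fun X => ?_
    have h := derivedCounit_bijective (VFun.restrRanAdj V A) K X
    have : (fun f : X ⟶ DerivedCategory.Q.obj ((onComplexes (VFun.ran V A)).obj K) =>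
        f ≫ adj.homEquiv _ _ (t K)) = adj.homEquiv _ _ ∘
          fun f => (restrDerived V A).map f ≫ t K := by
      ext f
      exact (adj.homEquiv_naturality_left _ _).symm
    exact this ▸ (Equiv.bijective _).comp h

end EnrichedDerived

theorem theorem4p11 {V : Type u} [Category.{v} V] [MonoidalCategory V] [SymmetricCategory V]
    [MonoidalClosed V] [Abelian V] [IsGrothendieckAbelian.{v} V] [HasDerivedCategory.{w₁} V]
    {C : Type v} [EnrichedCategory V C] [HasDerivedCategory.{w₂} (VFun V C)]
    (A : Set C) [HasDerivedCategory.{w₃} (VFun V A)]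
    {J : Type v} (P Q : J → CochainComplex V ℤ)
    (hP : IsCompactGenerators fun j => DerivedCategory.Q.obj (P j))
    (hQ : GeneratorCondition C P Q) :
    ∃ (_ : (restrGenerated (C := C) A Q).IsEquivalence)
      (R : Recollement (acyclicOn (V := V) (C := C) A).ι (restrDerived V A)),
      Nonempty (R.rL ≅ (restrGenerated (C := C) A Q).inv ⋙ (generatedBy (C := C) A Q).ι) ∧
      (∀ Y : CochainComplex (VFun V A) ℤ, ∃ (K : CochainComplex (VFun V A) ℤ) (k : Y ⟶ K),
        K.IsKInjective ∧ QuasiIso k) ∧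
      ∃ α : onComplexes (VFun.ran V A) ⋙ DerivedCategory.Q ⟶ DerivedCategory.Q ⋙ R.rR,
        ∀ K : CochainComplex (VFun V A) ℤ, K.IsKInjective → IsIso (α.app K) := by
  obtain ⟨rR, adj, hadj⟩ := exists_restrDerived_adj V A
  have hS : IsLocalizing.{w₂, v} (generatedBy (C := C) A Q) := isLocalizing_localizingClosure _
  have := hS.1
  obtain ⟨hF, R, hR⟩ := exists_recollement adj acyclicOn_iff_isZero_restrDerived
    (fun X Z f => eq_zero_of_generatedBy hP hQ f) (exists_triangle_generatedBy hP hQ)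
  refine ⟨hF, R, hR, fun Y => ?_, exists_ran_comparison R.adj_rR⟩
  obtain ⟨K, k, hk, hK⟩ := CochainComplex.exists_acyclicMono_isInjectiveFibrant Y
  exact ⟨K, k, CochainComplex.IsInjectiveFibrant.isKInjective hK, hk.2⟩
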